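/- Let $0<q<1$, $N\ge 1$, $\lambda=(\lambda_1,\dots,\lambda_N)\in\mathbb R^N$, $s,u,t,v\in\mathbb C^\times$, $\boldsymbol\alpha=(s,u,t,v,\lambda_1,\dots,\lambda_N)$, and $\mathbf x,\mathbf y\in(\mathbb C^\times)^N$. Put $x_{N+1}=s$, $y_0=t$, $\mu_s=\frac{s+s^{-1}}{q^{-1}-q}$, $(a;q^2)_\infty=\prod_{k\ge0}(1-aq^{2k})$, $\theta(a;q^2)=(a,q^2/a;q^2)_\infty$; several arguments, or $\pm$ in exponents, mean products. For $\lambda,\varepsilon\in\mathbb R$ let $$f_{x,s,u,\lambda,\varepsilon}(z)=\frac{(sq^{1-2i\lambda}x^{\pm1},\,uszq^{1+i\lambda};q^2)_\infty\,\theta(q^{2\varepsilon-i\lambda}uz/s;q^2)}{(uzq^{-i\lambda}x^{\pm1},\,sq^{1-i\lambda}/uz;q^2)_\infty},$$ $$f_{\mathbf x}(\mathbf z)=\prod_{j=1}^N f_{x_j,x_{j+1},u,\lambda_j,0}(z_j),\qquad \bar f^{\vartheta}_{\bar{\mathbf y}}(\mathbf z)=\prod_{j=1}^N f_{\bar y_j,\bar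 y_{j-1},\bar v,\lambda_j,0}(1/z_j).$$ With $g^\star(\mathbf z)=\overline{g(\bar z_1^{-1},\dots,\bar z_N^{-1})}$, the $N$-variable overlap coefficient (multivariate Askey–Wilson function) is $$\Phi_{\boldsymbol\alpha}(\mathbf x,\mathbf y)=\frac1{(2\pi i)^N}\int_{\mathcal C_1}\!\cdots\int_{\mathcal C_N} f_{\mathbf x}(\mathbf z)\,(\bar f^\vartheta_{\bar{\mathbf y}})^\star(\mathbf z)\,\frac{dz_N}{z_N}\cdots\frac{dz_1}{z_1},$$ where $\mathcal C_j$ is an admissible contour: a closed piecewise $C^1$ curve in $\mathbb C^\times$ that winds once (positively) around $0$, has the points $u^{-1}x_{j+1}q^{1-i\lambda_j+2k}$, $v^{-1}y_{j-1}q^{1+i\lambda_j+2k}$ ($k\in\mathbb Z_{\ge0}$) inside (off the curve, winding number $1$) and the points $u^{-1}q^{i\lambda_j-2k}x_j^{\pm1}$, $v^{-1}q^{-i\lambda_j-2k}y_j^{\pm1}$ ($k\in\mathbb Z_{\ge0}$) outside (off the curve, winding number $0$). Call $(\boldsymbol\alpha,\mathbf x,\mathbf y)$ generic if for each $j$ no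 point of the first kind equals one of the second kind. For $N=1$, with $f_{x,s,u,\lambda,\varepsilon}(z)$ and $f_{\bar y,\bar t,\bar v,\lambda,-\varepsilon}(1/z)$, the same formula defines the univariate overlap coefficient $\Phi_{s,u,t,v,\lambda,\varepsilon}(x,y)$. Then the following hold. **(o)** If $(\boldsymbol\alpha,\mathbf x,\mathbf y)$ is generic, admissible contours exist and $\Phi_{\boldsymbol\alpha}(\mathbf x,\mathbf y)$ does not depend on their choice. **(i)** If $(\boldsymbol\alpha,\mathbf x,\mathbf y)$ is generic, $\displaystyle\Phi_{\boldsymbol\alpha}(\mathbf x,\mathbf y)=\prod_{j=1}^N\Phi_{x_{j+1},u,y_{j-1},v,\lambda_j,0}(x_j,y_j)$. **(ii)** Let $\bar{\boldsymbol\alpha}=(\bar s,\bar u,\bar t,\bar v,\lambda_1,\dots,\lambda_N)$, $\boldsymbol\alpha^\vartheta=(t,v,s,u,\lambda_N,\dots,\lambda_1)$, $\hat{\mathbf x}=(x_N,\dots,x_1)$, $\hat{\mathbf y}=(y_N,\dots,y_1)$. If $(\bar{\boldsymbol\alpha},\bar{\mathbf x},\bar{\mathbf y})$ is generic, $\overline{\Phi_{\bar{\boldsymbol\alpha}}(\bar{\mathbf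 x},\bar{\mathbf y})}=\Phi_{\boldsymbol\alpha^\vartheta}(\hat{\mathbf y},\hat{\mathbf x})$. **(iii)** Let $1\le j\le N$. For $\nu\in\{-1,0,1\}^j$ set $\nu_{j+1}=0$ and let $T_\nu\mathbf x$ be $\mathbf x$ with $x_i$ replaced by $q^{2\nu_i}x_i$ for $i\le j$. Assume that $(\boldsymbol\alpha,T_\nu\mathbf x,\mathbf y)$ is generic for all $\nu\in\{-1,0,1\}^j$ and that $x_i^2\notin\{1,q^2,q^{-2}\}$ for $i\le j$. Then $$\mu_{y_j}\Phi_{\boldsymbol\alpha}(\mathbf x,\mathbf y)=\sum_{\nu\in\{-1,0,1\}^j}\mathcal C^{(j)}_\nu(\mathbf x)\,\Phi_{\boldsymbol\alpha}(T_\nu\mathbf x,\mathbf y)+\frac{(u/v+v/u)(x_{j+1}+x_{j+1}^{-1})}{q^{-2}-q^2}\,\Phi_{\boldsymbol\alpha}(\mathbf x,\mathbf y).$$ Here $\mathcal C_\nu^{(j)}(\mathbf x)=D_{\nu_1}(x_1)\prod_{i=1}^jC_{\nu,i}(\mathbf x)$ with $$D_{\nu_1}(x_1)=\begin{cases}-\dfrac{u\,x_1^{-\nu_1}}{vq}\,\dfrac{(1-vqx_1^{\nu_1}/ut)(1-vqtx_1^{\nu_1}/u)}{q^{-1}-q},&\nu_1\ne0,\\[2mm]\dfrac{(q^{-1}+q)(t+t^{-1})-(u/v+v/u)(x_1+x_1^{-1})}{q^{-2}-q^2},&\nu_1=0,\end{cases}$$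 $C_{\nu,i}(\mathbf x)=A^{[\nu_{i+1}]}_{x_{i+1},\lambda_i}(x_i^{\nu_i})$ if $\nu_i\ne0$ and $C_{\nu,i}(\mathbf x)=B^{[\nu_{i+1}]}_{x_{i+1},\lambda_i}(x_i)$ if $\nu_i=0$, where $$A^{[0]}_{s,\lambda}(x)=-\frac{x(1-sxq^{1-2i\lambda})(1-sxq^{1+2i\lambda})}{s(1-x^2)(1-q^2x^2)},\qquad B^{[0]}_{s,\lambda}(x)=-A^{[0]}_{s,\lambda}(x)-A^{[0]}_{s,\lambda}(x^{-1}),$$ $$A^{[-1]}_{s,\lambda}(x)=\frac{q^2x^2}{s^2(1-x^2)(1-q^2x^2)},\qquad B^{[-1]}_{s,\lambda}(x)=\frac{q^{-1}(q^{-1}+q)}{s^2(1-x^2/q^2)(1-1/x^2q^2)},$$ $$A^{[1]}_{s,\lambda}(x)=\frac{(1-sxq^{1-2i\lambda})(1-sxq^{3-2i\lambda})(1-sxq^{1+2i\lambda})(1-sxq^{3+2i\lambda})}{(1-x^2)(1-q^2x^2)},$$ $$B^{[1]}_{s,\lambda}(x)=\frac{q^{-1}(q^{-1}+q)(1-sxq^{1-2i\lambda})(1-sx^{-1}q^{1-2i\lambda})(1-sxq^{1+2i\lambda})(1-sx^{-1}q^{1+2i\lambda})}{(1-x^2/q^2)(1-1/x^2q^2)}.$$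 -/

import Mathlib

noncomputable section

namespace AWOverlap

open Complex

/-! Special functions -/

/-- The infinite shifted factorial `(a; b)_∞ = ∏_{k ≥ 0} (1 - a b^k)`. -/
def qPoch (a b : ℂ) : ℂ := ∏' k : ℕ, (1 - a * b ^ k)

/-- The theta function `θ(a; b) = (a, b/a; b)_∞`. -/
def qTheta (a b : ℂ) : ℂ := qPoch a b * qPoch (b / a) b

/-- `μ_s = (s + s⁻¹) / (q⁻¹ - q)`. -/
def mu (q : ℝ) (s : ℂ) : ℂ := (s + s⁻¹) / ((q : ℂ)⁻¹ - q)

/-! Univariate eigenfunctions -/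

/-- The eigenfunction
`f_x(z) = (s q^{1-2iλ} x^{±1}, u s z q^{1+iλ}; q²)_∞ θ(q^{2ε-iλ} u z / s; q²)
  / (u z q^{-iλ} x^{±1}, s q^{1-iλ} / (u z); q²)_∞`. -/
def eigFn (q : ℝ) (s u : ℂ) (lam eps : ℝ) (x z : ℂ) : ℂ :=
  (qPoch (s * (q : ℂ) ^ (1 - 2 * I * lam) * x) ((q : ℂ) ^ 2)
      * qPoch (s * (q : ℂ) ^ (1 - 2 * I * lam) * x⁻¹) ((q : ℂ) ^ 2)
      * qPoch (u * s * z * (q : ℂ) ^ (1 + I * lam)) ((q : ℂ) ^ 2)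
      * qTheta ((q : ℂ) ^ (2 * eps - I * lam) * u * z / s) ((q : ℂ) ^ 2))
    / (qPoch (u * z * (q : ℂ) ^ (-(I * lam)) * x) ((q : ℂ) ^ 2)
      * qPoch (u * z * (q : ℂ) ^ (-(I * lam)) * x⁻¹) ((q : ℂ) ^ 2)
      * qPoch (s * (q : ℂ) ^ (1 - I * lam) / (u * z)) ((q : ℂ) ^ 2))

/-- The eigenfunction `f_y^ϑ(z) = f_{y, t, v, λ, -ε}(1/z)`. -/
def eigFnTheta (q : ℝ) (t v : ℂ) (lam eps : ℝ) (y z : ℂ) : ℂ :=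
  eigFn q t v lam (-eps) y z⁻¹

/-! Contours -/

/-- A closed piecewise continuously differentiable curve in `ℂ`, parametrized by `[0, 1]`. -/
structure Contour where
  toFun : ℝ → ℂ
  closed : toFun 0 = toFun 1
  piecewise : ∃ (n : ℕ) (p : ℕ → ℝ), Monotone p ∧ p 0 = 0 ∧ p n = 1 ∧
    ∀ i < n, ContDiffOn ℝ 1 toFun (Set.Icc (p i) (p (i + 1)))

/-- The contour integral `∫_γ F(z) dz`. -/
def Contour.integral (γ : Contour) (F : ℂ → ℂ) : ℂ :=
  ∫ τ in (0 : ℝ)..1, F (γ.toFun τ) * deriv γ.toFun τ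

/-- The winding number of `γ` around `p` (meaningful if `p` is not on `γ`). -/
def Contour.winding (γ : Contour) (p : ℂ) : ℂ :=
  (2 * (Real.pi : ℂ) * I)⁻¹ * γ.integral fun z => (z - p)⁻¹

/-- The point `p` lies inside `γ`. -/
def Contour.Inside (γ : Contour) (p : ℂ) : Prop :=
  (∀ τ ∈ Set.Icc (0 : ℝ) 1, γ.toFun τ ≠ p) ∧ γ.winding p = 1

/-- The point `p` lies outside `γ`. -/
def Contour.Outside (γ : Contour) (p : ℂ) : Prop :=
  (∀ τ ∈ Set.Icc (0 : ℝ) 1, γ.toFun τ ≠ p) ∧ γ.winding p = 0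

/-- The poles `u⁻¹ s q^{1-iλ} q^{2k}` and `v⁻¹ t q^{1+iλ} q^{2k}`, `k ≥ 0`. -/
def innerPoles (q : ℝ) (s u t v : ℂ) (lam : ℝ) : Set ℂ :=
  {z | ∃ k : ℕ, z = u⁻¹ * s * (q : ℂ) ^ (1 - I * lam) * (q : ℂ) ^ (2 * k) ∨
    z = v⁻¹ * t * (q : ℂ) ^ (1 + I * lam) * (q : ℂ) ^ (2 * k)}

/-- The poles `u⁻¹ q^{iλ} x^{±1} q^{-2k}` and `v⁻¹ q^{-iλ} y^{±1} q^{-2k}`, `k ≥ 0`. -/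
def outerPoles (q : ℝ) (u v : ℂ) (lam : ℝ) (x y : ℂ) : Set ℂ :=
  {z | ∃ k : ℕ, z = u⁻¹ * (q : ℂ) ^ (I * lam) * x * ((q : ℂ) ^ (2 * k))⁻¹ ∨
    z = u⁻¹ * (q : ℂ) ^ (I * lam) * x⁻¹ * ((q : ℂ) ^ (2 * k))⁻¹ ∨
    z = v⁻¹ * (q : ℂ) ^ (-(I * lam)) * y * ((q : ℂ) ^ (2 * k))⁻¹ ∨
    z = v⁻¹ * (q : ℂ) ^ (-(I * lam)) * y⁻¹ * ((q : ℂ) ^ (2 * k))⁻¹}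

/-- `γ` is a deformation of the positively oriented unit circle in `ℂ \ {0}`
(it winds once around `0`) that has the inner poles inside and the outer poles outside. -/
def Admissible (q : ℝ) (s u t v : ℂ) (lam : ℝ) (x y : ℂ) (γ : Contour) : Prop :=
  γ.Inside 0 ∧ (∀ p ∈ innerPoles q s u t v lam, γ.Inside p) ∧
    ∀ p ∈ outerPoles q u v lam x y, γ.Outside p

/-! The univariate overlap coefficient -/

/-- `g^⋆(z) = conj (g (1 / conj z))`. -/
def star1 (g : ℂ → ℂ) (z : ℂ) : ℂ :=
  (starRingEnd ℂ) (g ((starRingEnd ℂ) z)⁻¹)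

/-- `⟨f, g⟩ = (2πi)⁻¹ ∫_γ f(z) g^⋆(z) dz / z`. -/
def pairing1 (γ : Contour) (f g : ℂ → ℂ) : ℂ :=
  (2 * (Real.pi : ℂ) * I)⁻¹ * γ.integral fun z => f z * star1 g z / z

open Classical in
/-- The univariate overlap coefficient
`Φ_{s,u,t,v,λ,ε}(x, y) = ⟨f_x, f^ϑ_{conj y, conj t, conj v}⟩`, computed with an admissible
contour (and `0` by convention if there is none). -/
def overlap1 (q : ℝ) (s u t v : ℂ) (lam eps : ℝ) (x y : ℂ) : ℂ :=
  if h : ∃ γ : Contour, Admissible q s u t v lam x y γ then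
    pairing1 h.choose (eigFn q s u lam eps x)
      (eigFnTheta q ((starRingEnd ℂ) t) ((starRingEnd ℂ) v) lam eps ((starRingEnd ℂ) y))
  else 0

/-! The multivariate overlap coefficient -/

/-- The tuple `(s, u, t, v, λ_1, …, λ_N)`. -/
structure Params (N : ℕ) where
  s : ℂ
  u : ℂ
  t : ℂ
  v : ℂ
  lam : Fin N → ℝ

/-- Complex conjugation `(conj s, conj u, conj t, conj v, λ_1, …, λ_N)`. -/
def Params.conj {N : ℕ} (α : Params N) : Params N :=
  ⟨(starRingEnd ℂ) α.s, (starRingEnd ℂ) α.u, (starRingEnd ℂ) α.t, (starRingEnd ℂ) α.v, α.lam⟩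

/-- The involution `(t, v, s, u, λ_N, …, λ_1)`. -/
def Params.theta {N : ℕ} (α : Params N) : Params N :=
  ⟨α.t, α.v, α.s, α.u, fun j => α.lam j.rev⟩

/-- Componentwise complex conjugation. -/
def conjVec {N : ℕ} (x : Fin N → ℂ) : Fin N → ℂ := fun j => (starRingEnd ℂ) (x j)

/-- The reversed tuple `(x_N, …, x_1)`. -/
def revVec {N : ℕ} (x : Fin N → ℂ) : Fin N → ℂ := fun j => x j.rev

/-- The entry following position `j` in `(x_1, …, x_N, e)`: it is `x_{j+1}`, with `x_{N+1} = e`. -/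
def next {R : Type} {N : ℕ} (e : R) (x : Fin N → R) (j : Fin N) : R :=
  (Fin.snoc (α := fun _ => R) x e : Fin (N + 1) → R) j.succ

/-- The entry preceding position `j` in `(e, y_1, …, y_N)`: it is `y_{j-1}`, with `y_0 = e`. -/
def prev {R : Type} {N : ℕ} (e : R) (y : Fin N → R) (j : Fin N) : R :=
  (Fin.cons (α := fun _ => R) e y : Fin (N + 1) → R) j.castSucc

/-- `f_x(z) = ∏_j f_{x_j, x_{j+1}, u, λ_j}(z_j)` with `x_{N+1} = s` (all `ε = 0`). -/
def eigFnN (q : ℝ) {N : ℕ} (s u : ℂ) (lam : Fin N → ℝ) (x z : Fin N → ℂ) : ℂ :=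
  ∏ j, eigFn q (next s x j) u (lam j) 0 (x j) (z j)

/-- `f_y^ϑ(z) = ∏_j f_{y_j, y_{j-1}, v, λ_j}(1/z_j)` with `y_0 = t` (all `ε = 0`). -/
def eigFnThetaN (q : ℝ) {N : ℕ} (t v : ℂ) (lam : Fin N → ℝ) (y z : Fin N → ℂ) : ℂ :=
  ∏ j, eigFnTheta q (prev t y j) v (lam j) 0 (y j) (z j)

/-- The iterated integral `∫_{C_1} ⋯ ∫_{C_n} F(z_1, …, z_n) dz_n/z_n ⋯ dz_1/z_1`. -/
def iterIntegral : (n : ℕ) → (Fin n → Contour) → ((Fin n → ℂ) → ℂ) → ℂ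
  | 0, _, F => F Fin.elim0
  | n + 1, C, F =>
      (C 0).integral fun z =>
        iterIntegral n (Fin.tail C) (fun w => F (Fin.cons z w : Fin (n + 1) → ℂ)) / z

/-- `g^⋆(z) = conj (g (1 / conj z_1, …, 1 / conj z_N))`. -/
def starN {N : ℕ} (g : (Fin N → ℂ) → ℂ) (z : Fin N → ℂ) : ℂ :=
  (starRingEnd ℂ) (g fun j => ((starRingEnd ℂ) (z j))⁻¹)

/-- `⟨f, g⟩ = (2πi)^{-N} ∫_{C_1} ⋯ ∫_{C_N} f(z) g^⋆(z) dz_N/z_N ⋯ dz_1/z_1`. -/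
def pairingN {N : ℕ} (C : Fin N → Contour) (f g : (Fin N → ℂ) → ℂ) : ℂ :=
  ((2 * (Real.pi : ℂ) * I) ^ N)⁻¹ * iterIntegral N C fun z => f z * starN g z

/-- The contours `C_1, …, C_N` are admissible for `α`, `x`, `y`. -/
def AdmissibleN (q : ℝ) {N : ℕ} (α : Params N) (x y : Fin N → ℂ) (C : Fin N → Contour) : Prop :=
  ∀ j, Admissible q (next α.s x j) α.u (prev α.t y j) α.v (α.lam j) (x j) (y j) (C j)

/-- No pole that has to be inside `C_j` coincides with one that has to be outside. -/
def Generic (q : ℝ) {N : ℕ} (α : Params N) (x y : Fin N → ℂ) : Prop :=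
  ∀ j, Disjoint (innerPoles q (next α.s x j) α.u (prev α.t y j) α.v (α.lam j))
    (outerPoles q α.u α.v (α.lam j) (x j) (y j))

/-- The pairing of `f_x` with `f^ϑ_{conj y, conj t, conj v}` over the contours `C`. -/
def overlapAlong (q : ℝ) {N : ℕ} (α : Params N) (x y : Fin N → ℂ) (C : Fin N → Contour) : ℂ :=
  pairingN C (eigFnN q α.s α.u α.lam x)
    (eigFnThetaN q α.conj.t α.conj.v α.conj.lam (conjVec y))

open Classical in
/-- The multivariate overlap coefficient `Φ_α(x, y)`, computed with admissible contours
(and `0` by convention if there are none). -/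
def overlapN (q : ℝ) {N : ℕ} (α : Params N) (x y : Fin N → ℂ) : ℂ :=
  if h : ∃ C : Fin N → Contour, AdmissibleN q α x y C then overlapAlong q α x y h.choose else 0

/-! The difference operators -/

/-- `A_{s,λ}(x)`. -/
def coefA (q : ℝ) (s : ℂ) (lam : ℝ) (x : ℂ) : ℂ :=
  -(x * (1 - s * x * (q : ℂ) ^ (1 - 2 * I * lam)) * (1 - s * x * (q : ℂ) ^ (1 + 2 * I * lam)))
    / (s * (1 - x ^ 2) * (1 - (q : ℂ) ^ 2 * x ^ 2))

/-- `B_{s,λ}(x)`. -/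
def coefB (q : ℝ) (s : ℂ) (lam : ℝ) (x : ℂ) : ℂ :=
  -coefA q s lam x - coefA q s lam x⁻¹

/-- `A^-_{s,λ}(x)` (it does not depend on `λ`). -/
def coefAminus (q : ℝ) (s x : ℂ) : ℂ :=
  x ^ 2 * (q : ℂ) ^ 2 / (s ^ 2 * (1 - x ^ 2) * (1 - (q : ℂ) ^ 2 * x ^ 2))

/-- `B^-_{s,λ}(x)` (it does not depend on `λ`). -/
def coefBminus (q : ℝ) (s x : ℂ) : ℂ :=
  (q : ℂ)⁻¹ * ((q : ℂ)⁻¹ + q)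
    / (s ^ 2 * (1 - x ^ 2 / (q : ℂ) ^ 2) * (1 - 1 / (x ^ 2 * (q : ℂ) ^ 2)))

/-- `A^+_{s,λ}(x)`. -/
def coefAplus (q : ℝ) (s : ℂ) (lam : ℝ) (x : ℂ) : ℂ :=
  (1 - s * x * (q : ℂ) ^ (1 - 2 * I * lam)) * (1 - s * x * (q : ℂ) ^ (3 - 2 * I * lam))
      * (1 - s * x * (q : ℂ) ^ (1 + 2 * I * lam)) * (1 - s * x * (q : ℂ) ^ (3 + 2 * I * lam))
    / ((1 - x ^ 2) * (1 - (q : ℂ) ^ 2 * x ^ 2))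

/-- `B^+_{s,λ}(x)`. -/
def coefBplus (q : ℝ) (s : ℂ) (lam : ℝ) (x : ℂ) : ℂ :=
  (q : ℂ)⁻¹ * ((q : ℂ)⁻¹ + q)
      * (1 - s * x * (q : ℂ) ^ (1 - 2 * I * lam)) * (1 - s / x * (q : ℂ) ^ (1 - 2 * I * lam))
      * (1 - s * x * (q : ℂ) ^ (1 + 2 * I * lam)) * (1 - s / x * (q : ℂ) ^ (1 + 2 * I * lam))
    / ((1 - x ^ 2 / (q : ℂ) ^ 2) * (1 - 1 / (x ^ 2 * (q : ℂ) ^ 2)))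

/-- The shift vectors `ν ∈ {-1, 0, 1}^j`, extended by `0` in the positions after `j`. -/
def shifts {N : ℕ} (j : Fin N) : Finset (Fin N → ℤ) :=
  Fintype.piFinset fun i => if i ≤ j then ({-1, 0, 1} : Finset ℤ) else {0}

/-- `T_ν x = (q^{2ν_1} x_1, …, q^{2ν_N} x_N)`. -/
def shiftVec (q : ℝ) {N : ℕ} (ν : Fin N → ℤ) (x : Fin N → ℂ) : Fin N → ℂ :=
  fun i => x i * (q : ℂ) ^ (2 * ν i)

/-- The coefficient `A^-`, `A` or `A^+`, according to `m = ν_{i+1} = -1, 0, 1`. -/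
def selA (q : ℝ) (m : ℤ) (s : ℂ) (lam : ℝ) (x : ℂ) : ℂ :=
  if m = -1 then coefAminus q s x else if m = 0 then coefA q s lam x else coefAplus q s lam x

/-- The coefficient `B^-`, `B` or `B^+`, according to `m = ν_{i+1} = -1, 0, 1`. -/
def selB (q : ℝ) (m : ℤ) (s : ℂ) (lam : ℝ) (x : ℂ) : ℂ :=
  if m = -1 then coefBminus q s x else if m = 0 then coefB q s lam x else coefBplus q s lam x

/-- The factor `C_{ν,i}(x)`: `A_{ν,i}(x_i^{ν_i}, x_{i+1})` if `ν_i ≠ 0`, and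
`B_{ν,i}(x_i, x_{i+1})` if `ν_i = 0`. -/
def coefFactor (q : ℝ) {N : ℕ} (α : Params N) (x : Fin N → ℂ) (ν : Fin N → ℤ) (i : Fin N) : ℂ :=
  if ν i ≠ 0 then selA q (next 0 ν i) (next α.s x i) (α.lam i) (x i ^ ν i)
  else selB q (next 0 ν i) (next α.s x i) (α.lam i) (x i)

/-- The extra factor of the coefficient for the first variable `x₁`, with `m = ν₁`. -/
def coefFirst (q : ℝ) (u t v : ℂ) (x₁ : ℂ) (m : ℤ) : ℂ :=
  if m ≠ 0 then
    -(u * x₁ ^ (-m) / (v * q))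
      * ((1 - v * q * x₁ ^ m / (u * t)) * (1 - v * q * t * x₁ ^ m / u) / ((q : ℂ)⁻¹ - q))
  else
    (((q : ℂ)⁻¹ + q) * (t + t⁻¹) - (u / v + v / u) * (x₁ + x₁⁻¹))
      / (((q : ℂ) ^ 2)⁻¹ - (q : ℂ) ^ 2)

/-- The coefficient of `T_ν` in the `j`-th difference operator: the factor for the first variable
times `∏_{i ≤ j} C_{ν,i}(x)`. -/
def coefTotal (q : ℝ) {N : ℕ} (α : Params N) (x : Fin N → ℂ) (j : Fin N) (ν : Fin N → ℤ) : ℂ :=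
  (∏ i ∈ Finset.Iic j, coefFactor q α x ν i)
    * coefFirst q α.u α.t α.v (x ⟨0, j.pos⟩) (ν ⟨0, j.pos⟩)

end AWOverlap

end

noncomputable section

namespace AWOverlap

open Complex Set MeasureTheory intervalIntegral

/-! ### Calculus on piecewise smooth closed curves -/

/-! Conjugation and inversion in the pairing cancel: the starred second eigenfunction is again an
`eigFn`, with `λ` replaced by `-λ`. The integrand is therefore meromorphic on the punctured plane
and is a product of functions of the separate variables, so the iterated integral is a product of
univariate ones. This gives (i), once the integrals are known not to depend on the contours.

For (o), independence is Cauchy's theorem in winding number form. On an annulus the integrand is a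
holomorphic function times finitely many factors `(z - p)⁻¹`. Partial fractions and Cauchy's formula
in the annulus show that the integral depends only on the winding numbers around `0` and around the
poles (`Contour.integral_eq_of_sameWinding`). Existence holds because the inner poles accumulate
only at `0` and the outer ones only at infinity: a circle around `0` is correct for all but finitely
many of them, and each exception is repaired by a loop that winds around that single point
(`exists_contour_inside_outside`).

For (ii), complex conjugation exchanges the two eigenfunctions in the integrand and maps an
admissible contour, traversed backwards, to an admissible contour for the exchanged parameters.

For (iii), the core is a univariate contiguous relation (`overlap1_contiguous`). For `m ∈ {-1, 0,
1}`, the sum over `ν` of `coefFirst` at `(t, x, ν)` times `coefStep` times the coefficient with `s`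
shifted by `q^{2m}` and `x` by `q^{2ν}` equals `coefFirst` at `(y, s, m)` times the unshifted
coefficient. At the level of integrands the two sides differ by a multiple of `q² P(q² z) - P(z)`
for an explicit function `P`, `primitive`. Its integral vanishes because the contour and its
multiple by `q²` wind equally around the poles of `P`. The pointwise identity reduces to rational
identities, since all the shifted eigenfunctions are rational multiples of one function.

The relation says that a matrix indexed by `(ν_i, ν_{i+1})` sends the vector `coefFirst` at
`(y_{i-1}, x_i)` to a multiple of the vector at `(y_i, x_{i+1})`. Applying it for `i = 1, …, j`
collapses the sum over all shifts (`sum_prod_transfer`). What remains is the entry of the last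
vector at `ν_{j+1} = 0`, which is `μ_{y_j}` minus the explicit constant of the difference equation.
-/

theorem Contour.continuousOn (γ : Contour) : ContinuousOn γ.toFun (Icc 0 1) := by
  obtain ⟨n, p, hp, h0, h1, hd⟩ := γ.piecewise
  have key : ∀ i ≤ n, ContinuousOn γ.toFun (Icc (p 0) (p i)) := by
    intro i
    induction i with
    | zero => intro _; simp
    | succ i ih =>
      intro hi
      rw [← Icc_union_Icc_eq_Icc (hp (Nat.zero_le i)) (hp (Nat.le_succ i))]
      exact (ih (by omega)).union_of_isClosed (hd i (by omega)).continuousOn isClosed_Icc isClosed_Icc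
  simpa [h0, h1] using key n le_rfl

theorem hasDerivAt_of_contDiffOn_Icc {f : ℝ → ℂ} {a b τ : ℝ} (h : ContDiffOn ℝ 1 f (Icc a b))
    (hτ : τ ∈ Ioo a b) : HasDerivAt f (deriv f τ) τ :=
  ((h.contDiffAt (Icc_mem_nhds hτ.1 hτ.2)).differentiableAt (by simp)).hasDerivAt

theorem intervalIntegrable_comp_mul_deriv {f : ℝ → ℂ} {a b : ℝ} (hab : a ≤ b)
    (h : ContDiffOn ℝ 1 f (Icc a b)) {G : ℝ → ℂ} (hG : ContinuousOn G (Icc a b)) :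
    IntervalIntegrable (fun τ => G τ * deriv f τ) volume a b := by
  rcases hab.eq_or_lt with rfl | hab
  · exact IntervalIntegrable.refl
  have hc : ContinuousOn (fun τ => G τ * derivWithin f (Icc a b) τ) (uIcc a b) := by
    rw [uIcc_of_le hab.le]
    exact hG.mul (h.continuousOn_derivWithin (uniqueDiffOn_Icc hab) le_rfl)
  -- At the break points `deriv f` may be a default value, so it is compared with the continuous
  -- `derivWithin` on the open interval only.
  refine hc.intervalIntegrable.congr_uIoo ?_
  intro τ hτ
  rw [uIoo_of_le hab.le] at hτ
  simp only
  rw [derivWithin_of_mem_nhds (Icc_mem_nhds hτ.1 hτ.2)]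

theorem Contour.intervalIntegrable_mul_deriv (γ : Contour) {G : ℝ → ℂ}
    (hG : ContinuousOn G (Icc 0 1)) :
    IntervalIntegrable (fun τ => G τ * deriv γ.toFun τ) volume 0 1 := by
  obtain ⟨n, p, hp, h0, h1, hd⟩ := γ.piecewise
  have := IntervalIntegrable.trans_iterate (f := fun τ => G τ * deriv γ.toFun τ) (μ := volume)
    (a := p) (n := n) fun k hk =>
      intervalIntegrable_comp_mul_deriv (hp (Nat.le_succ k)) (hd k hk) (hG.mono ?_)
  · rwa [h0, h1] at this
  · exact Icc_subset_Icc (h0 ▸ hp (Nat.zero_le k)) (h1 ▸ hp (Nat.succ_le_of_lt hk))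

theorem Contour.intervalIntegrable (γ : Contour) {F : ℂ → ℂ}
    (hF : ContinuousOn F (γ.toFun '' Icc 0 1)) :
    IntervalIntegrable (fun τ => F (γ.toFun τ) * deriv γ.toFun τ) volume 0 1 :=
  γ.intervalIntegrable_mul_deriv (hF.comp γ.continuousOn (mapsTo_image _ _))

theorem Contour.isCompact_image (γ : Contour) : IsCompact (γ.toFun '' Icc 0 1) :=
  isCompact_Icc.image_of_continuousOn γ.continuousOn

theorem Contour.integral_congr (γ : Contour) {F G : ℂ → ℂ}
    (h : ∀ z ∈ γ.toFun '' Icc 0 1, F z = G z) : γ.integral F = γ.integral G := by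
  refine intervalIntegral.integral_congr fun τ hτ => ?_
  rw [uIcc_of_le zero_le_one] at hτ
  simp only [h _ (mem_image_of_mem _ hτ)]

theorem Contour.integral_add (γ : Contour) {F G : ℂ → ℂ}
    (hF : ContinuousOn F (γ.toFun '' Icc 0 1)) (hG : ContinuousOn G (γ.toFun '' Icc 0 1)) :
    γ.integral (fun z => F z + G z) = γ.integral F + γ.integral G := by
  simp only [Contour.integral, add_mul]
  exact intervalIntegral.integral_add (γ.intervalIntegrable hF) (γ.intervalIntegrable hG)

theorem Contour.integral_sub (γ : Contour) {F G : ℂ → ℂ}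
    (hF : ContinuousOn F (γ.toFun '' Icc 0 1)) (hG : ContinuousOn G (γ.toFun '' Icc 0 1)) :
    γ.integral (fun z => F z - G z) = γ.integral F - γ.integral G := by
  simp only [Contour.integral, sub_mul]
  exact intervalIntegral.integral_sub (γ.intervalIntegrable hF) (γ.intervalIntegrable hG)

theorem Contour.integral_const_mul (γ : Contour) (c : ℂ) (F : ℂ → ℂ) :
    γ.integral (fun z => c * F z) = c * γ.integral F := by
  simp only [Contour.integral, mul_assoc]
  exact intervalIntegral.integral_const_mul _ _

theorem Contour.integral_mul_const (γ : Contour) (c : ℂ) (F : ℂ → ℂ) :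
    γ.integral (fun z => F z * c) = γ.integral F * c := by
  simp only [mul_comm _ c, Contour.integral_const_mul]

/-- The integral of a derivative along a closed curve vanishes. -/
theorem Contour.integral_eq_zero_of_hasDerivAt (γ : Contour) {F f : ℂ → ℂ}
    (hF : ∀ z ∈ γ.toFun '' Icc 0 1, HasDerivAt F (f z) z)
    (hf : ContinuousOn f (γ.toFun '' Icc 0 1)) : γ.integral f = 0 := by
  have hint := γ.intervalIntegrable hf
  obtain ⟨n, p, hp, h0, h1, hd⟩ := γ.piecewise
  have hsub : ∀ k < n, Icc (p k) (p (k + 1)) ⊆ Icc 0 1 := fun k hk =>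
    Icc_subset_Icc (h0 ▸ hp (Nat.zero_le k)) (h1 ▸ hp (Nat.succ_le_of_lt hk))
  have hint' : ∀ k < n, IntervalIntegrable (fun τ => f (γ.toFun τ) * deriv γ.toFun τ) volume
      (p k) (p (k + 1)) := fun k hk => hint.mono_set (by
    rw [uIcc_of_le (hp (Nat.le_succ k)), uIcc_of_le zero_le_one]; exact hsub k hk)
  have hpiece : ∀ k < n, ∫ τ in (p k)..(p (k + 1)), f (γ.toFun τ) * deriv γ.toFun τ
      = F (γ.toFun (p (k + 1))) - F (γ.toFun (p k)) := by
    intro k hk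
    refine integral_eq_sub_of_hasDerivAt_of_le (f := fun τ => F (γ.toFun τ)) (hp (Nat.le_succ k))
      ?_ ?_ (hint' k hk)
    · have hFc : ContinuousOn F (γ.toFun '' Icc 0 1) := fun z hz =>
        (hF z hz).continuousAt.continuousWithinAt
      exact (hFc.comp γ.continuousOn (mapsTo_image _ _)).mono (hsub k hk)
    · intro τ hτ
      exact (hF _ (mem_image_of_mem _ (hsub k hk (Ioo_subset_Icc_self hτ)))).comp τ
        (hasDerivAt_of_contDiffOn_Icc (hd k hk) hτ)
  -- The increments of `F` over the pieces telescope, and closedness of the curve makes the total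
  -- vanish.
  have hsum := sum_integral_adjacent_intervals hint'
  rw [h0, h1, Finset.sum_congr rfl fun k hk => hpiece k (Finset.mem_range.1 hk),
    Finset.sum_range_sub (fun k => F (γ.toFun (p k))), h0, h1, γ.closed, sub_self] at hsum
  exact hsum.symm

/-! ### Scaled and reflected curves -/

/-- The image of a curve under multiplication by a constant. -/
def Contour.scale (γ : Contour) (c : ℂ) : Contour where
  toFun τ := c * γ.toFun τ
  closed := by rw [γ.closed]
  piecewise := by
    obtain ⟨n, p, hp, h0, h1, hd⟩ := γ.piecewise
    exact ⟨n, p, hp, h0, h1, fun i hi => contDiffOn_const.mul (hd i hi)⟩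

theorem Contour.integral_scale (γ : Contour) (c : ℂ) (F : ℂ → ℂ) :
    (γ.scale c).integral F = γ.integral fun z => c * F (c * z) := by
  simp only [Contour.integral, Contour.scale]
  refine intervalIntegral.integral_congr fun τ _ => ?_
  rw [show (fun τ => c * γ.toFun τ) = fun τ => c • γ.toFun τ from rfl,
    deriv_fun_const_smul_field]
  simp only [smul_eq_mul]
  ring

theorem Contour.winding_scale (γ : Contour) {c : ℂ} (hc : c ≠ 0) (p : ℂ) :
    (γ.scale c).winding (c * p) = γ.winding p := by
  rw [Contour.winding, Contour.winding, Contour.integral_scale]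
  congr 2
  funext z
  rw [← mul_sub, mul_inv, mul_inv_cancel_left₀ hc]

/-- The complex conjugate of a curve, traversed backwards. -/
def Contour.conjRev (γ : Contour) : Contour where
  toFun τ := (starRingEnd ℂ) (γ.toFun (1 - τ))
  closed := by simp [γ.closed]
  piecewise := by
    obtain ⟨n, p, hp, h0, h1, hd⟩ := γ.piecewise
    -- The subtraction `n - i` is truncated, so the break points stay at `1` for `i ≥ n` and
    -- monotonicity persists.
    refine ⟨n, fun i => 1 - p (n - i), fun i j hij => ?_, by simp [h1], by simp [h0], ?_⟩
    · exact sub_le_sub_left (hp (by omega)) 1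
    · intro i hi
      have h := hd (n - (i + 1)) (by omega)
      rw [show n - (i + 1) + 1 = n - i by omega] at h
      refine conjCLE.contDiff.comp_contDiffOn (h.comp (contDiff_const.sub contDiff_id).contDiffOn ?_)
      intro τ hτ
      simp only [mem_Icc] at hτ ⊢
      constructor <;> linarith [hτ.1, hτ.2]

theorem Contour.deriv_conjRev (γ : Contour) (τ : ℝ) :
    deriv γ.conjRev.toFun τ = -(starRingEnd ℂ) (deriv γ.toFun (1 - τ)) := by
  have h := deriv.star (f := fun σ => γ.toFun (1 - σ)) (x := τ)
  rw [deriv_comp_const_sub] at h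
  exact h.trans (by rw [star_neg]; rfl)

theorem Contour.integral_conjRev (γ : Contour) (F : ℂ → ℂ) :
    (γ.conjRev).integral F
      = -(starRingEnd ℂ) (γ.integral fun z => (starRingEnd ℂ) (F ((starRingEnd ℂ) z))) := by
  simp only [Contour.integral, Contour.deriv_conjRev]
  have hconj : ∀ g : ℝ → ℂ, (starRingEnd ℂ) (∫ τ in (0 : ℝ)..1, g τ)
      = ∫ τ in (0 : ℝ)..1, (starRingEnd ℂ) (g τ) := fun g => by
    rw [intervalIntegral.integral_of_le zero_le_one, intervalIntegral.integral_of_le zero_le_one,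
      _root_.integral_conj]
  rw [hconj, ← intervalIntegral.integral_neg]
  have h := intervalIntegral.integral_comp_sub_left (a := 0) (b := 1) (fun τ : ℝ =>
    -(starRingEnd ℂ) ((starRingEnd ℂ) (F ((starRingEnd ℂ) (γ.toFun τ))) * deriv γ.toFun τ)) 1
  rw [sub_self, sub_zero] at h
  rw [← h]
  refine intervalIntegral.integral_congr fun τ _ => ?_
  simp [Contour.conjRev]

/-- Conjugation turns the orientation around and the reversed traversal restores it. In the formula,
the sign from the reversal cancels the one from conjugating `2πi`. -/
theorem Contour.winding_conjRev (γ : Contour) (p : ℂ) :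
    γ.conjRev.winding ((starRingEnd ℂ) p) = (starRingEnd ℂ) (γ.winding p) := by
  rw [Contour.winding, Contour.winding, Contour.integral_conjRev]
  simp only [map_mul, map_inv₀, map_sub, Complex.conj_conj, Complex.conj_I, Complex.conj_ofReal,
    map_ofNat]
  rw [mul_neg, mul_neg, inv_neg, neg_mul]

theorem Contour.Inside.scale {γ : Contour} {p c : ℂ} (h : γ.Inside p) (hc : c ≠ 0) :
    (γ.scale c).Inside (c * p) :=
  ⟨fun τ hτ he => h.1 τ hτ (mul_left_cancel₀ hc he), (γ.winding_scale hc p).trans h.2⟩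

theorem Contour.Outside.scale {γ : Contour} {p c : ℂ} (h : γ.Outside p) (hc : c ≠ 0) :
    (γ.scale c).Outside (c * p) :=
  ⟨fun τ hτ he => h.1 τ hτ (mul_left_cancel₀ hc he), (γ.winding_scale hc p).trans h.2⟩

theorem Contour.conjRev_ne {γ : Contour} {p : ℂ}
    (h : ∀ τ ∈ Icc (0 : ℝ) 1, γ.toFun τ ≠ p) :
    ∀ τ ∈ Icc (0 : ℝ) 1, γ.conjRev.toFun τ ≠ (starRingEnd ℂ) p := fun τ hτ he =>
  h (1 - τ) ⟨by linarith [hτ.2], by linarith [hτ.1]⟩ ((starRingEnd ℂ).injective he)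

theorem Contour.Inside.conjRev {γ : Contour} {p : ℂ} (h : γ.Inside p) :
    γ.conjRev.Inside ((starRingEnd ℂ) p) :=
  ⟨Contour.conjRev_ne h.1, by rw [Contour.winding_conjRev, h.2, map_one]⟩

theorem Contour.Outside.conjRev {γ : Contour} {p : ℂ} (h : γ.Outside p) :
    γ.conjRev.Outside ((starRingEnd ℂ) p) :=
  ⟨Contour.conjRev_ne h.1, by rw [Contour.winding_conjRev, h.2, map_zero]⟩

end AWOverlap

end

noncomputable section

namespace AWOverlap

open Complex Set MeasureTheory intervalIntegral

/-! ### Cauchy's theorem for curves in an annulus -/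

theorem mem_slitPlane_one_sub {z : ℂ} (hz : ‖z‖ < 1) : 1 - z ∈ slitPlane := by
  refine Or.inl ?_
  have := (Complex.re_le_norm z).trans_lt hz
  simpa using this

/-- On the disc `|z| < |p|` the principal branch of `log (1 - z / p)` is a primitive of `(z - p)⁻¹`.
-/
theorem Contour.winding_eq_zero_of_norm_lt (γ : Contour) {p : ℂ}
    (h : ∀ z ∈ γ.toFun '' Icc 0 1, ‖z‖ < ‖p‖) : γ.winding p = 0 := by
  have hne : ∀ z ∈ γ.toFun '' Icc 0 1, z - p ≠ 0 := fun z hz h0 => by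
    rw [sub_eq_zero] at h0
    exact (h z hz).ne (by rw [h0])
  rw [Contour.winding, Contour.integral_eq_zero_of_hasDerivAt γ
    (F := fun z => Complex.log (1 - z / p)), mul_zero]
  · intro z hz
    have hp : p ≠ 0 := norm_pos_iff.1 ((norm_nonneg z).trans_lt (h z hz))
    have h1 : ‖z / p‖ < 1 := by
      rw [norm_div, div_lt_one (norm_pos_iff.2 hp)]
      exact h z hz
    have h2 := (((hasDerivAt_id z).div_const p).const_sub 1).clog (mem_slitPlane_one_sub h1)
    refine HasDerivAt.congr_deriv h2 ?_
    have h3 := hne z hz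
    have h4 : p - z ≠ 0 := fun h => h3 (by rw [← neg_sub, h, neg_zero])
    rw [id_eq, one_sub_div hp, ← neg_sub p z]
    field_simp
  · exact (continuousOn_id.sub continuousOn_const).inv₀ hne

/-- For `|z| > |p|` the principal branch of `log (1 - p / z)` is a primitive of `(z - p)⁻¹ - z⁻¹`,
so both windings have the same integral. -/
theorem Contour.winding_eq_of_norm_lt (γ : Contour) {p : ℂ}
    (h : ∀ z ∈ γ.toFun '' Icc 0 1, ‖p‖ < ‖z‖) : γ.winding p = γ.winding 0 := by
  have hz0 : ∀ z ∈ γ.toFun '' Icc 0 1, z ≠ 0 := fun z hz =>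
    norm_pos_iff.1 ((norm_nonneg p).trans_lt (h z hz))
  have hne : ∀ z ∈ γ.toFun '' Icc 0 1, z - p ≠ 0 := fun z hz h0 => by
    rw [sub_eq_zero] at h0
    exact (h z hz).ne (by rw [h0])
  have hc1 : ContinuousOn (fun z : ℂ => (z - p)⁻¹) (γ.toFun '' Icc 0 1) :=
    (continuousOn_id.sub continuousOn_const).inv₀ hne
  have hc2 : ContinuousOn (fun z : ℂ => (z - 0)⁻¹) (γ.toFun '' Icc 0 1) :=
    (continuousOn_id.sub continuousOn_const).inv₀ (by simpa using hz0)
  rw [Contour.winding, Contour.winding, ← sub_eq_zero, ← mul_sub, ← γ.integral_sub hc1 hc2,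
    Contour.integral_eq_zero_of_hasDerivAt γ (F := fun z => Complex.log (1 - p / z)), mul_zero]
  · intro z hz
    have h1 : ‖p / z‖ < 1 := by
      rw [norm_div, div_lt_one (norm_pos_iff.2 (hz0 z hz))]
      exact h z hz
    have h2 := (((hasDerivAt_const z p).div (hasDerivAt_id z) (hz0 z hz)).const_sub 1).clog
      (mem_slitPlane_one_sub h1)
    refine HasDerivAt.congr_deriv h2 ?_
    have h3 := hne z hz
    have h4 := hz0 z hz
    simp only [id, sub_zero, Pi.div_apply]
    rw [one_sub_div h4]
    field_simp
    ring
  · exact hc1.sub hc2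

theorem circleIntegral_sub_inv_of_lt_norm {r : ℝ} {z : ℂ} (hr : 0 ≤ r) (hz : r < ‖z‖) :
    (∮ w in C(0, r), (w - z)⁻¹) = 0 := by
  have hne : ∀ w ∈ Metric.closedBall (0 : ℂ) r, w - z ≠ 0 := fun w hw h0 => by
    rw [sub_eq_zero] at h0
    rw [mem_closedBall_zero_iff, h0] at hw
    exact hw.not_gt hz
  refine circleIntegral_eq_zero_of_differentiable_on_off_countable hr countable_empty
    ((continuousOn_id.sub continuousOn_const).inv₀ hne) fun w hw => ?_
  exact (differentiableAt_id.sub_const z).inv (hne w (Metric.ball_subset_closedBall hw.1))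

/-- Cauchy's integral formula in an annulus. -/
theorem circleIntegral_sub_circleIntegral_of_annulus {H : ℂ → ℂ} {r R : ℝ} (hr : 0 < r)
    (hH : ∀ z, r ≤ ‖z‖ → ‖z‖ ≤ R → DifferentiableAt ℂ H z) {z : ℂ} (h1 : r < ‖z‖) (h2 : ‖z‖ < R) :
    (∮ w in C(0, R), (w - z)⁻¹ * H w) - (∮ w in C(0, r), (w - z)⁻¹ * H w)
      = 2 * Real.pi * I * H z := by
  have hrR : r ≤ R := (h1.trans h2).le
  have hmem : ∀ w, w ∈ Metric.closedBall (0 : ℂ) R \ Metric.ball 0 r ↔ r ≤ ‖w‖ ∧ ‖w‖ ≤ R := by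
    intro w; simp [and_comm]
  have hcH : ContinuousOn H (Metric.closedBall (0 : ℂ) R \ Metric.ball 0 r) := fun w hw =>
    (hH w ((hmem w).1 hw).1 ((hmem w).1 hw).2).continuousAt.continuousWithinAt
  have hnhds : Metric.closedBall (0 : ℂ) R \ Metric.ball 0 r ∈ nhds z := by
    have : {w : ℂ | r < ‖w‖} ∩ {w : ℂ | ‖w‖ < R} ∈ nhds z :=
      ((isOpen_lt continuous_const continuous_norm).inter
        (isOpen_lt continuous_norm continuous_const)).mem_nhds ⟨h1, h2⟩
    exact Filter.mem_of_superset this fun w hw => (hmem w).2 ⟨hw.1.le, hw.2.le⟩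
  have hdz := hH z h1.le h2.le
  -- The difference quotient of `H` at `z` is continuous at `z` and holomorphic elsewhere, so it has
  -- equal integrals over the two circles. Splitting it as in `hci` leaves the integral of `(w -
  -- z)⁻¹`, which is `2πi` over the outer circle and `0` over the inner one.
  have key := circleIntegral_eq_of_differentiable_on_annulus_off_countable hr hrR
    (f := dslope H z) (countable_singleton z) ((continuousOn_dslope hnhds).2 ⟨hcH, hdz⟩)
    (fun w hw => (differentiableAt_dslope_of_ne hw.2).2 (hH w (by
      have := hw.1.2; simp at this; exact this.le) (by
      have := hw.1.1; simp at this; exact this.le)))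
  have hci : ∀ ρ, r ≤ ρ → ρ ≤ R → ρ ≠ ‖z‖ → (∮ w in C(0, ρ), dslope H z w)
      = (∮ w in C(0, ρ), (w - z)⁻¹ * H w) - (∮ w in C(0, ρ), (w - z)⁻¹) * H z := by
    intro ρ hρ1 hρ2 hρ3
    have hρ0 : 0 ≤ ρ := hr.le.trans hρ1
    have hne : ∀ w ∈ Metric.sphere (0 : ℂ) ρ, w - z ≠ 0 := fun w hw h0 => by
      rw [sub_eq_zero] at h0
      rw [mem_sphere_zero_iff_norm, h0] at hw
      exact hρ3 hw.symm
    have hc1 : ContinuousOn (fun w : ℂ => (w - z)⁻¹) (Metric.sphere 0 ρ) :=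
      (continuousOn_id.sub continuousOn_const).inv₀ hne
    have hc2 : ContinuousOn H (Metric.sphere 0 ρ) := hcH.mono fun w hw => by
      rw [mem_sphere_zero_iff_norm] at hw
      exact (hmem w).2 ⟨hw ▸ hρ1, hw ▸ hρ2⟩
    have e1 : (∮ w in C(0, ρ), (w - z)⁻¹) * H z = ∮ w in C(0, ρ), (w - z)⁻¹ * H z := by
      have := circleIntegral.integral_smul_const (fun w : ℂ => (w - z)⁻¹) (H z) 0 ρ
      simpa only [smul_eq_mul] using this.symm
    rw [e1, ← circleIntegral.integral_sub (f := fun w => (w - z)⁻¹ * H w)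
      (g := fun w => (w - z)⁻¹ * H z) ((hc1.mul hc2).circleIntegrable hρ0)
      ((hc1.mul continuousOn_const).circleIntegrable hρ0)]
    refine circleIntegral.integral_congr hρ0 fun w hw => ?_
    have hwz : w ≠ z := fun h => hne w hw (sub_eq_zero.2 h)
    rw [dslope_of_ne _ hwz, slope_def_field, div_eq_inv_mul, mul_sub]
  rw [hci R hrR le_rfl h2.ne', hci r le_rfl hrR h1.ne,
    circleIntegral.integral_sub_inv_of_mem_ball (by simpa using h2),
    circleIntegral_sub_inv_of_lt_norm hr.le h1] at key
  linear_combination key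

/-- By Fubini the integral over `γ` is taken first. For fixed `w` it is `-2πi` times the winding
number of `γ` around `w`. Integrability is recorded as well, because two such integrals are
subtracted from each other later. -/
theorem Contour.integral_circleIntegral (γ : Contour) {H : ℂ → ℂ} {ρ : ℝ} (hρ : 0 < ρ)
    (hH : ContinuousOn H (Metric.sphere 0 ρ)) (hγ : ∀ z ∈ γ.toFun '' Icc 0 1, ‖z‖ ≠ ρ) :
    IntervalIntegrable (fun τ => (∮ w in C(0, ρ), (w - γ.toFun τ)⁻¹ * H w) * deriv γ.toFun τ)
      volume 0 1 ∧
    γ.integral (fun z => ∮ w in C(0, ρ), (w - z)⁻¹ * H w)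
      = -(2 * Real.pi * I) * ∮ w in C(0, ρ), H w * γ.winding w := by
  have hpi : (2 * Real.pi * I : ℂ) ≠ 0 := by simp [Real.pi_ne_zero]
  set K : ℝ → ℝ → ℂ := fun τ θ =>
    deriv (circleMap 0 ρ) θ * ((circleMap 0 ρ θ - γ.toFun τ)⁻¹ * H (circleMap 0 ρ θ)) with hK
  have hcK : ContinuousOn (Function.uncurry K) (Icc 0 1 ×ˢ Icc 0 (2 * Real.pi)) := by
    have hcm : Continuous fun p : ℝ × ℝ => circleMap 0 ρ p.2 :=
      (continuous_circleMap 0 ρ).comp continuous_snd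
    have h1 : ContinuousOn (fun p : ℝ × ℝ => γ.toFun p.1) (Icc 0 1 ×ˢ Icc 0 (2 * Real.pi)) :=
      γ.continuousOn.comp continuousOn_fst fun p hp => hp.1
    have h2 : ContinuousOn (fun p : ℝ × ℝ => H (circleMap 0 ρ p.2))
        (Icc 0 1 ×ˢ Icc 0 (2 * Real.pi)) :=
      hH.comp hcm.continuousOn fun p _ => circleMap_mem_sphere 0 hρ.le p.2
    have h3 : Continuous fun p : ℝ × ℝ => deriv (circleMap 0 ρ) p.2 := by
      simp only [deriv_circleMap]
      exact hcm.mul continuous_const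
    refine h3.continuousOn.mul (((hcm.continuousOn.sub h1).inv₀ fun p hp h0 => ?_).mul h2)
    refine hγ _ (mem_image_of_mem _ hp.1) ?_
    have h5 : circleMap 0 ρ p.2 - γ.toFun p.1 = 0 := h0
    rw [← sub_eq_zero.1 h5]
    simpa using circleMap_mem_sphere (0 : ℂ) hρ.le p.2
  -- The kernel `K` is continuous on a compact rectangle, hence bounded, while `deriv γ.toFun` is
  -- only known to be integrable.
  have hint : IntegrableOn (Function.uncurry fun τ θ => K τ θ * deriv γ.toFun τ)
      (uIoc 0 1 ×ˢ uIoc 0 (2 * Real.pi)) := by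
    have hcpt : IsCompact (Icc (0 : ℝ) 1 ×ˢ Icc 0 (2 * Real.pi)) := isCompact_Icc.prod isCompact_Icc
    obtain ⟨C, hC⟩ := hcpt.exists_bound_of_continuousOn hcK
    have hsub : Ioc (0 : ℝ) 1 ×ˢ Ioc 0 (2 * Real.pi) ⊆ Icc (0 : ℝ) 1 ×ˢ Icc 0 (2 * Real.pi) :=
      prod_mono Ioc_subset_Icc_self Ioc_subset_Icc_self
    have hmeas : MeasurableSet (Ioc (0 : ℝ) 1 ×ˢ Ioc 0 (2 * Real.pi)) :=
      measurableSet_Ioc.prod measurableSet_Ioc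
    rw [uIoc_of_le zero_le_one, uIoc_of_le Real.two_pi_pos.le]
    have hd : IntegrableOn (fun τ => deriv γ.toFun τ) (Ioc 0 1) := by
      have := γ.intervalIntegrable_mul_deriv (G := fun _ => 1) continuousOn_const
      simpa using this.1
    have hd2 : Integrable (fun p : ℝ × ℝ => deriv γ.toFun p.1 * (1 : ℂ))
        ((volume.restrict (Ioc 0 1)).prod (volume.restrict (Ioc 0 (2 * Real.pi)))) :=
      Integrable.mul_prod hd (integrable_const (1 : ℂ))
    rw [Measure.prod_restrict, ← Measure.volume_eq_prod] at hd2
    simp only [mul_one] at hd2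
    refine hd2.bdd_mul (c := C) ((hcK.mono hsub).aestronglyMeasurable hmeas) ?_
    exact (ae_restrict_iff' hmeas).2 (Filter.Eventually.of_forall fun p hp => hC p (hsub hp))
  have hsw := MeasureTheory.intervalIntegral_intervalIntegral_swap hint
  have e1 : γ.integral (fun z => ∮ w in C(0, ρ), (w - z)⁻¹ * H w)
      = ∫ τ in (0 : ℝ)..1, ∫ θ in (0 : ℝ)..2 * Real.pi, K τ θ * deriv γ.toFun τ := by
    simp only [Contour.integral, circleIntegral, smul_eq_mul, ← intervalIntegral.integral_mul_const]
    rfl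
  refine ⟨?_, ?_⟩
  · have h1 := hint
    rw [IntegrableOn, Measure.volume_eq_prod, ← Measure.prod_restrict] at h1
    have h2 := h1.integral_prod_left
    rw [intervalIntegrable_iff, IntegrableOn]
    rw [uIoc_of_le zero_le_one] at h2 ⊢
    refine h2.congr (Filter.Eventually.of_forall fun τ => ?_)
    simp only [circleIntegral, smul_eq_mul, ← intervalIntegral.integral_mul_const, Function.uncurry]
    rw [intervalIntegral.integral_of_le Real.two_pi_pos.le, uIoc_of_le Real.two_pi_pos.le]
  rw [e1, hsw]
  simp only [circleIntegral, smul_eq_mul]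
  rw [← intervalIntegral.integral_const_mul]
  refine intervalIntegral.integral_congr fun θ _ => ?_
  have e2 : (∫ τ in (0 : ℝ)..1, K τ θ * deriv γ.toFun τ)
      = γ.integral fun z => (-(deriv (circleMap 0 ρ) θ * H (circleMap 0 ρ θ))) *
        (z - circleMap 0 ρ θ)⁻¹ := by
    simp only [Contour.integral, hK]
    refine intervalIntegral.integral_congr fun τ _ => ?_
    rw [← neg_sub (γ.toFun τ), inv_neg]
    ring
  rw [e2, γ.integral_const_mul, Contour.winding]
  field_simp

/-- The integral over a closed curve in an annulus depends only on its winding number around the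
centre. -/
theorem Contour.integral_of_annulus (γ : Contour) {H : ℂ → ℂ} {r R : ℝ} (hr : 0 < r)
    (hH : ∀ z, r ≤ ‖z‖ → ‖z‖ ≤ R → DifferentiableAt ℂ H z)
    (hγ : ∀ z ∈ γ.toFun '' Icc 0 1, r < ‖z‖ ∧ ‖z‖ < R) :
    γ.integral H = γ.winding 0 * ∮ w in C(0, r), H w := by
  have hpi : (2 * Real.pi * I : ℂ) ≠ 0 := by simp [Real.pi_ne_zero]
  have h0 : γ.toFun 0 ∈ γ.toFun '' Icc 0 1 := mem_image_of_mem _ (by simp)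
  have hrR : r < R := (hγ _ h0).1.trans (hγ _ h0).2
  have hsph : ∀ ρ, r ≤ ρ → ρ ≤ R → ContinuousOn H (Metric.sphere 0 ρ) := fun ρ h1 h2 w hw => by
    rw [mem_sphere_zero_iff_norm] at hw
    exact (hH w (hw ▸ h1) (hw ▸ h2)).continuousAt.continuousWithinAt
  have hR := γ.integral_circleIntegral (hr.trans hrR) (hsph R hrR.le le_rfl)
    fun z hz => (hγ z hz).2.ne
  have hr' := γ.integral_circleIntegral hr (hsph r le_rfl hrR.le) fun z hz => (hγ z hz).1.ne'
  have hsub : γ.integral (fun z => (∮ w in C(0, R), (w - z)⁻¹ * H w)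
      - ∮ w in C(0, r), (w - z)⁻¹ * H w) = γ.integral (fun z => ∮ w in C(0, R), (w - z)⁻¹ * H w)
      - γ.integral fun z => ∮ w in C(0, r), (w - z)⁻¹ * H w := by
    simp only [Contour.integral, sub_mul]
    exact intervalIntegral.integral_sub hR.1 hr'.1
  rw [γ.integral_congr fun z hz => circleIntegral_sub_circleIntegral_of_annulus hr hH
    (hγ z hz).1 (hγ z hz).2, γ.integral_const_mul, hR.2, hr'.2] at hsub
  -- The curve lies strictly inside the outer circle, so it does not wind around the points of that
  -- circle. It lies strictly outside the inner circle, so around those points it winds as often as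
  -- around `0`.
  have eR : (∮ w in C(0, R), H w * γ.winding w) = 0 := by
    rw [circleIntegral.integral_congr (g := fun _ => 0) (hr.trans hrR).le]
    · simp [circleIntegral]
    · intro w hw
      rw [mem_sphere_zero_iff_norm] at hw
      beta_reduce
      rw [γ.winding_eq_zero_of_norm_lt fun z hz => hw ▸ (hγ z hz).2, mul_zero]
  have er : (∮ w in C(0, r), H w * γ.winding w) = (∮ w in C(0, r), H w) * γ.winding 0 := by
    have := circleIntegral.integral_smul_const H (γ.winding 0) 0 r
    simp only [smul_eq_mul] at this
    rw [← this]
    refine circleIntegral.integral_congr hr.le fun w hw => ?_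
    rw [mem_sphere_zero_iff_norm] at hw
    rw [γ.winding_eq_of_norm_lt fun z hz => hw ▸ (hγ z hz).1]
  rw [eR, er] at hsub
  apply mul_left_cancel₀ hpi
  linear_combination hsub

end AWOverlap

end

noncomputable section

namespace AWOverlap

open Complex Set MeasureTheory intervalIntegral

/-! ### Cauchy's theorem for meromorphic functions on the punctured plane -/

/-- Both curves avoid `p` and wind equally often around it. -/
def Contour.SameWinding (γ₁ γ₂ : Contour) (p : ℂ) : Prop :=
  (∀ τ ∈ Icc (0 : ℝ) 1, γ₁.toFun τ ≠ p) ∧ (∀ τ ∈ Icc (0 : ℝ) 1, γ₂.toFun τ ≠ p) ∧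
    γ₁.winding p = γ₂.winding p

theorem Contour.Inside.sameWinding {γ₁ γ₂ : Contour} {p : ℂ} (h₁ : γ₁.Inside p)
    (h₂ : γ₂.Inside p) : γ₁.SameWinding γ₂ p := ⟨h₁.1, h₂.1, h₁.2.trans h₂.2.symm⟩

theorem Contour.Outside.sameWinding {γ₁ γ₂ : Contour} {p : ℂ} (h₁ : γ₁.Outside p)
    (h₂ : γ₂.Outside p) : γ₁.SameWinding γ₂ p := ⟨h₁.1, h₂.1, h₁.2.trans h₂.2.symm⟩

/-- The product `∏_{p ∈ S} (z - p)⁻¹`. -/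
def polar (S : Multiset ℂ) (z : ℂ) : ℂ := (S.map fun p => (z - p)⁻¹).prod

theorem polar_zero (z : ℂ) : polar 0 z = 1 := by simp [polar]

theorem polar_cons (p : ℂ) (S : Multiset ℂ) (z : ℂ) :
    polar (p ::ₘ S) z = (z - p)⁻¹ * polar S z := by simp [polar]

theorem polar_add (S T : Multiset ℂ) (z : ℂ) : polar (S + T) z = polar S z * polar T z := by
  simp [polar]

theorem continuousOn_polar {S : Multiset ℂ} {K : Set ℂ} (h : ∀ p ∈ S, p ∉ K) :
    ContinuousOn (polar S) K := by
  induction S using Multiset.induction with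
  | empty => exact continuousOn_const.congr fun z _ => polar_zero z
  | cons p S ih =>
    refine ContinuousOn.congr (f := fun z => (z - p)⁻¹ * polar S z) ?_ fun z _ => polar_cons p S z
    refine ((continuousOn_id.sub continuousOn_const).inv₀ fun z hz h0 => ?_).mul
      (ih fun p' hp' => h p' (Multiset.mem_cons_of_mem hp'))
    exact h p (Multiset.mem_cons_self p S) ((sub_eq_zero.1 h0 : z = p) ▸ hz)

theorem Contour.notMem_image {γ : Contour} {p : ℂ} (h : ∀ τ ∈ Icc (0 : ℝ) 1, γ.toFun τ ≠ p) :
    p ∉ γ.toFun '' Icc 0 1 := by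
  rintro ⟨τ, hτ, e⟩
  exact h τ hτ e

/-- A pole of order at least two has no residue: the power has a single-valued primitive. -/
theorem Contour.integral_pow_inv (γ : Contour) {p : ℂ} (h : ∀ τ ∈ Icc (0 : ℝ) 1, γ.toFun τ ≠ p)
    (k : ℕ) : γ.integral (fun z => ((z - p)⁻¹) ^ (k + 2)) = 0 := by
  have hne : ∀ z ∈ γ.toFun '' Icc 0 1, z - p ≠ 0 := by
    rintro z ⟨τ, hτ, rfl⟩ h0
    exact h τ hτ (sub_eq_zero.1 h0)
  refine γ.integral_eq_zero_of_hasDerivAt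
    (F := fun z => -((k : ℂ) + 1)⁻¹ * ((z - p)⁻¹) ^ (k + 1)) (fun z hz => ?_)
    (((continuousOn_id.sub continuousOn_const).inv₀ hne).pow _)
  have h1 := ((((hasDerivAt_id z).sub_const p).fun_inv (hne z hz)).fun_pow (k + 1)).const_mul
    (-((k : ℂ) + 1)⁻¹)
  refine h1.congr_deriv ?_
  have h2 := hne z hz
  have h3 : (k : ℂ) + 1 ≠ 0 := by exact_mod_cast Nat.succ_ne_zero k
  simp only [id, Nat.add_sub_cancel]
  rw [pow_add]
  push_cast
  field_simp

/-- Partial fractions by induction on the number of poles. Two distinct poles reduce the integral to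
two with one pole fewer. If all poles coincide, the integral vanishes or, for a simple pole, is a
multiple of the winding number. -/
theorem Contour.integral_polar_eq {γ₁ γ₂ : Contour} (n : ℕ) : ∀ S : Multiset ℂ,
    Multiset.card S = n → (∀ p ∈ S, γ₁.SameWinding γ₂ p) →
    γ₁.integral (polar S) = γ₂.integral (polar S) := by
  induction n using Nat.strong_induction_on with
  | _ n ih =>
    intro S hcard hS
    rcases S.empty_or_exists_mem with rfl | ⟨p, hp⟩
    · have h : ∀ γ : Contour, γ.integral (polar 0) = 0 := fun γ =>
        γ.integral_eq_zero_of_hasDerivAt (F := id)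
          (fun z _ => (hasDerivAt_id z).congr_deriv (polar_zero z).symm)
          (continuousOn_polar (by simp))
      rw [h, h]
    obtain ⟨T, rfl⟩ := Multiset.exists_cons_of_mem hp
    by_cases hT : ∀ p' ∈ T, p' = p
    · rw [Multiset.eq_replicate_card.2 hT]
      have e : ∀ z, polar (p ::ₘ Multiset.replicate (Multiset.card T) p) z
          = ((z - p)⁻¹) ^ (Multiset.card T + 1) := fun z => by
        simp [polar, pow_succ, mul_comm]
      obtain ⟨h1, h2, h3⟩ := hS p hp
      rw [γ₁.integral_congr fun z _ => e z, γ₂.integral_congr fun z _ => e z]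
      rcases hc : Multiset.card T with _ | k
      · simp only [zero_add, pow_one]
        have hpi : (2 * Real.pi * I : ℂ) ≠ 0 := by simp [Real.pi_ne_zero]
        exact mul_left_cancel₀ (inv_ne_zero hpi) h3
      · rw [γ₁.integral_pow_inv h1, γ₂.integral_pow_inv h2]
    · push Not at hT
      obtain ⟨p', hp', hne⟩ := hT
      obtain ⟨T', rfl⟩ := Multiset.exists_cons_of_mem hp'
      have hsub : p - p' ≠ 0 := sub_ne_zero.2 hne.symm
      simp only [Multiset.card_cons] at hcard
      have hS1 : ∀ a ∈ p ::ₘ T', γ₁.SameWinding γ₂ a := fun a ha => hS a (by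
        rw [Multiset.mem_cons] at ha ⊢
        exact ha.imp_right Multiset.mem_cons_of_mem)
      have hS2 : ∀ a ∈ p' ::ₘ T', γ₁.SameWinding γ₂ a := fun a ha =>
        hS a (Multiset.mem_cons_of_mem ha)
      have h1 := ih (n - 1) (by omega) (p ::ₘ T') (by rw [Multiset.card_cons]; omega) hS1
      have h2 := ih (n - 1) (by omega) (p' ::ₘ T') (by rw [Multiset.card_cons]; omega) hS2
      -- This integrates `(z - p)⁻¹ (z - p')⁻¹ = (p - p')⁻¹ ((z - p)⁻¹ - (z - p')⁻¹)` against the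
      -- remaining factors.
      have key : ∀ γ : Contour, (∀ a ∈ p ::ₘ p' ::ₘ T', a ∉ γ.toFun '' Icc 0 1) →
          γ.integral (polar (p ::ₘ p' ::ₘ T')) = (p - p')⁻¹ *
            (γ.integral (polar (p ::ₘ T')) - γ.integral (polar (p' ::ₘ T'))) := by
        intro γ hγ
        rw [← γ.integral_sub, ← γ.integral_const_mul]
        · refine γ.integral_congr fun z hz => ?_
          have hz1 : z - p ≠ 0 := fun h0 => hγ p hp (by rwa [← sub_eq_zero.1 h0])
          have hz2 : z - p' ≠ 0 := fun h0 =>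
            hγ p' (Multiset.mem_cons_of_mem hp') (by rwa [← sub_eq_zero.1 h0])
          simp only [polar_cons]
          field_simp
          ring
        · exact continuousOn_polar fun a ha => hγ a (by
            rw [Multiset.mem_cons] at ha ⊢
            exact ha.imp_right Multiset.mem_cons_of_mem)
        · exact continuousOn_polar fun a ha => hγ a (Multiset.mem_cons_of_mem ha)
      rw [key γ₁ fun a ha => Contour.notMem_image (hS a ha).1,
        key γ₂ fun a ha => Contour.notMem_image (hS a ha).2.1, h1, h2]

/-- The open annulus `r < |z| < R`. -/
def annulus (r R : ℝ) : Set ℂ := {z | r < ‖z‖ ∧ ‖z‖ < R}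

theorem isOpen_annulus (r R : ℝ) : IsOpen (annulus r R) :=
  (isOpen_lt continuous_const continuous_norm).inter (isOpen_lt continuous_norm continuous_const)

/-- On the annulus `r < |z| < R`, the function `F` is a holomorphic function divided by a product of
linear factors with zeros in `P`. -/
def IsFactored (P : Set ℂ) (r R : ℝ) (F : ℂ → ℂ) : Prop :=
  ∃ (S : Multiset ℂ) (H : ℂ → ℂ), (∀ p ∈ S, p ∈ P) ∧ DifferentiableOn ℂ H (annulus r R) ∧
    ∀ z ∈ annulus r R, F z = H z * polar S z

theorem IsFactored.mul {P : Set ℂ} {r R : ℝ} {F G : ℂ → ℂ} (hF : IsFactored P r R F)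
    (hG : IsFactored P r R G) : IsFactored P r R fun z => F z * G z := by
  obtain ⟨S, H, hS, hH, hF⟩ := hF
  obtain ⟨S', H', hS', hH', hG⟩ := hG
  refine ⟨S + S', fun z => H z * H' z, fun p hp => ?_, hH.mul hH', fun z hz => ?_⟩
  · exact (Multiset.mem_add.1 hp).elim (hS p) (hS' p)
  · beta_reduce
    rw [hF z hz, hG z hz, polar_add]
    ring

theorem IsFactored.of_differentiableOn {P : Set ℂ} {r R : ℝ} {F : ℂ → ℂ}
    (hF : DifferentiableOn ℂ F (annulus r R)) : IsFactored P r R F :=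
  ⟨0, F, by simp, hF, fun z _ => by rw [polar_zero, mul_one]⟩

theorem IsFactored.sub_inv {P : Set ℂ} {p : ℂ} (hp : p ∈ P) (r R : ℝ) :
    IsFactored P r R fun z => (z - p)⁻¹ :=
  ⟨{p}, fun _ => 1, by simpa using hp, differentiableOn_const 1, fun z _ => by simp [polar]⟩

theorem IsFactored.congr {P : Set ℂ} {r R : ℝ} {F G : ℂ → ℂ} (hF : IsFactored P r R F)
    (h : ∀ z ∈ annulus r R, G z = F z) : IsFactored P r R G := by
  obtain ⟨S, H, hS, hH, hF⟩ := hF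
  exact ⟨S, H, hS, hH, fun z hz => (h z hz).trans (hF z hz)⟩

theorem IsFactored.prod {ι : Type*} {P : Set ℂ} {r R : ℝ} {F : ι → ℂ → ℂ} (s : Finset ι)
    (hF : ∀ i ∈ s, IsFactored P r R (F i)) : IsFactored P r R fun z => ∏ i ∈ s, F i z := by
  classical
  induction s using Finset.induction_on with
  | empty => simpa using IsFactored.of_differentiableOn (differentiableOn_const 1)
  | insert i s hi ih =>
    simp only [Finset.prod_insert hi]
    exact (hF i (Finset.mem_insert_self i s)).mul
      (ih fun k hk => hF k (Finset.mem_insert_of_mem hk))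

theorem IsFactored.continuousOn {P : Set ℂ} {r R : ℝ} {F : ℂ → ℂ} (hF : IsFactored P r R F)
    {K : Set ℂ} (hK : K ⊆ annulus r R) (hP : ∀ p ∈ P, p ∉ K) : ContinuousOn F K := by
  obtain ⟨S, H, hS, hH, hF⟩ := hF
  exact ((hH.continuousOn.mono hK).mul (continuousOn_polar fun p hp => hP p (hS p hp))).congr
    fun z hz => hF z (hK hz)

theorem exists_subset_annulus {K : Set ℂ} (hK : IsCompact K) (h0 : (0 : ℂ) ∉ K) :
    ∃ r R, 0 < r ∧ K ⊆ annulus r R := by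
  obtain ⟨R, hR⟩ := hK.isBounded.exists_norm_le
  have hd : ∃ r, 0 < r ∧ ∀ z ∈ K, r < ‖z‖ := by
    have hopen : Kᶜ ∈ nhds (0 : ℂ) := hK.isClosed.isOpen_compl.mem_nhds h0
    obtain ⟨ε, hε, hb⟩ := Metric.mem_nhds_iff.1 hopen
    refine ⟨ε / 2, by positivity, fun z hz => ?_⟩
    by_contra! hle
    exact hb (show z ∈ Metric.ball 0 ε by simp; linarith) hz
  obtain ⟨r, hr, hr'⟩ := hd
  exact ⟨r, R + 1, hr, fun z hz => ⟨hr' z hz, by linarith [hR z hz]⟩⟩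

theorem Contour.integral_eq_of_differentiableOn {γ₁ γ₂ : Contour} {r R : ℝ} (hr : 0 < r)
    {H : ℂ → ℂ} (hH : DifferentiableOn ℂ H (annulus r R))
    (h₁ : γ₁.toFun '' Icc 0 1 ⊆ annulus r R) (h₂ : γ₂.toFun '' Icc 0 1 ⊆ annulus r R)
    (h0 : γ₁.winding 0 = γ₂.winding 0) : γ₁.integral H = γ₂.integral H := by
  set K := γ₁.toFun '' Icc 0 1 ∪ γ₂.toFun '' Icc 0 1 with hK
  have hKc : IsCompact K := γ₁.isCompact_image.union γ₂.isCompact_image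
  have hKs : K ⊆ annulus r R := union_subset h₁ h₂
  have hne : K.Nonempty := ⟨γ₁.toFun 0, Or.inl (mem_image_of_mem _ (by simp))⟩
  obtain ⟨a, ha, hamin⟩ := hKc.exists_isMinOn hne continuous_norm.continuousOn
  obtain ⟨b, hb, hbmax⟩ := hKc.exists_isMaxOn hne continuous_norm.continuousOn
  -- Compactness of both curves leaves room for a closed annulus inside the open one, as
  -- `Contour.integral_of_annulus` needs holomorphy up to the boundary circles.
  obtain ⟨r', hr1, hr2⟩ := exists_between (hKs ha).1
  obtain ⟨R', hR1, hR2⟩ := exists_between (hKs hb).2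
  have hd : ∀ z, r' ≤ ‖z‖ → ‖z‖ ≤ R' → DifferentiableAt ℂ H z := fun z hz1 hz2 =>
    (hH z ⟨hr1.trans_le hz1, hz2.trans_lt hR2⟩).differentiableAt
      ((isOpen_annulus r R).mem_nhds ⟨hr1.trans_le hz1, hz2.trans_lt hR2⟩)
  have hin : ∀ z ∈ K, r' < ‖z‖ ∧ ‖z‖ < R' := fun z hz =>
    ⟨hr2.trans_le (hamin hz), (show ‖z‖ ≤ ‖b‖ from hbmax hz).trans_lt hR1⟩
  rw [γ₁.integral_of_annulus (hr.trans hr1) hd fun z hz => hin z (Or.inl hz),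
    γ₂.integral_of_annulus (hr.trans hr1) hd fun z hz => hin z (Or.inr hz), h0]

/-- The poles are split off one at a time: `H z / (z - p)` is the difference quotient of `H` at `p`,
which is holomorphic, plus the constant `H p` times `(z - p)⁻¹`. The constants leave purely polar
integrals. -/
theorem Contour.integral_mul_polar_eq {γ₁ γ₂ : Contour} {r R : ℝ} (hr : 0 < r)
    (h₁ : γ₁.toFun '' Icc 0 1 ⊆ annulus r R) (h₂ : γ₂.toFun '' Icc 0 1 ⊆ annulus r R)
    (h0 : γ₁.winding 0 = γ₂.winding 0) (S : Multiset ℂ) (hS : ∀ p ∈ S, γ₁.SameWinding γ₂ p) :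
    ∀ H : ℂ → ℂ, DifferentiableOn ℂ H (annulus r R) →
      γ₁.integral (fun z => H z * polar S z) = γ₂.integral (fun z => H z * polar S z) := by
  induction S using Multiset.induction with
  | empty =>
    intro H hH
    simp only [polar_zero, mul_one]
    exact Contour.integral_eq_of_differentiableOn hr hH h₁ h₂ h0
  | cons p S ih =>
    intro H hH
    have ih' := ih fun a ha => hS a (Multiset.mem_cons_of_mem ha)
    by_cases hp : p ∈ annulus r R
    · have hn : annulus r R ∈ nhds p := (isOpen_annulus r R).mem_nhds hp
      have hd := (Complex.differentiableOn_dslope hn).2 hH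
      have key : ∀ γ : Contour, γ.toFun '' Icc 0 1 ⊆ annulus r R →
          (∀ a ∈ p ::ₘ S, a ∉ γ.toFun '' Icc 0 1) →
          γ.integral (fun z => H z * polar (p ::ₘ S) z)
            = γ.integral (fun z => dslope H p z * polar S z)
              + H p * γ.integral (polar (p ::ₘ S)) := by
        intro γ hγ hγp
        rw [← γ.integral_const_mul, ← γ.integral_add]
        · refine γ.integral_congr fun z hz => ?_
          have hz1 : z - p ≠ 0 := fun h0 =>
            hγp p (Multiset.mem_cons_self p S) (by rwa [← sub_eq_zero.1 h0])
          rw [dslope_of_ne _ (sub_ne_zero.1 hz1), slope_def_field, polar_cons]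
          field_simp
          ring
        · exact (hd.continuousOn.mono hγ).mul
            (continuousOn_polar fun a ha => hγp a (Multiset.mem_cons_of_mem ha))
        · exact continuousOn_const.mul (continuousOn_polar hγp)
      rw [key γ₁ h₁ fun a ha => Contour.notMem_image (hS a ha).1,
        key γ₂ h₂ fun a ha => Contour.notMem_image (hS a ha).2.1, ih' _ hd,
        Contour.integral_polar_eq _ _ rfl hS]
    -- A pole outside the annulus is no singularity there, and its factor is absorbed into the
    -- holomorphic part.
    · have e : ∀ z, H z * polar (p ::ₘ S) z = (H z * (z - p)⁻¹) * polar S z := fun z => by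
        rw [polar_cons]; ring
      simp only [e]
      refine ih' _ (hH.mul ((differentiableOn_id.sub (differentiableOn_const p)).fun_inv
        fun z hz h0 => hp ((sub_eq_zero.1 h0 : z = p) ▸ hz)))

/-- Curves with the same winding numbers around `0` and around all the poles of `F` yield the same
integral of `F`. -/
theorem Contour.integral_eq_of_sameWinding {γ₁ γ₂ : Contour} {P : Set ℂ} {F : ℂ → ℂ}
    (h0 : γ₁.SameWinding γ₂ 0) (hP : ∀ p ∈ P, γ₁.SameWinding γ₂ p)
    (hF : ∀ r R, 0 < r → IsFactored P r R F) : γ₁.integral F = γ₂.integral F := by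
  obtain ⟨r, R, hr, hK⟩ := exists_subset_annulus (γ₁.isCompact_image.union γ₂.isCompact_image)
    fun h => h.elim (Contour.notMem_image h0.1) (Contour.notMem_image h0.2.1)
  obtain ⟨S, H, hS, hH, hFH⟩ := hF r R hr
  rw [γ₁.integral_congr fun z hz => hFH z (hK (Or.inl hz)),
    γ₂.integral_congr fun z hz => hFH z (hK (Or.inr hz))]
  exact Contour.integral_mul_polar_eq hr (subset_union_left.trans hK) (subset_union_right.trans hK)
    h0.2.2 S (fun p hp => hP p (hS p hp)) H hH

theorem Contour.continuousOn_of_isFactored {γ : Contour} {P : Set ℂ} {F : ℂ → ℂ}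
    (h0 : ∀ τ ∈ Icc (0 : ℝ) 1, γ.toFun τ ≠ 0)
    (hP : ∀ p ∈ P, ∀ τ ∈ Icc (0 : ℝ) 1, γ.toFun τ ≠ p)
    (hF : ∀ r R, 0 < r → IsFactored P r R F) : ContinuousOn F (γ.toFun '' Icc 0 1) := by
  obtain ⟨r, R, hr, hK⟩ := exists_subset_annulus γ.isCompact_image (Contour.notMem_image h0)
  exact (hF r R hr).continuousOn hK fun p hp => Contour.notMem_image (hP p hp)

end AWOverlap

end

noncomputable section

namespace AWOverlap

open Complex Set Filter Topology

/-! ### Infinite shifted factorials -/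

theorem summable_qPoch {b : ℂ} (hb : ‖b‖ < 1) (a : ℂ) : Summable fun k : ℕ => ‖-(a * b ^ k)‖ := by
  simp only [norm_neg, norm_mul, norm_pow]
  exact (summable_geometric_of_lt_one (norm_nonneg b) hb).mul_left _

theorem multipliable_qPoch {b : ℂ} (hb : ‖b‖ < 1) (a : ℂ) :
    Multipliable fun k : ℕ => (1 - a * b ^ k) := by
  simpa only [sub_eq_add_neg] using multipliable_one_add_of_summable (summable_qPoch hb a)

theorem prod_mul_qPoch {b : ℂ} (hb : ‖b‖ < 1) (a : ℂ) (n : ℕ) :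
    (∏ k ∈ Finset.range n, (1 - a * b ^ k)) * qPoch (a * b ^ n) b = qPoch a b := by
  have h : ∀ k : ℕ, 1 - a * b ^ (k + n) = 1 - a * b ^ n * b ^ k := fun k => by ring
  have := Multipliable.prod_mul_tprod_nat_mul' (f := fun k : ℕ => (1 - a * b ^ k)) (k := n)
    (by simpa only [h] using multipliable_qPoch hb (a * b ^ n))
  simp only [h] at this
  exact this

theorem qPoch_eq {b : ℂ} (hb : ‖b‖ < 1) (a : ℂ) : qPoch a b = (1 - a) * qPoch (a * b) b := by
  simpa using (prod_mul_qPoch hb a 1).symm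

/-- No single factor vanishes, as `|a b^k| < 1`, and an absolutely convergent product of nonzero
factors is nonzero. -/
theorem qPoch_ne_zero_of_norm_lt {a b : ℂ} (hb : ‖b‖ < 1) (ha : ‖a‖ < 1) : qPoch a b ≠ 0 := by
  simp only [qPoch, sub_eq_add_neg]
  refine tprod_one_add_ne_zero_of_summable (fun k h => ?_) (summable_qPoch hb a)
  have h1 : a * b ^ k = 1 := by linear_combination -h
  have h2 : ‖a * b ^ k‖ < 1 := by
    rw [norm_mul, norm_pow]
    exact mul_lt_one_of_nonneg_of_lt_one_left (norm_nonneg _) ha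
      (pow_le_one₀ (norm_nonneg _) hb.le)
  rw [h1, norm_one] at h2
  exact lt_irrefl _ h2

theorem exists_norm_mul_pow_lt {b : ℂ} (hb : ‖b‖ < 1) (c : ℝ) : ∃ n : ℕ, c * ‖b‖ ^ n < 1 := by
  have h := (tendsto_pow_atTop_nhds_zero_of_lt_one (norm_nonneg b) hb).const_mul c
  rw [mul_zero] at h
  exact (h.eventually (gt_mem_nhds one_pos)).exists

theorem differentiable_qPoch {b : ℂ} (hb : ‖b‖ < 1) : Differentiable ℂ fun a => qPoch a b := by
  intro a
  have hopen : IsOpen (Metric.ball (0 : ℂ) (‖a‖ + 1)) := Metric.isOpen_ball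
  have h := Summable.hasProdLocallyUniformlyOn_nat_one_add (f := fun (k : ℕ) (a : ℂ) => -(a * b ^ k))
    hopen (u := fun k => (‖a‖ + 1) * ‖b‖ ^ k)
    ((summable_geometric_of_lt_one (norm_nonneg b) hb).mul_left _)
    (Eventually.of_forall fun k x hx => by
      rw [norm_neg, norm_mul, norm_pow]
      exact mul_le_mul_of_nonneg_right (by simpa using hx.out.le) (by positivity))
    (fun k => by fun_prop)
  have hd : DifferentiableOn ℂ (fun a => ∏' k : ℕ, (1 + -(a * b ^ k)))
      (Metric.ball (0 : ℂ) (‖a‖ + 1)) :=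
    h.differentiableOn (Eventually.of_forall fun s => by
      simp only
      fun_prop) hopen
  simp only [← sub_eq_add_neg] at hd
  exact (hd a (by simp)).differentiableAt (hopen.mem_nhds (by simp))

/-- Quasi-periodicity: under the shift one of the two products gains a factor and the other loses
one, and the quotient of these factors is a monomial. -/
theorem qTheta_div {b : ℂ} (hb : ‖b‖ < 1) (hb0 : b ≠ 0) {a : ℂ} (ha : a ≠ 0) :
    qTheta (a / b) b = -(a / b) * qTheta a b := by
  rw [qTheta, qTheta, qPoch_eq hb (a / b), div_mul_cancel₀ a hb0,
    qPoch_eq hb (b / a), show b / (a / b) = b / a * b by field_simp]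
  field_simp
  ring

theorem qTheta_mul {b : ℂ} (hb : ‖b‖ < 1) (hb0 : b ≠ 0) {a : ℂ} (ha : a ≠ 0) :
    qTheta (a * b) b = -a⁻¹ * qTheta a b := by
  have h := qTheta_div hb hb0 (mul_ne_zero ha hb0)
  rw [mul_div_cancel_right₀ a hb0] at h
  rw [h]
  field_simp

/-! ### Factorization of shifted factorials on annuli -/

/-- On a bounded set only finitely many factors of the product can vanish. These become the linear
factors. The tail has argument of norm less than `1` and so has a holomorphic inverse. -/
theorem IsFactored.qPoch_mul_inv {P : Set ℂ} (r R : ℝ) {a b : ℂ} (hb : ‖b‖ < 1)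
    (hb0 : b ≠ 0) (ha : a ≠ 0) (hP : ∀ k : ℕ, (a * b ^ k)⁻¹ ∈ P) :
    IsFactored P r R fun z => (AWOverlap.qPoch (a * z) b)⁻¹ := by
  obtain ⟨n, hn⟩ := exists_norm_mul_pow_lt hb (‖a‖ * |R|)
  have h1 : IsFactored P r R fun z => (AWOverlap.qPoch (a * z * b ^ n) b)⁻¹ := by
    refine .of_differentiableOn (DifferentiableOn.fun_inv
      ((differentiable_qPoch hb).comp_differentiableOn (by fun_prop)) fun z hz => ?_)
    refine qPoch_ne_zero_of_norm_lt hb ?_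
    rw [norm_mul, norm_mul, norm_pow]
    refine lt_of_le_of_lt ?_ hn
    gcongr
    exact hz.2.le.trans (le_abs_self R)
  have h2 : IsFactored P r R fun z => ∏ k ∈ Finset.range n, (-(a * b ^ k)⁻¹) *
      (z - (a * b ^ k)⁻¹)⁻¹ :=
    .prod _ fun k _ => (IsFactored.of_differentiableOn (differentiableOn_const _)).mul
      (.sub_inv (hP k) r R)
  refine (h2.mul h1).congr fun z _ => ?_
  rw [← prod_mul_qPoch hb (a * z) n, mul_inv, ← Finset.prod_inv_distrib]
  congr 1
  refine Finset.prod_congr rfl fun k _ => ?_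
  have h3 : a * b ^ k ≠ 0 := mul_ne_zero ha (pow_ne_zero _ hb0)
  rw [neg_mul, ← mul_inv, ← inv_neg]
  congr 1
  rw [mul_sub, mul_inv_cancel₀ h3]
  ring

/-- The same splitting with the roles of `0` and infinity exchanged: away from `0` all but finitely
many factors are harmless, and `(1 - a b^k / z)⁻¹ = z (z - a b^k)⁻¹`. -/
theorem IsFactored.qPoch_div_inv {P : Set ℂ} {r : ℝ} (hr : 0 < r) (R : ℝ) {a b : ℂ}
    (hb : ‖b‖ < 1) (hP : ∀ k : ℕ, a * b ^ k ∈ P) :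
    IsFactored P r R fun z => (AWOverlap.qPoch (a / z) b)⁻¹ := by
  have hz0 : ∀ z ∈ annulus r R, z ≠ 0 := fun z hz => norm_pos_iff.1 (hr.trans hz.1)
  obtain ⟨n, hn⟩ := exists_norm_mul_pow_lt hb (‖a‖ / r)
  have h1 : IsFactored P r R fun z => (AWOverlap.qPoch (a / z * b ^ n) b)⁻¹ := by
    refine .of_differentiableOn (DifferentiableOn.fun_inv
      ((differentiable_qPoch hb).comp_differentiableOn
        (((differentiableOn_const a).div differentiableOn_id hz0).mul_const _)) fun z hz => ?_)
    refine qPoch_ne_zero_of_norm_lt hb ?_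
    rw [norm_mul, norm_div, norm_pow]
    refine lt_of_le_of_lt ?_ hn
    gcongr
    exact hz.1.le
  have h2 : IsFactored P r R fun z => ∏ k ∈ Finset.range n, z * (z - a * b ^ k)⁻¹ :=
    .prod _ fun k _ => (IsFactored.of_differentiableOn differentiableOn_id).mul
      (.sub_inv (hP k) r R)
  refine (h2.mul h1).congr fun z hz => ?_
  rw [← prod_mul_qPoch hb (a / z) n, mul_inv, ← Finset.prod_inv_distrib]
  congr 1
  refine Finset.prod_congr rfl fun k _ => ?_
  have h3 := hz0 z hz
  rw [← inv_inv z, ← mul_inv, inv_inv]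
  congr 1
  field_simp

end AWOverlap

end

noncomputable section

namespace AWOverlap

open Complex Set Filter Topology MeasureTheory intervalIntegral

/-! ### Concatenation of closed curves, circles -/

/-- The concatenation of two closed curves with a common base point. -/
def Contour.concat (γ₁ γ₂ : Contour) (h : γ₁.toFun 0 = γ₂.toFun 0) : Contour where
  toFun τ := if τ ≤ 1 / 2 then γ₁.toFun (2 * τ) else γ₂.toFun (2 * τ - 1)
  closed := by
    norm_num
    rw [h, γ₂.closed]
  piecewise := by
    obtain ⟨n₁, p₁, hp₁, h01, h11, hd₁⟩ := γ₁.piecewise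
    obtain ⟨n₂, p₂, hp₂, h02, h12, hd₂⟩ := γ₂.piecewise
    -- The last index `n₁ + n₂` has to fall into the second branch of the list of break points. At
    -- `i = n₁` both branches give `1/2`.
    have hn₂ : n₂ ≠ 0 := by
      rintro rfl
      rw [h02] at h12
      exact zero_ne_one h12
    refine ⟨n₁ + n₂, fun i => if i ≤ n₁ then p₁ i / 2 else (1 + p₂ (i - n₁)) / 2,
      monotone_nat_of_le_succ fun i => ?_, by simp [h01], ?_, fun i hi => ?_⟩
    · by_cases h1 : i + 1 ≤ n₁
      · rw [if_pos h1, if_pos (by omega)]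
        linarith [hp₁ (Nat.le_succ i)]
      · rw [if_neg h1]
        by_cases h2 : i ≤ n₁
        · rw [if_pos h2]
          have e1 := hp₁ h2
          have e2 := hp₂ (Nat.zero_le (i + 1 - n₁))
          linarith
        · rw [if_neg h2]
          linarith [hp₂ (show i - n₁ ≤ i + 1 - n₁ by omega)]
    · beta_reduce
      rw [if_neg (by omega), Nat.add_sub_cancel_left, h12]
      norm_num
    · by_cases h1 : i + 1 ≤ n₁
      · simp only [if_pos h1, if_pos (show i ≤ n₁ by omega)]
        have e1 := hp₁ h1
        refine ((hd₁ i (by omega)).comp (g := γ₁.toFun) (f := fun τ : ℝ => 2 * τ)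
          (by fun_prop) fun τ hτ => ?_).congr fun τ hτ => ?_
        · exact ⟨by linarith [hτ.1], by linarith [hτ.2]⟩
        · rw [if_pos (by linarith [hτ.2])]
          rfl
      · have hpi : (if i ≤ n₁ then p₁ i / 2 else (1 + p₂ (i - n₁)) / 2)
            = (1 + p₂ (i - n₁)) / 2 := by
          split_ifs with h2
          · have : i = n₁ := by omega
            subst this
            simp [h11, h02]
          · rfl
        simp only [hpi, if_neg h1]
        have e2 := hp₂ (Nat.zero_le (i - n₁))
        have hd := hd₂ (i - n₁) (by omega)
        rw [show i - n₁ + 1 = i + 1 - n₁ by omega] at hd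
        refine (hd.comp (g := γ₂.toFun) (f := fun τ : ℝ => 2 * τ - 1)
          (by fun_prop) fun τ hτ => ?_).congr fun τ hτ => ?_
        · exact ⟨by linarith [hτ.1], by linarith [hτ.2]⟩
        · split_ifs with h3
          · have : τ = 1 / 2 := by linarith [hτ.1]
            subst this
            simp only [Function.comp]
            norm_num
            rw [← γ₁.closed, h]
          · rfl

theorem Contour.concat_ne {γ₁ γ₂ : Contour} (h : γ₁.toFun 0 = γ₂.toFun 0) {p : ℂ}
    (h₁ : ∀ τ ∈ Icc (0 : ℝ) 1, γ₁.toFun τ ≠ p) (h₂ : ∀ τ ∈ Icc (0 : ℝ) 1, γ₂.toFun τ ≠ p) :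
    ∀ τ ∈ Icc (0 : ℝ) 1, (γ₁.concat γ₂ h).toFun τ ≠ p := by
  intro τ hτ
  simp only [Contour.concat]
  split_ifs with h3
  · exact h₁ _ ⟨by linarith [hτ.1], by linarith⟩
  · exact h₂ _ ⟨by linarith, by linarith [hτ.2]⟩

theorem Contour.integral_concat {γ₁ γ₂ : Contour} (h : γ₁.toFun 0 = γ₂.toFun 0) {F : ℂ → ℂ}
    (hF : ContinuousOn F ((γ₁.concat γ₂ h).toFun '' Icc 0 1)) :
    (γ₁.concat γ₂ h).integral F = γ₁.integral F + γ₂.integral F := by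
  have hint := (γ₁.concat γ₂ h).intervalIntegrable hF
  have hi1 : IntervalIntegrable (fun τ => F ((γ₁.concat γ₂ h).toFun τ) *
      deriv (γ₁.concat γ₂ h).toFun τ) volume 0 (1 / 2) := hint.mono_set (by
    rw [uIcc_of_le (by norm_num), uIcc_of_le (by norm_num)]
    exact Icc_subset_Icc le_rfl (by norm_num))
  have hi2 : IntervalIntegrable (fun τ => F ((γ₁.concat γ₂ h).toFun τ) *
      deriv (γ₁.concat γ₂ h).toFun τ) volume (1 / 2) 1 := hint.mono_set (by
    rw [uIcc_of_le (by norm_num), uIcc_of_le (by norm_num)]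
    exact Icc_subset_Icc (by norm_num) le_rfl)
  rw [Contour.integral, ← integral_add_adjacent_intervals hi1 hi2]
  congr 1
  · have e : ∫ τ in (0 : ℝ)..1 / 2, F ((γ₁.concat γ₂ h).toFun τ) * deriv (γ₁.concat γ₂ h).toFun τ
        = ∫ τ in (0 : ℝ)..1 / 2, (fun σ => 2 * (F (γ₁.toFun σ) * deriv γ₁.toFun σ)) (2 * τ) := by
      refine integral_congr_uIoo fun τ hτ => ?_
      rw [uIoo_of_le (by norm_num)] at hτ
      have e1 : (γ₁.concat γ₂ h).toFun =ᶠ[𝓝 τ] fun σ => γ₁.toFun (2 * σ) := by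
        filter_upwards [gt_mem_nhds hτ.2] with σ hσ
        simp only [Contour.concat, if_pos hσ.le]
      beta_reduce
      rw [e1.deriv_eq, e1.eq_of_nhds, deriv_comp_mul_left, Complex.real_smul]
      push_cast
      ring
    rw [e, intervalIntegral.integral_comp_mul_left (fun σ => 2 * (F (γ₁.toFun σ) *
      deriv γ₁.toFun σ)) (two_ne_zero (α := ℝ)), Contour.integral,
      intervalIntegral.integral_const_mul]
    norm_num
    ring
  · have e : ∫ τ in (1 / 2 : ℝ)..1, F ((γ₁.concat γ₂ h).toFun τ) * deriv (γ₁.concat γ₂ h).toFun τ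
        = ∫ τ in (1 / 2 : ℝ)..1,
          (fun σ => 2 * (F (γ₂.toFun σ) * deriv γ₂.toFun σ)) (2 * τ - 1) := by
      refine integral_congr_uIoo fun τ hτ => ?_
      rw [uIoo_of_le (by norm_num)] at hτ
      have e1 : (γ₁.concat γ₂ h).toFun =ᶠ[𝓝 τ] fun σ => (fun ρ => γ₂.toFun (ρ - 1)) (2 * σ) := by
        filter_upwards [lt_mem_nhds hτ.1] with σ hσ
        simp only [Contour.concat, if_neg (not_le.2 hσ)]
      beta_reduce
      rw [e1.deriv_eq, e1.eq_of_nhds, deriv_comp_mul_left (f := fun ρ => γ₂.toFun (ρ - 1)),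
        deriv_comp_sub_const, Complex.real_smul]
      push_cast
      ring
    rw [e, intervalIntegral.integral_comp_mul_sub (fun σ => 2 * (F (γ₂.toFun σ) *
      deriv γ₂.toFun σ)) (two_ne_zero (α := ℝ)), Contour.integral,
      intervalIntegral.integral_const_mul]
    norm_num
    ring

theorem continuousOn_sub_inv {γ : Contour} {p : ℂ} (h : ∀ τ ∈ Icc (0 : ℝ) 1, γ.toFun τ ≠ p) :
    ContinuousOn (fun z => (z - p)⁻¹) (γ.toFun '' Icc 0 1) :=
  (continuousOn_id.sub continuousOn_const).inv₀ fun z hz h0 =>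
    Contour.notMem_image h ((sub_eq_zero.1 h0 : z = p) ▸ hz)

theorem Contour.winding_concat {γ₁ γ₂ : Contour} (h : γ₁.toFun 0 = γ₂.toFun 0) {p : ℂ}
    (h₁ : ∀ τ ∈ Icc (0 : ℝ) 1, γ₁.toFun τ ≠ p) (h₂ : ∀ τ ∈ Icc (0 : ℝ) 1, γ₂.toFun τ ≠ p) :
    (γ₁.concat γ₂ h).winding p = γ₁.winding p + γ₂.winding p := by
  rw [Contour.winding, Contour.integral_concat h
    (continuousOn_sub_inv (Contour.concat_ne h h₁ h₂)), mul_add]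
  rfl

/-- The image of a curve under a translation. -/
def Contour.translate (γ : Contour) (c : ℂ) : Contour where
  toFun τ := c + γ.toFun τ
  closed := by rw [γ.closed]
  piecewise := by
    obtain ⟨n, p, hp, h0, h1, hd⟩ := γ.piecewise
    exact ⟨n, p, hp, h0, h1, fun i hi => contDiffOn_const.add (hd i hi)⟩

theorem Contour.winding_translate (γ : Contour) (c p : ℂ) :
    (γ.translate c).winding p = γ.winding (p - c) := by
  simp only [Contour.winding, Contour.integral, Contour.translate, deriv_const_add]
  congr 2
  funext τ
  congr 2
  ring

/-- The circle around `0` through `w`, traversed `m` times. -/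
def circleContour (w : ℂ) (m : ℤ) : Contour where
  toFun τ := w * exp (2 * Real.pi * I * m * τ)
  closed := by
    have := Complex.exp_int_mul_two_pi_mul_I m
    simp only [ofReal_zero, ofReal_one, mul_zero, mul_one, exp_zero]
    rw [show 2 * Real.pi * I * m = m * (2 * Real.pi * I) by ring, this, mul_one]
  piecewise := by
    refine ⟨1, fun i => i, Nat.mono_cast, by simp, by simp, fun i _ => ?_⟩
    refine ContDiff.contDiffOn (contDiff_const.mul (ContDiff.cexp (contDiff_const.mul ?_)))
    exact ofRealCLM.contDiff

theorem norm_circleContour (w : ℂ) (m : ℤ) (τ : ℝ) : ‖(circleContour w m).toFun τ‖ = ‖w‖ := by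
  have h : 2 * Real.pi * I * m * τ = ((2 * Real.pi * m * τ : ℝ) : ℂ) * I := by push_cast; ring
  simp only [circleContour]
  rw [h, norm_mul, norm_exp_ofReal_mul_I, mul_one]

theorem winding_circleContour_zero {w : ℂ} (hw : w ≠ 0) (m : ℤ) :
    (circleContour w m).winding 0 = m := by
  have hpi : (2 * Real.pi * I : ℂ) ≠ 0 := by simp [Real.pi_ne_zero]
  have h : ∀ τ : ℝ, ((circleContour w m).toFun τ - 0)⁻¹ * deriv (circleContour w m).toFun τ
      = 2 * Real.pi * I * m := by
    intro τ
    have h1 : HasDerivAt (circleContour w m).toFun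
        (w * (exp (2 * Real.pi * I * m * τ) * (2 * Real.pi * I * m * 1))) τ :=
      ((ofRealCLM.hasDerivAt (x := τ)).const_mul (2 * Real.pi * I * m)).cexp.const_mul w
    rw [h1.deriv]
    simp only [circleContour]
    have := Complex.exp_ne_zero (2 * Real.pi * I * m * τ)
    field_simp
    ring
  simp only [Contour.winding, Contour.integral, h, intervalIntegral.integral_const]
  rw [sub_zero, one_smul, inv_mul_cancel_left₀ hpi]

/-- The circle around `c` through `b`, traversed `m` times starting from `b`. -/
def circleThrough (c b : ℂ) (m : ℤ) : Contour := (circleContour (b - c) m).translate c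

theorem circleThrough_zero (c b : ℂ) (m : ℤ) : (circleThrough c b m).toFun 0 = b := by
  simp [circleThrough, Contour.translate, circleContour]

theorem circleThrough_ne {c b p : ℂ} (m : ℤ) (h : ‖p - c‖ ≠ ‖b - c‖) :
    ∀ τ ∈ Icc (0 : ℝ) 1, (circleThrough c b m).toFun τ ≠ p := by
  rintro τ - rfl
  apply h
  simp only [circleThrough, Contour.translate, add_sub_cancel_left]
  exact norm_circleContour _ _ _

theorem winding_circleThrough {c b p : ℂ} (m : ℤ) (h : ‖p - c‖ ≠ ‖b - c‖) :
    (circleThrough c b m).winding p = if ‖p - c‖ < ‖b - c‖ then (m : ℂ) else 0 := by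
  rw [circleThrough, Contour.winding_translate]
  split_ifs with h1
  · rw [Contour.winding_eq_of_norm_lt, winding_circleContour_zero]
    · exact norm_pos_iff.1 ((norm_nonneg _).trans_lt h1)
    · rintro z ⟨τ, -, rfl⟩
      rwa [norm_circleContour]
  · refine Contour.winding_eq_zero_of_norm_lt _ ?_
    rintro z ⟨τ, -, rfl⟩
    rw [norm_circleContour]
    exact lt_of_le_of_ne (not_lt.1 h1) (Ne.symm h)

/-! ### Existence of curves with prescribed winding numbers -/

/-- There is a closed curve based at `b` that avoids `S` and has the winding numbers `w` on `S`. -/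
def HasWindings (b : ℂ) (S : Set ℂ) (w : ℂ → ℂ) : Prop :=
  ∃ γ : Contour, γ.toFun 0 = b ∧ ∀ p ∈ S, (∀ τ ∈ Icc (0 : ℝ) 1, γ.toFun τ ≠ p) ∧ γ.winding p = w p

theorem HasWindings.congr {b : ℂ} {S : Set ℂ} {w w' : ℂ → ℂ} (h : HasWindings b S w)
    (hw : ∀ p ∈ S, w p = w' p) : HasWindings b S w' := by
  obtain ⟨γ, h0, h⟩ := h
  exact ⟨γ, h0, fun p hp => ⟨(h p hp).1, (h p hp).2.trans (hw p hp)⟩⟩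

theorem HasWindings.add {b : ℂ} {S : Set ℂ} {w w' : ℂ → ℂ} (h : HasWindings b S w)
    (h' : HasWindings b S w') : HasWindings b S fun p => w p + w' p := by
  obtain ⟨γ, h0, h⟩ := h
  obtain ⟨γ', h0', h'⟩ := h'
  refine ⟨γ.concat γ' (h0.trans h0'.symm), ?_, fun p hp => ⟨Contour.concat_ne _ (h p hp).1
    (h' p hp).1, ?_⟩⟩
  · simp [Contour.concat, h0]
  · rw [Contour.winding_concat _ (h p hp).1 (h' p hp).1, (h p hp).2, (h' p hp).2]

theorem hasWindings_circle {b c : ℂ} {S : Set ℂ} (m : ℤ) (h : ∀ p ∈ S, ‖p - c‖ ≠ ‖b - c‖) :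
    HasWindings b S fun p => if ‖p - c‖ < ‖b - c‖ then (m : ℂ) else 0 :=
  ⟨circleThrough c b m, circleThrough_zero c b m, fun p hp => ⟨circleThrough_ne m (h p hp),
    winding_circleThrough m (h p hp)⟩⟩

/-- A circle through two given points that avoids a countable set. -/
theorem exists_circle {b p : ℂ} (hbp : b ≠ p) {A : Set ℂ} (hA : A.Countable) (hbA : b ∉ A)
    (hpA : p ∉ A) : ∃ t : ℝ, ∀ a ∈ A,
      ‖a - ((b + p) / 2 + I * t * (b - p))‖ ≠ ‖b - ((b + p) / 2 + I * t * (b - p))‖ := by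
  -- The circles through `b` and `p` have their centres on the perpendicular bisector, parametrized
  -- by `t`. Any third point lies on at most one of them, so countably many values of `t` are
  -- excluded.
  have hd : b - p ≠ 0 := sub_ne_zero.2 hbp
  have hsub : ∀ a ∈ A, {t : ℝ | ‖a - ((b + p) / 2 + I * t * (b - p))‖
      = ‖b - ((b + p) / 2 + I * t * (b - p))‖}.Subsingleton := by
    intro a ha
    -- In this coordinate `b` and `p` sit at `1/2` and `-1/2`. The circle condition is affine in
    -- `t`, and it can hold for two values of `t` only at these two points.
    set w := (a - (b + p) / 2) / (b - p) with hw
    have ha' : a = (b + p) / 2 + w * (b - p) := by rw [hw, div_mul_cancel₀ _ hd]; ring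
    have key : ∀ t : ℝ, ‖a - ((b + p) / 2 + I * t * (b - p))‖
        = ‖b - ((b + p) / 2 + I * t * (b - p))‖ → w.re ^ 2 + w.im ^ 2 - 2 * t * w.im = 1 / 4 := by
      intro t ht
      have e1 : a - ((b + p) / 2 + I * t * (b - p)) = (w - I * t) * (b - p) := by rw [ha']; ring
      have e2 : b - ((b + p) / 2 + I * t * (b - p)) = (1 / 2 - I * t) * (b - p) := by ring
      rw [e1, e2, norm_mul, norm_mul] at ht
      have h3 := mul_right_cancel₀ (norm_ne_zero_iff.2 hd) ht
      have h4 : normSq (w - I * t) = normSq (1 / 2 - I * t) := by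
        rw [normSq_eq_norm_sq, normSq_eq_norm_sq, h3]
      simp [normSq_apply] at h4
      nlinarith
    intro t ht t' ht'
    by_contra hne
    have k1 := key t ht
    have k2 := key t' ht'
    have him : w.im = 0 := by
      have : (t - t') * w.im = 0 := by linarith
      exact (mul_eq_zero.1 this).resolve_left (sub_ne_zero.2 hne)
    have hre : (w.re - 1 / 2) * (w.re + 1 / 2) = 0 := by rw [him] at k1; nlinarith
    have hwre : w = w.re := Complex.ext (by simp) (by simp [him])
    rcases mul_eq_zero.1 hre with h | h
    · have : w = 1 / 2 := by
        rw [hwre, show w.re = 1 / 2 by linarith]; push_cast; ring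
      exact hbA (by rwa [ha', this, show (b + p) / 2 + 1 / 2 * (b - p) = b by ring] at ha)
    · have : w = -1 / 2 := by
        rw [hwre, show w.re = -1 / 2 by linarith]; push_cast; ring
      exact hpA (by rwa [ha', this, show (b + p) / 2 + -1 / 2 * (b - p) = p by ring] at ha)
  have hc : (⋃ a ∈ A, {t : ℝ | ‖a - ((b + p) / 2 + I * t * (b - p))‖
      = ‖b - ((b + p) / 2 + I * t * (b - p))‖}).Countable :=
    hA.biUnion fun a ha => (hsub a ha).countable
  obtain ⟨t, ht⟩ := (Set.Countable.dense_compl ℝ hc).nonempty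
  refine ⟨t, fun a ha h => ht ?_⟩
  exact mem_biUnion ha h

/-- Choose a circle through `b` and `p` that avoids the other points, and move its centre slightly
towards and away from `p`, keeping `b` on it. One of the two circles contains `p`, the other does
not, and all other points lie on the same side of both. Traversing the first `m` times and the
second `-m` times winds around `p` alone. -/
theorem hasWindings_single {b p : ℂ} {S : Set ℂ} (hbp : b ≠ p) (hS : S.Countable) (hb : b ∉ S)
    (hcl : IsClosed (S \ {p})) (m : ℤ) : HasWindings b S fun a => if a = p then (m : ℂ) else 0 := by
  have hd : b - p ≠ 0 := sub_ne_zero.2 hbp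
  obtain ⟨t, ht⟩ := exists_circle hbp (hS.mono sdiff_subset) (fun h => hb h.1)
    (fun h : p ∈ S \ {p} => h.2 rfl)
  set c := (b + p) / 2 + I * t * (b - p) with hc
  -- The other points keep a positive distance from the circle, by compactness near it and trivially
  -- beyond distance `1`. This is where closedness of `S \ {p}` enters.
  obtain ⟨ε, hε, hgap⟩ : ∃ ε > 0, ∀ a ∈ S \ {p}, ε ≤ |‖a - c‖ - ‖b - c‖| := by
    have hcpt : IsCompact (S \ {p} ∩ Metric.closedBall c (‖b - c‖ + 1)) :=
      (isCompact_closedBall _ _).inter_left hcl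
    obtain ⟨ε, hε, h⟩ := hcpt.exists_forall_le' (f := fun a => |‖a - c‖ - ‖b - c‖|) (a := 0)
      (by fun_prop) fun a ha => abs_pos.2 (sub_ne_zero.2 (ht a ha.1))
    refine ⟨min ε 1, lt_min hε one_pos, fun a ha => ?_⟩
    by_cases hac : a ∈ Metric.closedBall c (‖b - c‖ + 1)
    · exact (min_le_left _ _).trans (h a ⟨ha, hac⟩)
    · rw [Metric.mem_closedBall, dist_eq_norm, not_le] at hac
      exact (min_le_right _ _).trans (le_abs.2 (Or.inl (by linarith)))
  -- The centre then moves by `ε / 4`, so comparing the distance of a point with the radius changes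
  -- the difference by at most `ε / 2`, less than the gap `ε`.
  set δ : ℝ := ε / (4 * ‖b - p‖) with hδ
  have hdn : 0 < ‖b - p‖ := norm_pos_iff.2 hd
  have hδ0 : 0 < δ := by positivity
  have hshift : ∀ η : ℝ, |η| = δ → ∀ a, |‖a - (c + η * (b - p))‖ - ‖a - c‖| ≤ ε / 4 := by
    intro η hη a
    refine (abs_norm_sub_norm_le _ _).trans ?_
    rw [show a - (c + η * (b - p)) - (a - c) = -(η * (b - p)) by ring, norm_neg, norm_mul,
      Complex.norm_real, Real.norm_eq_abs, hη, hδ]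
    apply le_of_eq
    field_simp
  have hother : ∀ η : ℝ, |η| = δ → ∀ a ∈ S \ {p},
      ‖a - (c + η * (b - p))‖ ≠ ‖b - (c + η * (b - p))‖ ∧
      (‖a - (c + η * (b - p))‖ < ‖b - (c + η * (b - p))‖ ↔ ‖a - c‖ < ‖b - c‖) := by
    intro η hη a ha
    have h1 := abs_le.1 (hshift η hη a)
    have h2 := abs_le.1 (hshift η hη b)
    rcases le_abs.1 (hgap a ha) with h | h
    · exact ⟨by intro h'; linarith, by constructor <;> intro h' <;> linarith⟩
    · exact ⟨by intro h'; linarith, by constructor <;> intro h' <;> linarith⟩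
  -- The sign of `η` decides whether `p` is outside or inside the moved circle, which still passes
  -- through `b`.
  have hnorm : ∀ η : ℝ, ‖p - (c + η * (b - p))‖ ^ 2 - ‖b - (c + η * (b - p))‖ ^ 2
      = 2 * η * ‖b - p‖ ^ 2 := by
    intro η
    rw [show p - (c + η * (b - p)) = (-1 / 2 - η - I * t) * (b - p) by rw [hc]; ring,
      show b - (c + η * (b - p)) = (1 / 2 - η - I * t) * (b - p) by rw [hc]; ring,
      norm_mul, norm_mul, mul_pow, mul_pow, ← sub_mul]
    congr 1
    rw [← normSq_eq_norm_sq, ← normSq_eq_norm_sq]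
    simp [normSq_apply]
    ring
  have hout : ‖b - (c + δ * (b - p))‖ < ‖p - (c + δ * (b - p))‖ := by
    refine lt_of_pow_lt_pow_left₀ 2 (norm_nonneg _) ?_
    have := hnorm δ
    have : 0 < 2 * δ * ‖b - p‖ ^ 2 := by positivity
    linarith
  have hin : ‖p - (c + (-δ : ℝ) * (b - p))‖ < ‖b - (c + (-δ : ℝ) * (b - p))‖ := by
    refine lt_of_pow_lt_pow_left₀ 2 (norm_nonneg _) ?_
    have := hnorm (-δ)
    have : 0 < 2 * δ * ‖b - p‖ ^ 2 := by positivity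
    linarith
  have a1 : |δ| = δ := abs_of_pos hδ0
  have a2 : |(-δ)| = δ := by rw [abs_neg, a1]
  have w1 := hasWindings_circle (b := b) (c := c + (-δ : ℝ) * (b - p)) (S := S) m fun a ha => by
    by_cases hap : a = p
    · rw [hap]; exact hin.ne
    · exact (hother _ a2 a ⟨ha, hap⟩).1
  have w2 := hasWindings_circle (b := b) (c := c + δ * (b - p)) (S := S) (-m) fun a ha => by
    by_cases hap : a = p
    · rw [hap]; exact hout.ne'
    · exact (hother _ a1 a ⟨ha, hap⟩).1
  refine (w1.add w2).congr fun a ha => ?_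
  by_cases hap : a = p
  · subst hap
    rw [if_pos hin, if_neg hout.not_gt, if_pos rfl, add_zero]
  · rw [if_neg hap]
    simp only [(hother _ a2 a ⟨ha, hap⟩).2, (hother _ a1 a ⟨ha, hap⟩).2]
    split_ifs <;> simp

theorem hasWindings_finset {b : ℂ} {S : Set ℂ} (hS : S.Countable) (hb : b ∉ S) {T : Finset ℂ}
    (hT : ∀ p ∈ T, b ≠ p ∧ IsClosed (S \ {p})) (m : ℂ → ℤ) {w : ℂ → ℂ} (hw : HasWindings b S w) :
    HasWindings b S fun a => w a + if a ∈ T then (m a : ℂ) else 0 := by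
  classical
  induction T using Finset.induction_on with
  | empty => simpa using hw
  | insert p T hp ih =>
    have h1 := ih fun a ha => hT a (Finset.mem_insert_of_mem ha)
    obtain ⟨h2, h3⟩ := hT p (Finset.mem_insert_self p T)
    refine (h1.add (hasWindings_single h2 hS hb h3 (m p))).congr fun a _ => ?_
    by_cases hap : a = p
    · subst hap
      simp [hp]
    · simp [hap]

theorem isClosed_of_finite_nhds {A : Set ℂ} (h0 : (0 : ℂ) ∈ A)
    (h : ∀ z ≠ 0, ∃ U ∈ 𝓝 z, (A ∩ U).Finite) : IsClosed A := by
  rw [← isOpen_compl_iff, isOpen_iff_mem_nhds]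
  intro z hz
  obtain ⟨U, hU, hfin⟩ := h z fun h => hz (h ▸ h0)
  filter_upwards [hU, hfin.isClosed.isOpen_compl.mem_nhds fun h => hz h.1] with a h1 h2 h3
  exact h2 ⟨h3, h1⟩

/-- There is a closed curve that has the disjoint sets `A ∪ {0}` inside and `B` outside, if `A`
accumulates at most at `0` and `B` at most at `∞`. -/
theorem exists_contour_inside_outside {A B : Set ℂ} (hAB : Disjoint A B) (hB0 : (0 : ℂ) ∉ B)
    (hA : ∀ r > 0, (A ∩ {z | r ≤ ‖z‖}).Finite) (hB : ∀ r, (B ∩ {z | ‖z‖ ≤ r}).Finite) :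
    ∃ γ : Contour, γ.Inside 0 ∧ (∀ p ∈ A, γ.Inside p) ∧ ∀ p ∈ B, γ.Outside p := by
  classical
  set S : Set ℂ := insert 0 (A ∪ B) with hSdef
  have hfin : ∀ r > 0, ∀ R, (S ∩ {z | r ≤ ‖z‖ ∧ ‖z‖ ≤ R}).Finite := by
    intro r hr R
    refine ((hA r hr).union (hB R)).subset ?_
    rintro z ⟨hz, h1, h2⟩
    rcases hz with rfl | hz | hz
    · rw [norm_zero] at h1
      exact absurd h1 (not_le.2 hr)
    · exact Or.inl ⟨hz, h1⟩
    · exact Or.inr ⟨hz, h2⟩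
  have hSc : S.Countable := by
    have : S ⊆ {0} ∪ ⋃ n : ℕ, S ∩ {z | 1 / ((n : ℝ) + 1) ≤ ‖z‖ ∧ ‖z‖ ≤ n} := by
      intro z hz
      by_cases h0 : z = 0
      · exact Or.inl h0
      · obtain ⟨n, hn⟩ := exists_nat_one_div_lt (norm_pos_iff.2 h0)
        obtain ⟨k, hk⟩ := exists_nat_ge ‖z‖
        refine Or.inr (mem_iUnion.2 ⟨max n k, hz, ?_, ?_⟩)
        · refine le_trans ?_ hn.le
          gcongr
          exact le_max_left _ _
        · refine hk.trans ?_
          gcongr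
          exact le_max_right _ _
    refine Countable.mono this ((countable_singleton 0).union (countable_iUnion fun n => ?_))
    exact (hfin _ (by positivity) _).countable
  -- The only possible finite accumulation point is `0`, and it remains in the set.
  have hcl : ∀ p ≠ 0, IsClosed (S \ {p}) := by
    intro p hp
    refine isClosed_of_finite_nhds ⟨Or.inl rfl, fun h => hp h.symm⟩ fun z hz => ?_
    have hz' := norm_pos_iff.2 hz
    refine ⟨{a | ‖z‖ / 2 ≤ ‖a‖ ∧ ‖a‖ ≤ 2 * ‖z‖}, ?_, (hfin _ (half_pos hz') _).subset
      (inter_subset_inter_left _ sdiff_subset)⟩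
    filter_upwards [continuous_norm.continuousAt.preimage_mem_nhds
      (Ioo_mem_nhds (show ‖z‖ / 2 < ‖z‖ by linarith) (show ‖z‖ < 2 * ‖z‖ by linarith))] with a ha
    exact ⟨ha.1.le, ha.2.le⟩
  -- A radius that no point of the countable set `S` has. The same number serves as base point of
  -- all loops.
  obtain ⟨b, hb⟩ : ∃ b : ℝ, 0 < b ∧ ∀ p ∈ S, ‖p‖ ≠ b := by
    have h1 : ((fun p : ℂ => ‖p‖) '' S).Countable := hSc.image _
    obtain ⟨b, hb1, hb2⟩ := (h1.dense_compl ℝ).exists_between (zero_lt_one (α := ℝ))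
    exact ⟨b, hb2.1, fun p hp h => hb1 ⟨p, hp, h⟩⟩
  obtain ⟨hb0, hb⟩ := hb
  have hbn : ‖(b : ℂ)‖ = b := by rw [Complex.norm_real, Real.norm_eq_abs, abs_of_pos hb0]
  have hbS : (b : ℂ) ∉ S := fun h => hb _ h hbn
  -- The finitely many points on the wrong side of the circle of radius `b`. Those of `A` need a
  -- correction `+1`, those of `B` a correction `-1`.
  have hT : ((A ∩ {z | b ≤ ‖z‖}) ∪ (B ∩ {z | ‖z‖ ≤ b})).Finite := (hA b hb0).union (hB b)
  have w0 := hasWindings_circle (b := (b : ℂ)) (c := 0) (S := S) 1 fun p hp => by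
    rw [sub_zero, sub_zero, hbn]; exact hb p hp
  have hTmem : ∀ p ∈ hT.toFinset, (b : ℂ) ≠ p ∧ IsClosed (S \ {p}) := by
    intro p hp
    rw [Set.Finite.mem_toFinset] at hp
    have hpS : p ∈ S := hp.elim (fun h => Or.inr (Or.inl h.1)) fun h => Or.inr (Or.inr h.1)
    refine ⟨fun h => hbS (h ▸ hpS), hcl p ?_⟩
    rintro rfl
    rcases hp with h | h
    · have := h.2
      simp only [mem_ofPred_eq, norm_zero] at this
      linarith
    · exact hB0 h.1
  obtain ⟨γ, -, hγ⟩ := hasWindings_finset hSc hbS hTmem (fun p => if p ∈ A then 1 else -1) w0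
  simp only [sub_zero, hbn, Set.Finite.mem_toFinset] at hγ
  refine ⟨γ, ?_, fun p hp => ?_, fun p hp => ?_⟩
  · obtain ⟨h1, h2⟩ := hγ 0 (Or.inl rfl)
    refine ⟨h1, h2.trans ?_⟩
    rw [if_pos (by simpa using hb0), if_neg]
    · simp
    · rintro (h | h)
      · have := h.2
        simp only [mem_ofPred_eq, norm_zero] at this
        linarith
      · exact hB0 h.1
  · have hpB : p ∉ B := fun h => disjoint_left.1 hAB hp h
    obtain ⟨h1, h2⟩ := hγ p (Or.inr (Or.inl hp))
    refine ⟨h1, h2.trans ?_⟩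
    by_cases hlt : ‖p‖ < b
    · rw [if_pos hlt, if_neg]
      · simp
      · rintro (h | h)
        · exact absurd h.2 (not_le.2 hlt)
        · exact hpB h.1
    · have hmem : p ∈ A ∩ {z | b ≤ ‖z‖} ∪ B ∩ {z | ‖z‖ ≤ b} := Or.inl ⟨hp, not_lt.1 hlt⟩
      rw [if_neg hlt, if_pos hmem, if_pos hp]
      simp
  · have hpA : p ∉ A := fun h => disjoint_left.1 hAB h hp
    have hpS : p ∈ S := Or.inr (Or.inr hp)
    obtain ⟨h1, h2⟩ := hγ p hpS
    refine ⟨h1, h2.trans ?_⟩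
    by_cases hlt : ‖p‖ < b
    · have hmem : p ∈ A ∩ {z | b ≤ ‖z‖} ∪ B ∩ {z | ‖z‖ ≤ b} := Or.inr ⟨hp, hlt.le⟩
      rw [if_pos hlt, if_pos hmem, if_neg hpA]
      simp
    · rw [if_neg hlt, if_neg]
      · simp
      · rintro (h | h)
        · exact hpA h.1
        · exact hb p hpS (le_antisymm h.2 (not_lt.1 hlt))

end AWOverlap

end

noncomputable section

namespace AWOverlap

open Complex Set Filter Topology

/-! ### The integrand -/

theorem norm_ofReal_sq_lt_one {q : ℝ} (hq0 : 0 < q) (hq1 : q < 1) : ‖(q : ℂ) ^ 2‖ < 1 := by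
  rw [norm_pow, Complex.norm_real, Real.norm_eq_abs, abs_of_pos hq0]
  exact pow_lt_one₀ hq0.le hq1 two_ne_zero

theorem conj_qPoch {a b : ℂ} (hb : ‖b‖ < 1) :
    (starRingEnd ℂ) (qPoch a b) = qPoch ((starRingEnd ℂ) a) ((starRingEnd ℂ) b) := by
  rw [qPoch, qPoch, (multipliable_qPoch hb a).map_tprod (starRingEnd ℂ) continuous_conj]
  simp

theorem conj_ofReal_cpow {q : ℝ} (hq : 0 < q) (c : ℂ) :
    (starRingEnd ℂ) ((q : ℂ) ^ c) = (q : ℂ) ^ ((starRingEnd ℂ) c) := by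
  have hq' : (q : ℂ) ≠ 0 := by exact_mod_cast hq.ne'
  rw [cpow_def_of_ne_zero hq', cpow_def_of_ne_zero hq', ← exp_conj, map_mul, ← ofReal_log hq.le,
    conj_ofReal]

theorem conj_eigFn {q : ℝ} (hq0 : 0 < q) (hq1 : q < 1) (s u : ℂ) (lam eps : ℝ) (x z : ℂ) :
    (starRingEnd ℂ) (eigFn q s u lam eps x z)
      = eigFn q ((starRingEnd ℂ) s) ((starRingEnd ℂ) u) (-lam) eps ((starRingEnd ℂ) x)
        ((starRingEnd ℂ) z) := by
  have hb := norm_ofReal_sq_lt_one hq0 hq1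
  simp only [eigFn, qTheta, map_mul, map_div₀, conj_qPoch hb, map_pow, conj_ofReal, map_inv₀,
    conj_ofReal_cpow hq0, map_sub, map_add, map_one, conj_I, map_neg, map_ofNat, ofReal_neg]
  ring_nf

/-- The conjugated parameters and the two inversions cancel. Only `λ` changes sign, because
conjugation sends `q^{iλ}` to `q^{-iλ}`. In particular the starred function is meromorphic in `z`.
-/
theorem star1_eigFnTheta {q : ℝ} (hq0 : 0 < q) (hq1 : q < 1) (t v : ℂ) (lam : ℝ) (y z : ℂ) :
    star1 (eigFnTheta q ((starRingEnd ℂ) t) ((starRingEnd ℂ) v) lam 0 ((starRingEnd ℂ) y)) z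
      = eigFn q t v (-lam) 0 y z := by
  rw [star1, eigFnTheta, conj_eigFn hq0 hq1, inv_inv]
  simp

/-- The eigenfunction in the variables `X = u z q^{-iλ}`, `W = q^{2iλ}`. -/
def eigCore (q W s x X : ℂ) : ℂ :=
  (qPoch (s * q / W * x) (q ^ 2) * qPoch (s * q / W * x⁻¹) (q ^ 2) * qPoch (s * q * W * X) (q ^ 2)
      * qTheta (X / s) (q ^ 2))
    / (qPoch (X * x) (q ^ 2) * qPoch (X * x⁻¹) (q ^ 2) * qPoch (s * q / W / X) (q ^ 2))

theorem cpow_I_ne_zero {q : ℝ} (hq : 0 < q) (lam : ℝ) : (q : ℂ) ^ (I * lam) ≠ 0 := by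
  have hq' : (q : ℂ) ≠ 0 := by exact_mod_cast hq.ne'
  simp [cpow_def_of_ne_zero hq', Complex.exp_ne_zero]

theorem cpow_neg_I (q lam : ℝ) : (q : ℂ) ^ (-(I * lam)) = ((q : ℂ) ^ (I * lam))⁻¹ := cpow_neg _ _

theorem cpow_I_neg (q lam : ℝ) : (q : ℂ) ^ (I * ((-lam : ℝ) : ℂ)) = ((q : ℂ) ^ (I * lam))⁻¹ := by
  rw [← cpow_neg]; congr 1; push_cast; ring

theorem cpow_one_add_I {q : ℝ} (hq : 0 < q) (lam : ℝ) : (q : ℂ) ^ (1 + I * lam) = q * (q : ℂ) ^ (I * lam) := by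
  have hq' : (q : ℂ) ≠ 0 := by exact_mod_cast hq.ne'
  rw [cpow_add _ _ hq', cpow_one]

theorem cpow_one_sub_I {q : ℝ} (hq : 0 < q) (lam : ℝ) : (q : ℂ) ^ (1 - I * lam) = q / (q : ℂ) ^ (I * lam) := by
  have hq' : (q : ℂ) ≠ 0 := by exact_mod_cast hq.ne'
  rw [cpow_sub _ _ hq', cpow_one]

theorem cpow_two_I (q lam : ℝ) : (q : ℂ) ^ (2 * I * lam) = ((q : ℂ) ^ (I * lam)) ^ 2 := by
  rw [mul_assoc, ← cpow_ofNat_mul]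

theorem cpow_one_sub_two_I {q : ℝ} (hq : 0 < q) (lam : ℝ) : (q : ℂ) ^ (1 - 2 * I * lam) = q / ((q : ℂ) ^ (I * lam)) ^ 2 := by
  have hq' : (q : ℂ) ≠ 0 := by exact_mod_cast hq.ne'
  rw [cpow_sub _ _ hq', cpow_one, cpow_two_I]

theorem cpow_one_add_two_I {q : ℝ} (hq : 0 < q) (lam : ℝ) : (q : ℂ) ^ (1 + 2 * I * lam) = q * ((q : ℂ) ^ (I * lam)) ^ 2 := by
  have hq' : (q : ℂ) ≠ 0 := by exact_mod_cast hq.ne'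
  rw [cpow_add _ _ hq', cpow_one, cpow_two_I]

theorem cpow_three_sub_two_I {q : ℝ} (hq : 0 < q) (lam : ℝ) :
    (q : ℂ) ^ (3 - 2 * I * lam) = (q : ℂ) ^ 3 / ((q : ℂ) ^ (I * lam)) ^ 2 := by
  have hq' : (q : ℂ) ≠ 0 := by exact_mod_cast hq.ne'
  rw [cpow_sub _ _ hq', cpow_two_I, cpow_ofNat]

theorem cpow_three_add_two_I {q : ℝ} (hq : 0 < q) (lam : ℝ) :
    (q : ℂ) ^ (3 + 2 * I * lam) = (q : ℂ) ^ 3 * ((q : ℂ) ^ (I * lam)) ^ 2 := by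
  have hq' : (q : ℂ) ≠ 0 := by exact_mod_cast hq.ne'
  rw [cpow_add _ _ hq', cpow_two_I, cpow_ofNat]

theorem eigFn_eq_eigCore {q : ℝ} (hq : 0 < q) (lam : ℝ) (s u x z : ℂ) :
    eigFn q s u lam 0 x z
      = eigCore q (((q : ℂ) ^ (I * lam)) ^ 2) s x (u * z / (q : ℂ) ^ (I * lam)) := by
  have hw := cpow_I_ne_zero hq lam
  simp only [eigFn, eigCore, cpow_neg_I, cpow_one_sub_two_I hq, cpow_one_add_I hq,
    cpow_one_sub_I hq, ofReal_zero, mul_zero, zero_sub]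
  set w := (q : ℂ) ^ (I * lam)
  rw [show u * s * z * (q * w) = s * q * w ^ 2 * (u * z / w) by field_simp,
    show w⁻¹ * u * z / s = u * z / w / s by field_simp, show u * z * w⁻¹ = u * z / w by ring,
    show s * (q / w) / (u * z) = s * q / w ^ 2 / (u * z / w) by field_simp,
    mul_div_assoc s (q : ℂ)]

theorem eigFn_neg_eq_eigCore {q : ℝ} (hq : 0 < q) (lam : ℝ) (s u x z : ℂ) :
    eigFn q s u (-lam) 0 x z
      = eigCore q (((q : ℂ) ^ (I * lam)) ^ 2)⁻¹ s x (u * z * (q : ℂ) ^ (I * lam)) := by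
  rw [eigFn_eq_eigCore hq, cpow_I_neg, inv_pow, div_inv_eq_mul]

/-- The integrand of the univariate overlap coefficient. -/
def integrand (q : ℝ) (s u t v : ℂ) (lam : ℝ) (x y z : ℂ) : ℂ :=
  eigFn q s u lam 0 x z * eigFn q t v (-lam) 0 y z / z

theorem pairing1_eq {q : ℝ} (hq0 : 0 < q) (hq1 : q < 1) (s u t v : ℂ) (lam : ℝ) (x y : ℂ)
    (γ : Contour) :
    pairing1 γ (eigFn q s u lam 0 x)
      (eigFnTheta q ((starRingEnd ℂ) t) ((starRingEnd ℂ) v) lam 0 ((starRingEnd ℂ) y))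
      = (2 * (Real.pi : ℂ) * I)⁻¹ * γ.integral (integrand q s u t v lam x y) := by
  simp only [pairing1, star1_eigFnTheta hq0 hq1]
  rfl

theorem differentiableOn_qTheta {b : ℂ} (hb : ‖b‖ < 1) {U : Set ℂ} {g : ℂ → ℂ}
    (hg : DifferentiableOn ℂ g U) (hg0 : ∀ z ∈ U, g z ≠ 0) :
    DifferentiableOn ℂ (fun z => qTheta (g z) b) U :=
  ((differentiable_qPoch hb).comp_differentiableOn hg).mul
    ((differentiable_qPoch hb).comp_differentiableOn ((differentiableOn_const b).div hg hg0))

/-- The shape of all the integrands: a holomorphic function on the punctured plane divided by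
shifted factorials. -/
theorem isFactored_div_qPoch {P : Set ℂ} {r : ℝ} (hr : 0 < r) (R : ℝ) {b : ℂ} (hb : ‖b‖ < 1)
    (hb0 : b ≠ 0) {N : ℂ → ℂ} (hN : DifferentiableOn ℂ N (annulus r R)) {a₁ a₂ a₃ a₄ c₁ c₂ : ℂ}
    (ha₁ : a₁ ≠ 0) (ha₂ : a₂ ≠ 0) (ha₃ : a₃ ≠ 0) (ha₄ : a₄ ≠ 0)
    (hP₁ : ∀ k : ℕ, (a₁ * b ^ k)⁻¹ ∈ P) (hP₂ : ∀ k : ℕ, (a₂ * b ^ k)⁻¹ ∈ P)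
    (hP₃ : ∀ k : ℕ, (a₃ * b ^ k)⁻¹ ∈ P) (hP₄ : ∀ k : ℕ, (a₄ * b ^ k)⁻¹ ∈ P)
    (hP₅ : ∀ k : ℕ, c₁ * b ^ k ∈ P) (hP₆ : ∀ k : ℕ, c₂ * b ^ k ∈ P) :
    IsFactored P r R fun z => N z * (qPoch (a₁ * z) b)⁻¹ * (qPoch (a₂ * z) b)⁻¹ *
      (qPoch (a₃ * z) b)⁻¹ * (qPoch (a₄ * z) b)⁻¹ * (qPoch (c₁ / z) b)⁻¹ *
      (qPoch (c₂ / z) b)⁻¹ :=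
  ((((((IsFactored.of_differentiableOn hN).mul (.qPoch_mul_inv r R hb hb0 ha₁ hP₁)).mul
    (.qPoch_mul_inv r R hb hb0 ha₂ hP₂)).mul (.qPoch_mul_inv r R hb hb0 ha₃ hP₃)).mul
    (.qPoch_mul_inv r R hb hb0 ha₄ hP₄)).mul (.qPoch_div_inv hr R hb hP₅)).mul
    (.qPoch_div_inv hr R hb hP₆)

theorem isFactored_integrand {q : ℝ} (hq0 : 0 < q) (hq1 : q < 1) {s u t v : ℂ} (lam : ℝ) {x y : ℂ}
    (hs : s ≠ 0) (hu : u ≠ 0) (ht : t ≠ 0) (hv : v ≠ 0) (hx : x ≠ 0) (hy : y ≠ 0) (r R : ℝ)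
    (hr : 0 < r) :
    IsFactored (innerPoles q s u t v lam ∪ outerPoles q u v lam x y) r R
      (integrand q s u t v lam x y) := by
  have hb := norm_ofReal_sq_lt_one hq0 hq1
  have hq' : (q : ℂ) ≠ 0 := by exact_mod_cast hq0.ne'
  have hw := cpow_I_ne_zero hq0 lam
  have hz0 : ∀ z ∈ annulus r R, z ≠ 0 := fun z hz => norm_pos_iff.1 (hr.trans hz.1)
  set w := (q : ℂ) ^ (I * lam) with hwdef
  have hN : DifferentiableOn ℂ (fun z => (qPoch (s * q / w ^ 2 * x) (q ^ 2) *
      qPoch (s * q / w ^ 2 * x⁻¹) (q ^ 2) * qPoch (s * q * w ^ 2 * (u * z / w)) (q ^ 2) *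
      qTheta (u * z / w / s) (q ^ 2)) * (qPoch (t * q / (w ^ 2)⁻¹ * y) (q ^ 2) *
      qPoch (t * q / (w ^ 2)⁻¹ * y⁻¹) (q ^ 2) * qPoch (t * q * (w ^ 2)⁻¹ * (v * z * w)) (q ^ 2) *
      qTheta (v * z * w / t) (q ^ 2)) * z⁻¹) (annulus r R) := by
    refine DifferentiableOn.mul (DifferentiableOn.mul ?_ ?_) (differentiableOn_id.fun_inv hz0)
    · refine (((differentiableOn_const _).mul (differentiableOn_const _)).mul
        ((differentiable_qPoch hb).comp_differentiableOn (by fun_prop))).mul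
        (differentiableOn_qTheta hb (by fun_prop) fun z hz => ?_)
      have := hz0 z hz
      positivity
    · refine (((differentiableOn_const _).mul (differentiableOn_const _)).mul
        ((differentiable_qPoch hb).comp_differentiableOn (by fun_prop))).mul
        (differentiableOn_qTheta hb (by fun_prop) fun z hz => ?_)
      have := hz0 z hz
      positivity
  -- The six shifted factorials in the two denominators correspond to the six sequences of poles:
  -- the two with `z` in the denominator to the inner ones, the other four to the outer ones.
  have key := isFactored_div_qPoch (P := innerPoles q s u t v lam ∪ outerPoles q u v lam x y)
    hr R hb (pow_ne_zero 2 hq') hN (a₁ := u / w * x) (a₂ := u / w * x⁻¹) (a₃ := v * w * y)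
    (a₄ := v * w * y⁻¹) (c₁ := s * q / (w * u)) (c₂ := t * q * w / v) (by positivity)
    (by positivity) (by positivity) (by positivity)
    (fun k => Or.inr ⟨k, Or.inr (Or.inl ?_)⟩) (fun k => Or.inr ⟨k, Or.inl ?_⟩)
    (fun k => Or.inr ⟨k, Or.inr (Or.inr (Or.inr ?_))⟩)
    (fun k => Or.inr ⟨k, Or.inr (Or.inr (Or.inl ?_))⟩)
    (fun k => Or.inl ⟨k, Or.inl ?_⟩) (fun k => Or.inl ⟨k, Or.inr ?_⟩)
  · refine key.congr fun z hz => ?_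
    have hz := hz0 z hz
    rw [integrand, eigFn_eq_eigCore hq0, eigFn_neg_eq_eigCore hq0, ← hwdef, eigCore, eigCore,
      show u * z / w * x = u / w * x * z by ring, show u * z / w * x⁻¹ = u / w * x⁻¹ * z by ring,
      show v * z * w * y = v * w * y * z by ring, show v * z * w * y⁻¹ = v * w * y⁻¹ * z by ring,
      show s * q / w ^ 2 / (u * z / w) = s * q / (w * u) / z by field_simp,
      show t * q / (w ^ 2)⁻¹ / (v * z * w) = t * q * w / v / z by field_simp]
    simp only [div_eq_mul_inv, mul_inv]
    ring
  · rw [← hwdef, pow_mul]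
    field_simp
  · rw [← hwdef, pow_mul]
    field_simp
  · rw [cpow_neg_I, ← hwdef, pow_mul]
    field_simp
  · rw [cpow_neg_I, ← hwdef, pow_mul]
    field_simp
  · rw [cpow_one_sub_I hq0, ← hwdef, pow_mul]
    field_simp
  · rw [cpow_one_add_I hq0, ← hwdef, pow_mul]
    field_simp

end AWOverlap

end

noncomputable section

namespace AWOverlap

open Complex Set Filter Topology

/-! ### Admissible contours -/

theorem finite_geometric_inter {b : ℂ} (hb : ‖b‖ < 1) (c : ℂ) {r : ℝ} (hr : 0 < r) :
    ({z | ∃ k : ℕ, z = c * b ^ k} ∩ {z | r ≤ ‖z‖}).Finite := by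
  obtain ⟨n, hn⟩ := exists_norm_mul_pow_lt hb (‖c‖ / r)
  refine (Set.finite_range fun k : Fin n => c * b ^ (k : ℕ)).subset ?_
  rintro z ⟨⟨k, rfl⟩, hz⟩
  refine ⟨⟨k, ?_⟩, rfl⟩
  by_contra! hk
  have h1 : ‖b‖ ^ k ≤ ‖b‖ ^ n := pow_le_pow_of_le_one (norm_nonneg _) hb.le hk
  have h2 : r ≤ ‖c‖ * ‖b‖ ^ k := by simpa using hz
  have h3 : ‖c‖ / r * ‖b‖ ^ k ≤ ‖c‖ / r * ‖b‖ ^ n := by gcongr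
  rw [div_mul_eq_mul_div, div_mul_eq_mul_div, div_le_div_iff_of_pos_right hr] at h3
  rw [div_mul_eq_mul_div, div_lt_one hr] at hn
  linarith

theorem finite_geometric_inv_inter {b : ℂ} (hb : ‖b‖ < 1) (hb0 : b ≠ 0) {c : ℂ} (hc : c ≠ 0)
    (r : ℝ) : ({z | ∃ k : ℕ, z = c * (b ^ k)⁻¹} ∩ {z | ‖z‖ ≤ r}).Finite := by
  obtain ⟨n, hn⟩ := exists_norm_mul_pow_lt hb (|r| / ‖c‖)
  have hc' : 0 < ‖c‖ := norm_pos_iff.2 hc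
  have hb' : 0 < ‖b‖ := norm_pos_iff.2 hb0
  refine (Set.finite_range fun k : Fin n => c * (b ^ (k : ℕ))⁻¹).subset ?_
  rintro z ⟨⟨k, rfl⟩, hz⟩
  refine ⟨⟨k, ?_⟩, rfl⟩
  by_contra! hk
  have h1 : ‖b‖ ^ k ≤ ‖b‖ ^ n := pow_le_pow_of_le_one (norm_nonneg _) hb.le hk
  have h2 : ‖c‖ * (‖b‖ ^ k)⁻¹ ≤ r := by simpa using hz
  rw [← div_eq_mul_inv, div_le_iff₀ (pow_pos hb' k)] at h2
  rw [div_mul_eq_mul_div, div_lt_one hc'] at hn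
  have h3 : |r| * ‖b‖ ^ k ≤ |r| * ‖b‖ ^ n := by gcongr
  have h4 : r * ‖b‖ ^ k ≤ |r| * ‖b‖ ^ k := by gcongr; exact le_abs_self r
  linarith

theorem finite_innerPoles_inter {q : ℝ} (hq0 : 0 < q) (hq1 : q < 1) (s u t v : ℂ) (lam : ℝ)
    {r : ℝ} (hr : 0 < r) : (innerPoles q s u t v lam ∩ {z | r ≤ ‖z‖}).Finite := by
  have hb := norm_ofReal_sq_lt_one hq0 hq1
  refine ((finite_geometric_inter hb (u⁻¹ * s * (q : ℂ) ^ (1 - I * lam)) hr).union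
    (finite_geometric_inter hb (v⁻¹ * t * (q : ℂ) ^ (1 + I * lam)) hr)).subset ?_
  rintro z ⟨⟨k, hk | hk⟩, hz⟩
  · exact Or.inl ⟨⟨k, by rw [hk, pow_mul]⟩, hz⟩
  · exact Or.inr ⟨⟨k, by rw [hk, pow_mul]⟩, hz⟩

theorem finite_outerPoles_inter {q : ℝ} (hq0 : 0 < q) (hq1 : q < 1) {u v : ℂ} (lam : ℝ) {x y : ℂ}
    (hu : u ≠ 0) (hv : v ≠ 0) (hx : x ≠ 0) (hy : y ≠ 0) (r : ℝ) :
    (outerPoles q u v lam x y ∩ {z | ‖z‖ ≤ r}).Finite := by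
  have hb := norm_ofReal_sq_lt_one hq0 hq1
  have hq' : (q : ℂ) ≠ 0 := by exact_mod_cast hq0.ne'
  have hw := cpow_I_ne_zero hq0 lam
  have h : ∀ {c : ℂ}, c ≠ 0 → ({z | ∃ k : ℕ, z = c * (((q : ℂ) ^ 2) ^ k)⁻¹} ∩
      {z | ‖z‖ ≤ r}).Finite := fun hc => finite_geometric_inv_inter hb (pow_ne_zero 2 hq') hc r
  have hw' : (q : ℂ) ^ (-(I * lam)) ≠ 0 := by rw [cpow_neg_I]; exact inv_ne_zero hw
  refine ((h (mul_ne_zero (mul_ne_zero (inv_ne_zero hu) hw) hx)).union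
    ((h (mul_ne_zero (mul_ne_zero (inv_ne_zero hu) hw) (inv_ne_zero hx))).union
    ((h (mul_ne_zero (mul_ne_zero (inv_ne_zero hv) hw') hy)).union
    (h (mul_ne_zero (mul_ne_zero (inv_ne_zero hv) hw') (inv_ne_zero hy)))))).subset ?_
  rintro z ⟨⟨k, hk⟩, hz⟩
  rw [pow_mul] at hk
  rcases hk with hk | hk | hk | hk
  · exact Or.inl ⟨⟨k, hk⟩, hz⟩
  · exact Or.inr (Or.inl ⟨⟨k, hk⟩, hz⟩)
  · exact Or.inr (Or.inr (Or.inl ⟨⟨k, hk⟩, hz⟩))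
  · exact Or.inr (Or.inr (Or.inr ⟨⟨k, hk⟩, hz⟩))

theorem zero_notMem_outerPoles {q : ℝ} (hq0 : 0 < q) {u v : ℂ} (lam : ℝ) {x y : ℂ}
    (hu : u ≠ 0) (hv : v ≠ 0) (hx : x ≠ 0) (hy : y ≠ 0) : (0 : ℂ) ∉ outerPoles q u v lam x y := by
  have hq' : (q : ℂ) ≠ 0 := by exact_mod_cast hq0.ne'
  have hw := cpow_I_ne_zero hq0 lam
  rintro ⟨k, hk⟩
  simp [cpow_neg_I, hw, hu, hv, hx, hy, hq'] at hk

/-- A contour that is admissible for finitely many parameters `s` and `x` at once. -/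
theorem exists_admissible {q : ℝ} (hq0 : 0 < q) (hq1 : q < 1) {u t v : ℂ} (lam : ℝ) {y : ℂ}
    (hu : u ≠ 0) (hv : v ≠ 0) (hy : y ≠ 0) (S T : Finset ℂ) (hT : ∀ x ∈ T, x ≠ 0)
    (h : ∀ s ∈ S, ∀ x ∈ T, Disjoint (innerPoles q s u t v lam) (outerPoles q u v lam x y)) :
    ∃ γ : Contour, ∀ s ∈ S, ∀ x ∈ T, Admissible q s u t v lam x y γ := by
  -- Inner poles do not depend on `x` and outer ones do not depend on `s`, so disjointness for all
  -- pairs is disjointness of the two unions.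
  have hd : Disjoint (⋃ s ∈ S, innerPoles q s u t v lam) (⋃ x ∈ T, outerPoles q u v lam x y) := by
    simp only [disjoint_iUnion_left, disjoint_iUnion_right]
    exact fun x hx s hs => h s hs x hx
  obtain ⟨γ, h0, h1, h2⟩ := exists_contour_inside_outside hd
    (by
      simp only [mem_iUnion, not_exists]
      exact fun x hx => zero_notMem_outerPoles hq0 lam hu hv (hT x hx) hy)
    (fun r hr => by
      simp only [iUnion_inter]
      exact S.finite_toSet.biUnion fun s _ => finite_innerPoles_inter hq0 hq1 s u t v lam hr)
    (fun r => by
      simp only [iUnion_inter]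
      exact T.finite_toSet.biUnion fun x hx =>
        finite_outerPoles_inter hq0 hq1 lam hu hv (hT x hx) hy r)
  exact ⟨γ, fun s hs x hx => ⟨h0, fun p hp => h1 p (mem_biUnion hs hp),
    fun p hp => h2 p (mem_biUnion hx hp)⟩⟩

/-! ### Univariate coefficients: independence of the contour, and conjugation. -/

section Overlap

variable {q : ℝ} {s u t v : ℂ} {lam : ℝ} {x y : ℂ}

theorem Admissible.sameWinding {γ γ' : Contour} (h : Admissible q s u t v lam x y γ)
    (h' : Admissible q s u t v lam x y γ') :
    ∀ p ∈ innerPoles q s u t v lam ∪ outerPoles q u v lam x y, γ.SameWinding γ' p :=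
  fun p hp => hp.elim (fun hp => (h.2.1 p hp).sameWinding (h'.2.1 p hp))
    fun hp => (h.2.2 p hp).sameWinding (h'.2.2 p hp)

theorem Admissible.continuousOn_integrand {γ : Contour} (h : Admissible q s u t v lam x y γ)
    (hq0 : 0 < q) (hq1 : q < 1)
    (hs : s ≠ 0) (hu : u ≠ 0) (ht : t ≠ 0) (hv : v ≠ 0) (hx : x ≠ 0) (hy : y ≠ 0) :
    ContinuousOn (integrand q s u t v lam x y) (γ.toFun '' Icc 0 1) :=
  Contour.continuousOn_of_isFactored h.1.1 (fun p hp => (h.sameWinding h p hp).1)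
    fun r R hr => isFactored_integrand hq0 hq1 lam hs hu ht hv hx hy r R hr

theorem Admissible.integral_eq {γ γ' : Contour} (h : Admissible q s u t v lam x y γ)
    (h' : Admissible q s u t v lam x y γ') (hq0 : 0 < q) (hq1 : q < 1)
    (hs : s ≠ 0) (hu : u ≠ 0) (ht : t ≠ 0) (hv : v ≠ 0) (hx : x ≠ 0) (hy : y ≠ 0) :
    γ.integral (integrand q s u t v lam x y) = γ'.integral (integrand q s u t v lam x y) :=
  Contour.integral_eq_of_sameWinding (h.1.sameWinding h'.1) (h.sameWinding h')
    fun r R hr => isFactored_integrand hq0 hq1 lam hs hu ht hv hx hy r R hr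

/-- This replaces the chosen contour in the definition by any admissible one, so that several
coefficients can be computed over one common curve. -/
theorem Admissible.overlap1_eq {γ : Contour} (h : Admissible q s u t v lam x y γ)
    (hq0 : 0 < q) (hq1 : q < 1)
    (hs : s ≠ 0) (hu : u ≠ 0) (ht : t ≠ 0) (hv : v ≠ 0) (hx : x ≠ 0) (hy : y ≠ 0) :
    overlap1 q s u t v lam 0 x y
      = (2 * (Real.pi : ℂ) * I)⁻¹ * γ.integral (integrand q s u t v lam x y) := by
  have hex : ∃ γ : Contour, Admissible q s u t v lam x y γ := ⟨γ, h⟩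
  rw [overlap1, dif_pos hex, pairing1_eq hq0 hq1,
    hex.choose_spec.integral_eq h hq0 hq1 hs hu ht hv hx hy]

/-- Since `q^{iλ}` is conjugated to `q^{-iλ}`, conjugation exchanges the sequences belonging to `(s,
u)` and `(t, v)`. -/
theorem conj_mem_innerPoles (hq0 : 0 < q) {p : ℂ}
    (hp : p ∈ innerPoles q ((starRingEnd ℂ) t) ((starRingEnd ℂ) v) ((starRingEnd ℂ) s)
      ((starRingEnd ℂ) u) lam) : (starRingEnd ℂ) p ∈ innerPoles q s u t v lam := by
  obtain ⟨k, rfl | rfl⟩ := hp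
  · refine ⟨k, Or.inr ?_⟩
    simp [conj_ofReal_cpow hq0]
  · refine ⟨k, Or.inl ?_⟩
    simp [conj_ofReal_cpow hq0, sub_eq_add_neg]

theorem conj_mem_outerPoles (hq0 : 0 < q) {p : ℂ}
    (hp : p ∈ outerPoles q ((starRingEnd ℂ) v) ((starRingEnd ℂ) u) lam ((starRingEnd ℂ) y)
      ((starRingEnd ℂ) x)) : (starRingEnd ℂ) p ∈ outerPoles q u v lam x y := by
  obtain ⟨k, rfl | rfl | rfl | rfl⟩ := hp
  · exact ⟨k, Or.inr (Or.inr (Or.inl (by simp [conj_ofReal_cpow hq0])))⟩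
  · exact ⟨k, Or.inr (Or.inr (Or.inr (by simp [conj_ofReal_cpow hq0])))⟩
  · exact ⟨k, Or.inl (by simp [conj_ofReal_cpow hq0])⟩
  · exact ⟨k, Or.inr (Or.inl (by simp [conj_ofReal_cpow hq0]))⟩

theorem Admissible.conjRev {γ : Contour} (h : Admissible q s u t v lam x y γ) (hq0 : 0 < q) :
    Admissible q ((starRingEnd ℂ) t) ((starRingEnd ℂ) v) ((starRingEnd ℂ) s) ((starRingEnd ℂ) u)
      lam ((starRingEnd ℂ) y) ((starRingEnd ℂ) x) γ.conjRev := by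
  refine ⟨?_, fun p hp => ?_, fun p hp => ?_⟩
  · simpa using h.1.conjRev
  · simpa using (h.2.1 _ (conj_mem_innerPoles hq0 hp)).conjRev
  · simpa using (h.2.2 _ (conj_mem_outerPoles hq0 hp)).conjRev

theorem conj_integrand (hq0 : 0 < q) (hq1 : q < 1) (z : ℂ) :
    (starRingEnd ℂ) (integrand q ((starRingEnd ℂ) t) ((starRingEnd ℂ) v) ((starRingEnd ℂ) s)
      ((starRingEnd ℂ) u) lam ((starRingEnd ℂ) y) ((starRingEnd ℂ) x) ((starRingEnd ℂ) z))
      = integrand q s u t v lam x y z := by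
  simp only [integrand, map_div₀, map_mul, conj_eigFn hq0 hq1, conj_conj, neg_neg]
  rw [mul_comm (eigFn q t v (-lam) 0 y z)]

/-- The sign from conjugating `2πi` is cancelled by the reversed traversal, so the symmetry holds
without a sign. -/
theorem conj_integral_integrand (hq0 : 0 < q) (hq1 : q < 1) (γ : Contour) :
    (starRingEnd ℂ) ((2 * (Real.pi : ℂ) * I)⁻¹ * γ.integral (integrand q s u t v lam x y))
      = (2 * (Real.pi : ℂ) * I)⁻¹ * γ.conjRev.integral (integrand q ((starRingEnd ℂ) t)
        ((starRingEnd ℂ) v) ((starRingEnd ℂ) s) ((starRingEnd ℂ) u) lam ((starRingEnd ℂ) y)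
        ((starRingEnd ℂ) x)) := by
  rw [Contour.integral_conjRev]
  simp only [conj_integrand hq0 hq1, map_mul, map_inv₀, conj_I, conj_ofReal, map_ofNat]
  rw [mul_neg, mul_neg, inv_neg, neg_mul]

end Overlap

/-! ### Factorization and symmetry of the multivariate coefficient -/

section Neighbours

variable {R : Type} {n : ℕ} (e : R)

theorem next_last (x : Fin (n + 1) → R) : next e x (Fin.last n) = e := by
  rw [next, Fin.succ_last, Fin.snoc_last]

theorem next_castSucc (x : Fin (n + 1) → R) (i : Fin n) : next e x i.castSucc = x i.succ := by
  rw [next, Fin.succ_castSucc, Fin.snoc_castSucc]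

theorem prev_zero (y : Fin (n + 1) → R) : prev e y 0 = e := by
  rw [prev, Fin.castSucc_zero, Fin.cons_zero]

theorem prev_succ (y : Fin (n + 1) → R) (i : Fin n) : prev e y i.succ = y i.castSucc := by
  rw [prev, Fin.castSucc_succ, Fin.cons_succ]

end Neighbours

theorem next_revVec {N : ℕ} (e : ℂ) (y : Fin N → ℂ) (j : Fin N) :
    next e (revVec y) j = prev e y j.rev := by
  cases N with
  | zero => exact j.elim0
  | succ n =>
    induction j using Fin.lastCases with
    | last => rw [next_last, Fin.rev_last, prev_zero]
    | cast i => rw [next_castSucc, Fin.rev_castSucc, prev_succ, revVec, Fin.rev_succ]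

theorem prev_revVec {N : ℕ} (e : ℂ) (x : Fin N → ℂ) (j : Fin N) :
    prev e (revVec x) j = next e x j.rev := by
  have h : revVec (revVec x) = x := by funext i; simp [revVec]
  have := next_revVec e (revVec x) j.rev
  rw [h, Fin.rev_rev] at this
  exact this.symm

theorem next_ne_zero {N : ℕ} {e : ℂ} {x : Fin N → ℂ} (he : e ≠ 0) (hx : ∀ j, x j ≠ 0)
    (j : Fin N) : next e x j ≠ 0 := by
  cases N with
  | zero => exact j.elim0
  | succ n =>
    induction j using Fin.lastCases with
    | last => rwa [next_last]
    | cast i => rw [next_castSucc]; exact hx _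

theorem prev_ne_zero {N : ℕ} {e : ℂ} {y : Fin N → ℂ} (he : e ≠ 0) (hy : ∀ j, y j ≠ 0)
    (j : Fin N) : prev e y j ≠ 0 := by
  cases N with
  | zero => exact j.elim0
  | succ n =>
    induction j using Fin.cases with
    | zero => rwa [prev_zero]
    | succ i => rw [prev_succ]; exact hy _

theorem conj_next {N : ℕ} (e : ℂ) (x : Fin N → ℂ) (j : Fin N) :
    (starRingEnd ℂ) (next e x j) = next ((starRingEnd ℂ) e) (conjVec x) j := by
  cases N with
  | zero => exact j.elim0
  | succ n =>
    induction j using Fin.lastCases with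
    | last => rw [next_last, next_last]
    | cast i => rw [next_castSucc, next_castSucc, conjVec]

theorem conj_prev {N : ℕ} (e : ℂ) (y : Fin N → ℂ) (j : Fin N) :
    (starRingEnd ℂ) (prev e y j) = prev ((starRingEnd ℂ) e) (conjVec y) j := by
  cases N with
  | zero => exact j.elim0
  | succ n =>
    induction j using Fin.cases with
    | zero => rw [prev_zero, prev_zero]
    | succ i => rw [prev_succ, prev_succ, conjVec]

theorem iterIntegral_const_mul (n : ℕ) : ∀ (C : Fin n → Contour) (c : ℂ) (F : (Fin n → ℂ) → ℂ),
    iterIntegral n C (fun z => c * F z) = c * iterIntegral n C F := by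
  induction n with
  | zero => intros; rfl
  | succ n ih =>
    intro C c F
    simp only [iterIntegral, ih, mul_div_assoc, Contour.integral_const_mul]

theorem iterIntegral_prod (n : ℕ) : ∀ (C : Fin n → Contour) (f : Fin n → ℂ → ℂ),
    iterIntegral n C (fun z => ∏ j, f j (z j)) = ∏ j, (C j).integral fun z => f j z / z := by
  induction n with
  | zero => intros; simp [iterIntegral]
  | succ n ih =>
    intro C f
    simp only [iterIntegral, Fin.prod_univ_succ, Fin.cons_zero, Fin.cons_succ,
      iterIntegral_const_mul, ih (Fin.tail C) (fun j => f j.succ), Fin.tail, mul_div_right_comm,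
      Contour.integral_mul_const]

/-- The integrand in the `j`-th variable. -/
def integrandN (q : ℝ) {N : ℕ} (α : Params N) (x y : Fin N → ℂ) (j : Fin N) : ℂ → ℂ :=
  integrand q (next α.s x j) α.u (prev α.t y j) α.v (α.lam j) (x j) (y j)

/-- Each factor of the integrand involves a single `z_j`, since `x_{j+1}` and `y_{j-1}` enter only
as parameters. The iterated integral then splits, and this needs no admissibility. -/
theorem overlapAlong_eq {q : ℝ} (hq0 : 0 < q) (hq1 : q < 1) {N : ℕ} (α : Params N)
    (x y : Fin N → ℂ) (C : Fin N → Contour) :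
    overlapAlong q α x y C
      = ∏ j, ((2 * (Real.pi : ℂ) * I)⁻¹ * (C j).integral (integrandN q α x y j)) := by
  have h : ∀ z : Fin N → ℂ, eigFnN q α.s α.u α.lam x z *
      starN (eigFnThetaN q α.conj.t α.conj.v α.conj.lam (conjVec y)) z
      = ∏ j, (eigFn q (next α.s x j) α.u (α.lam j) 0 (x j) (z j) *
        eigFn q (prev α.t y j) α.v (-α.lam j) 0 (y j) (z j)) := by
    intro z
    rw [Finset.prod_mul_distrib, eigFnN, starN, eigFnThetaN, map_prod]
    congr 1
    refine Finset.prod_congr rfl fun j _ => ?_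
    rw [← star1_eigFnTheta hq0 hq1, star1, conj_prev]
    rfl
  rw [overlapAlong, pairingN]
  simp only [h]
  rw [iterIntegral_prod N C fun j z => eigFn q (next α.s x j) α.u (α.lam j) 0 (x j) z *
    eigFn q (prev α.t y j) α.v (-α.lam j) 0 (y j) z, Finset.prod_mul_distrib, Finset.prod_const,
    Finset.card_univ, Fintype.card_fin, inv_pow]
  rfl

/-! ### Multivariate coefficients: contours, product formula and symmetry. -/

section Multivariate

variable {q : ℝ} {N : ℕ} {α : Params N} {x y : Fin N → ℂ}

theorem Generic.exists_admissibleN (h : Generic q α x y) (hq0 : 0 < q) (hq1 : q < 1)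
    (hu : α.u ≠ 0) (hv : α.v ≠ 0) (hx : ∀ j, x j ≠ 0) (hy : ∀ j, y j ≠ 0) :
    ∃ C, AdmissibleN q α x y C := by
  have h1 : ∀ j, ∃ γ : Contour, Admissible q (next α.s x j) α.u (prev α.t y j) α.v (α.lam j) (x j)
      (y j) γ := fun j => by
    obtain ⟨γ, hγ⟩ := exists_admissible hq0 hq1 (α.lam j) hu hv (hy j) {next α.s x j} {x j}
      (by simpa using hx j) (by simpa using h j)
    exact ⟨γ, hγ _ (Finset.mem_singleton_self _) _ (Finset.mem_singleton_self _)⟩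
  choose C hC using h1
  exact ⟨C, hC⟩

theorem AdmissibleN.overlapAlong_eq_prod {C : Fin N → Contour} (h : AdmissibleN q α x y C)
    (hq0 : 0 < q) (hq1 : q < 1) (hs : α.s ≠ 0) (hu : α.u ≠ 0) (ht : α.t ≠ 0) (hv : α.v ≠ 0)
    (hx : ∀ j, x j ≠ 0) (hy : ∀ j, y j ≠ 0) :
    overlapAlong q α x y C
      = ∏ j, overlap1 q (next α.s x j) α.u (prev α.t y j) α.v (α.lam j) 0 (x j) (y j) := by
  rw [overlapAlong_eq hq0 hq1]
  exact Finset.prod_congr rfl fun j _ => ((h j).overlap1_eq hq0 hq1 (next_ne_zero hs hx j) hu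
    (prev_ne_zero ht hy j) hv (hx j) (hy j)).symm

theorem AdmissibleN.overlapN_eq_prod {C : Fin N → Contour} (h : AdmissibleN q α x y C)
    (hq0 : 0 < q) (hq1 : q < 1) (hs : α.s ≠ 0) (hu : α.u ≠ 0) (ht : α.t ≠ 0) (hv : α.v ≠ 0)
    (hx : ∀ j, x j ≠ 0) (hy : ∀ j, y j ≠ 0) :
    overlapN q α x y
      = ∏ j, overlap1 q (next α.s x j) α.u (prev α.t y j) α.v (α.lam j) 0 (x j) (y j) := by
  have hex : ∃ C, AdmissibleN q α x y C := ⟨C, h⟩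
  rw [overlapN, dif_pos hex]
  exact hex.choose_spec.overlapAlong_eq_prod hq0 hq1 hs hu ht hv hx hy

theorem conj_overlapN (hq0 : 0 < q) (hq1 : q < 1) (hs : α.s ≠ 0) (hu : α.u ≠ 0) (ht : α.t ≠ 0)
    (hv : α.v ≠ 0) (hx : ∀ j, x j ≠ 0) (hy : ∀ j, y j ≠ 0)
    (h : Generic q α.conj (conjVec x) (conjVec y)) :
    (starRingEnd ℂ) (overlapN q α.conj (conjVec x) (conjVec y))
      = overlapN q α.theta (revVec y) (revVec x) := by
  have hc : ∀ {z : ℂ}, z ≠ 0 → (starRingEnd ℂ) z ≠ 0 := fun hz => (map_ne_zero _).2 hz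
  have hs' : α.conj.s ≠ 0 := hc hs
  have hu' : α.conj.u ≠ 0 := hc hu
  have ht' : α.conj.t ≠ 0 := hc ht
  have hv' : α.conj.v ≠ 0 := hc hv
  have hx' : ∀ j, conjVec x j ≠ 0 := fun j => hc (hx j)
  have hy' : ∀ j, conjVec y j ≠ 0 := fun j => hc (hy j)
  obtain ⟨C, hC⟩ := h.exists_admissibleN hq0 hq1 hu' hv' hx' hy'
  -- The conjugated, reversed contours serve for the exchanged parameters. Reversing the order of
  -- the variables then turns predecessors into successors, as `α.theta` requires.
  have hadm : ∀ j, Admissible q (prev α.t y j) α.v (next α.s x j) α.u (α.lam j) (y j) (x j)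
      (C j).conjRev := fun j => by
    have h1 := (hC j).conjRev hq0
    rw [show α.conj.s = (starRingEnd ℂ) α.s from rfl, show α.conj.t = (starRingEnd ℂ) α.t from rfl,
      ← conj_next, ← conj_prev] at h1
    simpa [Params.conj, conjVec] using h1
  have hadmN : AdmissibleN q α.theta (revVec y) (revVec x) fun j => (C j.rev).conjRev := fun j => by
    rw [next_revVec, prev_revVec]
    exact hadm j.rev
  rw [hC.overlapN_eq_prod hq0 hq1 hs' hu' ht' hv' hx' hy',
    hadmN.overlapN_eq_prod hq0 hq1 ht hv hs hu (fun j => hy j.rev) (fun j => hx j.rev), map_prod,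
    ← Equiv.prod_comp Fin.revPerm]
  refine Finset.prod_congr rfl fun j _ => ?_
  rw [Fin.revPerm_apply, next_revVec, prev_revVec,
    (hC j.rev).overlap1_eq hq0 hq1 (next_ne_zero hs' hx' _) hu' (prev_ne_zero ht' hy' _) hv'
      (hx' _) (hy' _), conj_integral_integrand hq0 hq1,
    show α.conj.s = (starRingEnd ℂ) α.s from rfl, show α.conj.t = (starRingEnd ℂ) α.t from rfl,
    ← conj_next, ← conj_prev]
  exact ((by simpa [Params.conj, conjVec, Params.theta, revVec] using
    ((hadm j.rev).overlap1_eq hq0 hq1 (prev_ne_zero ht hy _) hv (next_ne_zero hs hx _) hu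
      (hy _) (hx _)).symm))

end Multivariate

end AWOverlap

end

noncomputable section

namespace AWOverlap

/-! ### Contiguous relations for the eigenfunctions: rational identities -/

/-- The contiguous relation for `m = 0` divided by the common eigenfunction. Here `a` stands for `v
/ u` and `T` for `t + t⁻¹`, while `a W X` is the variable of the second eigenfunction. As `T` is
free, two identities are proved at once: the coefficient of `T` and the rest. -/
theorem contiguous_rational_zero {q W s x X a T : ℂ} (hq : q ≠ 0) (hW : W ≠ 0) (hs : s ≠ 0)
    (hx : x ≠ 0) (hX : X ≠ 0) (ha : a ≠ 0) (h1 : 1 - x ^ 2 ≠ 0) (h2 : 1 - q ^ 2 * x ^ 2 ≠ 0)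
    (h3 : x ^ 2 - q ^ 2 ≠ 0) (h4 : q ^ 2 - X * x ≠ 0) (h5 : x * q ^ 2 - X ≠ 0) (h6 : 1 + q ^ 2 ≠ 0) :
    (T - (x⁻¹ / (a * q) + a * q * x)) *
      (-(x * (1 - s * q * W * x)) / (s * (1 - x ^ 2) * (1 - q ^ 2 * x ^ 2)) *
        ((1 - s * q / W * x⁻¹ / q ^ 2) * (1 - X * x) / (1 - X * x⁻¹ / q ^ 2)))
    + (T - (x / (a * q) + a * q * x⁻¹)) *
      (-(x⁻¹ * (1 - s * q * W * x⁻¹)) / (s * (1 - x⁻¹ ^ 2) * (1 - q ^ 2 * x⁻¹ ^ 2)) *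
        ((1 - s * q / W * x / q ^ 2) * (1 - X * x⁻¹) / (1 - X * x / q ^ 2)))
    + (T - (a + a⁻¹) * (x + x⁻¹) / (q⁻¹ + q)) *
      (x * (1 - s * q * W * x) / (s * (1 - x ^ 2) * (1 - q ^ 2 * x ^ 2)) * (1 - s * q / W * x)
      + x⁻¹ * (1 - s * q * W * x⁻¹) / (s * (1 - x⁻¹ ^ 2) * (1 - q ^ 2 * x⁻¹ ^ 2)) *
        (1 - s * q / W * x⁻¹))
    = a * W * X + (a * W * X)⁻¹ - (a + a⁻¹) * (s + s⁻¹) / (q⁻¹ + q)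
      - X * (1 - s * q * W * X / q ^ 2) * (1 - s * q / W / X) /
        (s * q ^ 2 * (1 - X * x / q ^ 2) * (1 - X * x⁻¹ / q ^ 2)) *
        (T - (a * X / q + q / (a * X))) := by
  have e1 : 1 - X * x⁻¹ / q ^ 2 = (x * q ^ 2 - X) / (x * q ^ 2) := by field_simp
  have e2 : 1 - X * x / q ^ 2 = (q ^ 2 - X * x) / q ^ 2 := by field_simp
  have e3 : 1 - x⁻¹ ^ 2 = -(1 - x ^ 2) / x ^ 2 := by field_simp; ring
  have e4 : 1 - q ^ 2 * x⁻¹ ^ 2 = (x ^ 2 - q ^ 2) / x ^ 2 := by field_simp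
  have e6 : q⁻¹ + q = (1 + q ^ 2) / q := by field_simp
  rw [e1, e2, e3, e4, e6]
  -- The denominators are made opaque so that `field_simp` clears them as single symbols. They are
  -- expanded again only for the final polynomial identity.
  obtain ⟨D1, d1⟩ : ∃ D, D = 1 - x ^ 2 := ⟨_, rfl⟩
  obtain ⟨D2, d2⟩ : ∃ D, D = 1 - q ^ 2 * x ^ 2 := ⟨_, rfl⟩
  obtain ⟨D3, d3⟩ : ∃ D, D = x ^ 2 - q ^ 2 := ⟨_, rfl⟩
  obtain ⟨D4, d4⟩ : ∃ D, D = q ^ 2 - X * x := ⟨_, rfl⟩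
  obtain ⟨D5, d5⟩ : ∃ D, D = x * q ^ 2 - X := ⟨_, rfl⟩
  obtain ⟨D6, d6⟩ : ∃ D, D = 1 + q ^ 2 := ⟨_, rfl⟩
  rw [← d1] at h1
  rw [← d2] at h2
  rw [← d3] at h3
  rw [← d4] at h4
  rw [← d5] at h5
  rw [← d6] at h6
  rw [← d1, ← d2, ← d3, ← d4, ← d5, ← d6]
  field_simp
  rw [d1, d2, d3, d4, d5, d6]
  ring

/-- The case `m = 1`. The normalization differs from the other two cases: the factor `(1 - s q W X)
/ (1 - s q / (W X))` of the unshifted eigenfunction is kept on the right, as `1 - s q W X` may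
vanish and cannot be divided out. -/
theorem contiguous_rational_pos {q W s x X a T : ℂ} (hq : q ≠ 0) (hW : W ≠ 0) (hs : s ≠ 0)
    (hx : x ≠ 0) (hX : X ≠ 0) (ha : a ≠ 0) (h1 : 1 - x ^ 2 ≠ 0) (h2 : 1 - q ^ 2 * x ^ 2 ≠ 0)
    (h3 : x ^ 2 - q ^ 2 ≠ 0) (h4 : q ^ 2 - X * x ≠ 0) (h5 : x * q ^ 2 - X ≠ 0) (h6 : 1 + q ^ 2 ≠ 0)
    (h7 : W * X - s * q ≠ 0) :
    (T - (x⁻¹ / (a * q) + a * q * x)) *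
      ((1 - s * q * W * x) * (1 - s * q * W * x * q ^ 2) / ((1 - x ^ 2) * (1 - q ^ 2 * x ^ 2)) *
        (-(X / (s * q ^ 2)) * (1 - X * x) / (1 - X * x⁻¹ / q ^ 2)))
    + (T - (x / (a * q) + a * q * x⁻¹)) *
      ((1 - s * q * W * x⁻¹) * (1 - s * q * W * x⁻¹ * q ^ 2) /
        ((1 - x⁻¹ ^ 2) * (1 - q ^ 2 * x⁻¹ ^ 2)) *
        (-(X / (s * q ^ 2)) * (1 - X * x⁻¹) / (1 - X * x / q ^ 2)))
    + (T - (a + a⁻¹) * (x + x⁻¹) / (q⁻¹ + q)) *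
      (q⁻¹ * (q⁻¹ + q) * (1 - s * q * W * x) * (1 - s * q * W * x⁻¹) /
        ((1 - x ^ 2 / q ^ 2) * (1 - 1 / (x ^ 2 * q ^ 2))) * -(X / (s * q ^ 2)))
    = (a * W * X + (a * W * X)⁻¹ - (a * q * s + (a * q * s)⁻¹)) *
      ((1 - s * q * W * X) / (1 - s * q / W / X))
      - X * (1 - s * q * W * X / q ^ 2) * (1 - s * q * W * X) /
        (s * q ^ 2 * (1 - X * x / q ^ 2) * (1 - X * x⁻¹ / q ^ 2)) *
        (T - (a * X / q + q / (a * X))) := by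
  have e1 : 1 - X * x⁻¹ / q ^ 2 = (x * q ^ 2 - X) / (x * q ^ 2) := by field_simp
  have e2 : 1 - X * x / q ^ 2 = (q ^ 2 - X * x) / q ^ 2 := by field_simp
  have e3 : 1 - x⁻¹ ^ 2 = -(1 - x ^ 2) / x ^ 2 := by field_simp; ring
  have e4 : 1 - q ^ 2 * x⁻¹ ^ 2 = (x ^ 2 - q ^ 2) / x ^ 2 := by field_simp
  have e6 : q⁻¹ + q = (1 + q ^ 2) / q := by field_simp
  have e7 : 1 - s * q / W / X = (W * X - s * q) / (W * X) := by field_simp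
  have e8 : 1 - x ^ 2 / q ^ 2 = -(x ^ 2 - q ^ 2) / q ^ 2 := by field_simp; ring
  have e9 : 1 - 1 / (x ^ 2 * q ^ 2) = -(1 - q ^ 2 * x ^ 2) / (x ^ 2 * q ^ 2) := by
    field_simp; ring
  rw [e1, e2, e3, e4, e6, e7, e8, e9]
  obtain ⟨D1, d1⟩ : ∃ D, D = 1 - x ^ 2 := ⟨_, rfl⟩
  obtain ⟨D2, d2⟩ : ∃ D, D = 1 - q ^ 2 * x ^ 2 := ⟨_, rfl⟩
  obtain ⟨D3, d3⟩ : ∃ D, D = x ^ 2 - q ^ 2 := ⟨_, rfl⟩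
  obtain ⟨D4, d4⟩ : ∃ D, D = q ^ 2 - X * x := ⟨_, rfl⟩
  obtain ⟨D5, d5⟩ : ∃ D, D = x * q ^ 2 - X := ⟨_, rfl⟩
  obtain ⟨D6, d6⟩ : ∃ D, D = 1 + q ^ 2 := ⟨_, rfl⟩
  obtain ⟨D7, d7⟩ : ∃ D, D = W * X - s * q := ⟨_, rfl⟩
  rw [← d1] at h1
  rw [← d2] at h2
  rw [← d3] at h3
  rw [← d4] at h4
  rw [← d5] at h5
  rw [← d6] at h6
  rw [← d7] at h7
  rw [← d1, ← d2, ← d3, ← d4, ← d5, ← d6, ← d7]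
  field_simp
  rw [d1, d2, d3, d4, d5, d6, d7]
  ring

/-- The case `m = -1`, with the additional denominator `1 - s / (q W X)` that the shift of `s` by
`q⁻²` produces. -/
theorem contiguous_rational_neg {q W s x X a T : ℂ} (hq : q ≠ 0) (hW : W ≠ 0) (hs : s ≠ 0)
    (hx : x ≠ 0) (hX : X ≠ 0) (ha : a ≠ 0) (h1 : 1 - x ^ 2 ≠ 0) (h2 : 1 - q ^ 2 * x ^ 2 ≠ 0)
    (h3 : x ^ 2 - q ^ 2 ≠ 0) (h4 : q ^ 2 - X * x ≠ 0) (h5 : x * q ^ 2 - X ≠ 0) (h6 : 1 + q ^ 2 ≠ 0)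
    (h7 : W * X * q - s ≠ 0) :
    (T - (x⁻¹ / (a * q) + a * q * x)) *
      (x ^ 2 * q ^ 2 / (s ^ 2 * (1 - x ^ 2) * (1 - q ^ 2 * x ^ 2)) *
        ((1 - s * q / W * x⁻¹ / q ^ 4) * (1 - s * q / W * x⁻¹ / q ^ 2) * (1 - s * q * W * X / q ^ 2) *
          -(s / X) * (1 - X * x) / ((1 - X * x⁻¹ / q ^ 2) * (1 - s * q / W / X / q ^ 2))))
    + (T - (x / (a * q) + a * q * x⁻¹)) *
      (x⁻¹ ^ 2 * q ^ 2 / (s ^ 2 * (1 - x⁻¹ ^ 2) * (1 - q ^ 2 * x⁻¹ ^ 2)) *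
        ((1 - s * q / W * x / q ^ 4) * (1 - s * q / W * x / q ^ 2) * (1 - s * q * W * X / q ^ 2) *
          -(s / X) * (1 - X * x⁻¹) / ((1 - X * x / q ^ 2) * (1 - s * q / W / X / q ^ 2))))
    + (T - (a + a⁻¹) * (x + x⁻¹) / (q⁻¹ + q)) *
      (q⁻¹ * (q⁻¹ + q) / (s ^ 2 * (1 - x ^ 2 / q ^ 2) * (1 - 1 / (x ^ 2 * q ^ 2))) *
        ((1 - s * q / W * x / q ^ 2) * (1 - s * q / W * x⁻¹ / q ^ 2) * (1 - s * q * W * X / q ^ 2) *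
          -(s / X) / (1 - s * q / W / X / q ^ 2)))
    = a * W * X + (a * W * X)⁻¹ - (a * q / s + s / (a * q))
      - X * (1 - s * q * W * X / q ^ 2) * (1 - s * q / W / X) /
        (s * q ^ 2 * (1 - X * x / q ^ 2) * (1 - X * x⁻¹ / q ^ 2)) *
        (T - (a * X / q + q / (a * X))) := by
  have e1 : 1 - X * x⁻¹ / q ^ 2 = (x * q ^ 2 - X) / (x * q ^ 2) := by field_simp
  have e2 : 1 - X * x / q ^ 2 = (q ^ 2 - X * x) / q ^ 2 := by field_simp
  have e3 : 1 - x⁻¹ ^ 2 = -(1 - x ^ 2) / x ^ 2 := by field_simp; ring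
  have e4 : 1 - q ^ 2 * x⁻¹ ^ 2 = (x ^ 2 - q ^ 2) / x ^ 2 := by field_simp
  have e6 : q⁻¹ + q = (1 + q ^ 2) / q := by field_simp
  have e7 : 1 - s * q / W / X / q ^ 2 = (W * X * q - s) / (W * X * q) := by field_simp
  have e8 : 1 - x ^ 2 / q ^ 2 = -(x ^ 2 - q ^ 2) / q ^ 2 := by field_simp; ring
  have e9 : 1 - 1 / (x ^ 2 * q ^ 2) = -(1 - q ^ 2 * x ^ 2) / (x ^ 2 * q ^ 2) := by
    field_simp; ring
  rw [e1, e2, e3, e4, e6, e7, e8, e9]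
  obtain ⟨D1, d1⟩ : ∃ D, D = 1 - x ^ 2 := ⟨_, rfl⟩
  obtain ⟨D2, d2⟩ : ∃ D, D = 1 - q ^ 2 * x ^ 2 := ⟨_, rfl⟩
  obtain ⟨D3, d3⟩ : ∃ D, D = x ^ 2 - q ^ 2 := ⟨_, rfl⟩
  obtain ⟨D4, d4⟩ : ∃ D, D = q ^ 2 - X * x := ⟨_, rfl⟩
  obtain ⟨D5, d5⟩ : ∃ D, D = x * q ^ 2 - X := ⟨_, rfl⟩
  obtain ⟨D6, d6⟩ : ∃ D, D = 1 + q ^ 2 := ⟨_, rfl⟩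
  obtain ⟨D7, d7⟩ : ∃ D, D = W * X * q - s := ⟨_, rfl⟩
  rw [← d1] at h1
  rw [← d2] at h2
  rw [← d3] at h3
  rw [← d4] at h4
  rw [← d5] at h5
  rw [← d6] at h6
  rw [← d7] at h7
  rw [← d1, ← d2, ← d3, ← d4, ← d5, ← d6, ← d7]
  field_simp
  rw [d1, d2, d3, d4, d5, d6, d7]
  ring

end AWOverlap

end

noncomputable section

namespace AWOverlap

open Complex

/-! ### Contiguous relations for the eigenfunctions -/

/-- The common factor of the functions `f_{x q^{2ν}, s q^{2m}}`, `ν, m ∈ {-1, 0, 1}`. -/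
def coreBase (q W s x X : ℂ) : ℂ :=
  qPoch (s * q / W * x * q ^ 2) (q ^ 2) * qPoch (s * q / W * x⁻¹ * q ^ 2) (q ^ 2)
    * qPoch (s * q * W * X * q ^ 2) (q ^ 2) * qTheta (X / s) (q ^ 2)
    * (qPoch (X * x * q ^ 2) (q ^ 2))⁻¹ * (qPoch (X * x⁻¹ * q ^ 2) (q ^ 2))⁻¹
    * (qPoch (s * q / W / X * q ^ 2) (q ^ 2))⁻¹

theorem coreBase_inv (q W s x X : ℂ) : coreBase q W s x⁻¹ X = coreBase q W s x X := by
  simp only [coreBase, inv_inv]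
  ring

/-- By this symmetry the shift of `x` by `q⁻²` follows from the one by `q²`. -/
theorem eigCore_inv (q W s x X : ℂ) : eigCore q W s x⁻¹ X = eigCore q W s x X := by
  simp only [eigCore, inv_inv]
  ring

theorem eigCore_eq {q : ℂ} (hb : ‖q ^ 2‖ < 1) (W s x X : ℂ) :
    eigCore q W s x X = (1 - s * q / W * x) * (1 - s * q / W * x⁻¹) *
      (1 - s * q * W * X) * ((1 - X * x) * (1 - X * x⁻¹) * (1 - s * q / W / X))⁻¹ *
      coreBase q W s x X := by
  rw [eigCore, coreBase, qPoch_eq hb (s * q / W * x), qPoch_eq hb (s * q / W * x⁻¹),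
    qPoch_eq hb (s * q * W * X), qPoch_eq hb (X * x), qPoch_eq hb (X * x⁻¹),
    qPoch_eq hb (s * q / W / X)]
  simp only [div_eq_mul_inv, mul_inv]
  ring

theorem eigCore_shift_x {q : ℂ} (hb : ‖q ^ 2‖ < 1) (hq : q ≠ 0) (W s x X : ℂ) :
    eigCore q W s (x * q ^ 2) X
      = (1 - s * q / W * x⁻¹) * (1 - s * q / W * x⁻¹ / q ^ 2) * (1 - s * q * W * X) *
      ((1 - X * x⁻¹) * (1 - X * x⁻¹ / q ^ 2) * (1 - s * q / W / X))⁻¹ * coreBase q W s x X := by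
  have hq2 : q ^ 2 ≠ 0 := pow_ne_zero 2 hq
  rw [eigCore, coreBase, mul_inv, ← mul_assoc, ← mul_assoc, ← mul_assoc, ← mul_assoc,
    qPoch_eq hb (s * q / W * x⁻¹ * (q ^ 2)⁻¹), inv_mul_cancel_right₀ hq2,
    qPoch_eq hb (s * q / W * x⁻¹),
    qPoch_eq hb (s * q * W * X), qPoch_eq hb (X * x⁻¹ * (q ^ 2)⁻¹), inv_mul_cancel_right₀ hq2,
    qPoch_eq hb (X * x⁻¹), qPoch_eq hb (s * q / W / X)]
  simp only [div_eq_mul_inv, mul_inv]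
  ring

theorem eigCore_shift_s {q : ℂ} (hb : ‖q ^ 2‖ < 1) (hq : q ≠ 0) {s X : ℂ} (hs : s ≠ 0)
    (hX : X ≠ 0) (W x : ℂ) : eigCore q W (s * q ^ 2) x X
      = -(X / (s * q ^ 2)) * ((1 - X * x) * (1 - X * x⁻¹))⁻¹ * coreBase q W s x X := by
  have hq2 : q ^ 2 ≠ 0 := pow_ne_zero 2 hq
  have hth := qTheta_div hb hq2 (div_ne_zero hX hs)
  rw [eigCore, coreBase, show s * q ^ 2 * q / W * x = s * q / W * x * q ^ 2 by ring,
    show s * q ^ 2 * q / W * x⁻¹ = s * q / W * x⁻¹ * q ^ 2 by ring,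
    show s * q ^ 2 * q * W * X = s * q * W * X * q ^ 2 by ring,
    show s * q ^ 2 * q / W / X = s * q / W / X * q ^ 2 by ring,
    show X / (s * q ^ 2) = X / s / q ^ 2 by rw [div_div], hth, qPoch_eq hb (X * x),
    qPoch_eq hb (X * x⁻¹)]
  simp only [div_eq_mul_inv, mul_inv]
  ring

/-- The factor on the left completes a shifted factorial to the one in `coreBase`. It may vanish, so
it is not divided out. It also occurs in `A^+`, which is where the lemma is applied. -/
theorem eigCore_shift_s_x {q : ℂ} (hb : ‖q ^ 2‖ < 1) (hq : q ≠ 0) {s X : ℂ} (hs : s ≠ 0)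
    (hX : X ≠ 0) (W x : ℂ) :
    (1 - s * q / W * x * q ^ 2) * eigCore q W (s * q ^ 2) (x * q ^ 2) X
      = -(X / (s * q ^ 2)) * (1 - s * q / W * x⁻¹) *
      ((1 - X * x⁻¹) * (1 - X * x⁻¹ / q ^ 2))⁻¹ * coreBase q W s x X := by
  have hq2 : q ^ 2 ≠ 0 := pow_ne_zero 2 hq
  have hth := qTheta_div hb hq2 (div_ne_zero hX hs)
  rw [eigCore, coreBase,
    show s * q ^ 2 * q / W * (x * q ^ 2) = s * q / W * x * q ^ 2 * q ^ 2 by ring,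
    show s * q ^ 2 * q / W * (x * q ^ 2)⁻¹ = s * q / W * x⁻¹ by rw [mul_inv]; field_simp,
    show s * q ^ 2 * q * W * X = s * q * W * X * q ^ 2 by ring,
    show s * q ^ 2 * q / W / X = s * q / W / X * q ^ 2 by ring,
    show X / (s * q ^ 2) = X / s / q ^ 2 by rw [div_div], hth,
    qPoch_eq hb (s * q / W * x * q ^ 2), qPoch_eq hb (s * q / W * x⁻¹),
    show X * (x * q ^ 2)⁻¹ = X * x⁻¹ / q ^ 2 by rw [mul_inv, div_eq_mul_inv, mul_assoc],
    qPoch_eq hb (X * x⁻¹ / q ^ 2), div_mul_cancel₀ _ hq2, qPoch_eq hb (X * x⁻¹)]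
  simp only [div_eq_mul_inv, mul_inv]
  ring

theorem eigCore_shift_s_neg {q : ℂ} (hb : ‖q ^ 2‖ < 1) (hq : q ≠ 0) {s X : ℂ} (hs : s ≠ 0)
    (hX : X ≠ 0) (W x : ℂ) : eigCore q W (s * (q ^ 2)⁻¹) x X
      = (1 - s * q / W * x) * (1 - s * q / W * x / q ^ 2) * (1 - s * q / W * x⁻¹) *
      (1 - s * q / W * x⁻¹ / q ^ 2) * (1 - s * q * W * X) * (1 - s * q * W * X / q ^ 2) *
      -(s / X) * ((1 - X * x) * (1 - X * x⁻¹) * (1 - s * q / W / X) *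
        (1 - s * q / W / X / q ^ 2))⁻¹ * coreBase q W s x X := by
  have hq2 : q ^ 2 ≠ 0 := pow_ne_zero 2 hq
  have hth := qTheta_mul hb hq2 (div_ne_zero hX hs)
  rw [eigCore, coreBase, show s * (q ^ 2)⁻¹ * q / W * x = s * q / W * x / q ^ 2 by ring,
    show s * (q ^ 2)⁻¹ * q / W * x⁻¹ = s * q / W * x⁻¹ / q ^ 2 by ring,
    show s * (q ^ 2)⁻¹ * q * W * X = s * q * W * X / q ^ 2 by ring,
    show s * (q ^ 2)⁻¹ * q / W / X = s * q / W / X / q ^ 2 by ring,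
    show X / (s * (q ^ 2)⁻¹) = X / s * q ^ 2 by field_simp, hth,
    qPoch_eq hb (s * q / W * x / q ^ 2), div_mul_cancel₀ _ hq2, qPoch_eq hb (s * q / W * x),
    qPoch_eq hb (s * q / W * x⁻¹ / q ^ 2), div_mul_cancel₀ _ hq2, qPoch_eq hb (s * q / W * x⁻¹),
    qPoch_eq hb (s * q * W * X / q ^ 2), div_mul_cancel₀ _ hq2, qPoch_eq hb (s * q * W * X),
    qPoch_eq hb (s * q / W / X / q ^ 2), div_mul_cancel₀ _ hq2, qPoch_eq hb (s * q / W / X),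
    qPoch_eq hb (X * x), qPoch_eq hb (X * x⁻¹), inv_div]
  simp only [div_eq_mul_inv, mul_inv]
  ring

theorem eigCore_shift_s_neg_x {q : ℂ} (hb : ‖q ^ 2‖ < 1) (hq : q ≠ 0) {s X : ℂ} (hs : s ≠ 0)
    (hX : X ≠ 0) (W x : ℂ) : eigCore q W (s * (q ^ 2)⁻¹) (x * q ^ 2) X
      = (1 - s * q / W * x) * (1 - s * q / W * x⁻¹) *
      (1 - s * q / W * x⁻¹ / q ^ 2) * (1 - s * q / W * x⁻¹ / q ^ 4) * (1 - s * q * W * X) *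
      (1 - s * q * W * X / q ^ 2) * -(s / X) * ((1 - X * x⁻¹) * (1 - X * x⁻¹ / q ^ 2) *
      (1 - s * q / W / X) * (1 - s * q / W / X / q ^ 2))⁻¹ * coreBase q W s x X := by
  have hq2 : q ^ 2 ≠ 0 := pow_ne_zero 2 hq
  have hth := qTheta_mul hb hq2 (div_ne_zero hX hs)
  rw [eigCore, coreBase,
    show s * (q ^ 2)⁻¹ * q / W * (x * q ^ 2) = s * q / W * x by field_simp,
    show s * (q ^ 2)⁻¹ * q / W * (x * q ^ 2)⁻¹ = s * q / W * x⁻¹ / q ^ 2 / q ^ 2 by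
      rw [mul_inv]; ring_nf,
    show s * (q ^ 2)⁻¹ * q * W * X = s * q * W * X / q ^ 2 by ring,
    show s * (q ^ 2)⁻¹ * q / W / X = s * q / W / X / q ^ 2 by ring,
    show X / (s * (q ^ 2)⁻¹) = X / s * q ^ 2 by field_simp, hth,
    qPoch_eq hb (s * q / W * x),
    qPoch_eq hb (s * q / W * x⁻¹ / q ^ 2 / q ^ 2), div_mul_cancel₀ _ hq2,
    qPoch_eq hb (s * q / W * x⁻¹ / q ^ 2), div_mul_cancel₀ _ hq2, qPoch_eq hb (s * q / W * x⁻¹),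
    qPoch_eq hb (s * q * W * X / q ^ 2), div_mul_cancel₀ _ hq2, qPoch_eq hb (s * q * W * X),
    qPoch_eq hb (s * q / W / X / q ^ 2), div_mul_cancel₀ _ hq2, qPoch_eq hb (s * q / W / X),
    show X * (x * q ^ 2)⁻¹ = X * x⁻¹ / q ^ 2 by rw [mul_inv, div_eq_mul_inv, mul_assoc],
    qPoch_eq hb (X * x⁻¹ / q ^ 2), div_mul_cancel₀ _ hq2, qPoch_eq hb (X * x⁻¹), inv_div,
    show s * q / W * x⁻¹ / q ^ 4 = s * q / W * x⁻¹ / q ^ 2 / q ^ 2 by rw [div_div]; ring_nf]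
  simp only [div_eq_mul_inv, mul_inv]
  ring

/-- The `x`-dependent factor of the function whose `q²`-difference is the contiguous relation. -/
def gCore (q W s x X : ℂ) : ℂ :=
  X / (s * q ^ 2) * (qPoch (s * q / W * x) (q ^ 2) * qPoch (s * q / W * x⁻¹) (q ^ 2)
      * qPoch (s * q * W * X / q ^ 2) (q ^ 2) * qTheta (X / s) (q ^ 2))
    * (qPoch (X * x / q ^ 2) (q ^ 2))⁻¹ * (qPoch (X * x⁻¹ / q ^ 2) (q ^ 2))⁻¹
    * (qPoch (s * q / W / X * q ^ 2) (q ^ 2))⁻¹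

/-- The `y`-dependent factor of the function whose `q²`-difference is the contiguous relation. -/
def gDual (q W t y Y : ℂ) : ℂ :=
  t⁻¹ * (qPoch (t * q / W * y) (q ^ 2) * qPoch (t * q / W * y⁻¹) (q ^ 2)
      * qPoch (t * q * W * Y / q ^ 2) (q ^ 2) * qTheta (Y / t) (q ^ 2))
    * (qPoch (Y * y) (q ^ 2))⁻¹ * (qPoch (Y * y⁻¹) (q ^ 2))⁻¹
    * (qPoch (t * q / W / Y * q ^ 2) (q ^ 2))⁻¹

theorem gCore_eq {q : ℂ} (hb : ‖q ^ 2‖ < 1) (hq : q ≠ 0) (W s x X : ℂ) :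
    gCore q W s x X = X / (s * q ^ 2) * (1 - s * q / W * x) * (1 - s * q / W * x⁻¹) *
      (1 - s * q * W * X / q ^ 2) * (1 - s * q * W * X) * ((1 - X * x / q ^ 2) * (1 - X * x) *
      (1 - X * x⁻¹ / q ^ 2) * (1 - X * x⁻¹))⁻¹ * coreBase q W s x X := by
  have hq2 : q ^ 2 ≠ 0 := pow_ne_zero 2 hq
  rw [gCore, coreBase, qPoch_eq hb (s * q / W * x), qPoch_eq hb (s * q / W * x⁻¹),
    qPoch_eq hb (s * q * W * X / q ^ 2), div_mul_cancel₀ _ hq2, qPoch_eq hb (s * q * W * X),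
    qPoch_eq hb (X * x / q ^ 2), div_mul_cancel₀ _ hq2, qPoch_eq hb (X * x),
    qPoch_eq hb (X * x⁻¹ / q ^ 2), div_mul_cancel₀ _ hq2, qPoch_eq hb (X * x⁻¹)]
  simp only [div_eq_mul_inv, mul_inv]
  ring

/-- The prefactor of `gCore` is normalized so that the monomials from the theta function cancel and
the shift returns the eigenfunction exactly. -/
theorem gCore_shift {q : ℂ} (hb : ‖q ^ 2‖ < 1) (hq : q ≠ 0) {s X : ℂ} (hs : s ≠ 0)
    (hX : X ≠ 0) (W x : ℂ) : gCore q W s x (X * q ^ 2) = -eigCore q W s x X := by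
  have hq2 : q ^ 2 ≠ 0 := pow_ne_zero 2 hq
  rw [gCore, eigCore, show s * q * W * (X * q ^ 2) / q ^ 2 = s * q * W * X by field_simp,
    show X * q ^ 2 / s = X / s * q ^ 2 by ring, qTheta_mul hb hq2 (div_ne_zero hX hs),
    show X * q ^ 2 * x / q ^ 2 = X * x by field_simp,
    show X * q ^ 2 * x⁻¹ / q ^ 2 = X * x⁻¹ by field_simp,
    show s * q / W / (X * q ^ 2) * q ^ 2 = s * q / W / X by field_simp, inv_div,
    mul_div_mul_right _ _ hq2]
  simp only [div_eq_mul_inv, mul_inv]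
  linear_combination (-(X * X⁻¹) * (qPoch (s * q * W⁻¹ * x) (q ^ 2) *
    qPoch (s * q * W⁻¹ * x⁻¹) (q ^ 2) * qPoch (s * q * W * X) (q ^ 2) * qTheta (X * s⁻¹) (q ^ 2)) *
    (qPoch (X * x) (q ^ 2))⁻¹ * (qPoch (X * x⁻¹) (q ^ 2))⁻¹ *
    (qPoch (s * q * W⁻¹ * X⁻¹) (q ^ 2))⁻¹) * mul_inv_cancel₀ hs
    + (-(qPoch (s * q * W⁻¹ * x) (q ^ 2) *
    qPoch (s * q * W⁻¹ * x⁻¹) (q ^ 2) * qPoch (s * q * W * X) (q ^ 2) * qTheta (X * s⁻¹) (q ^ 2)) *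
    (qPoch (X * x) (q ^ 2))⁻¹ * (qPoch (X * x⁻¹) (q ^ 2))⁻¹ *
    (qPoch (s * q * W⁻¹ * X⁻¹) (q ^ 2))⁻¹) * mul_inv_cancel₀ hX

/-- A device for cancelling one denominator known to be nonzero while `ring` treats all other
inverses as symbols, so that nothing else has to be nonzero. -/
theorem eq_of_mul_mul_inv {L R d : ℂ} (hd : d ≠ 0) (h : L * (d * d⁻¹) = R) : L = R := by
  rw [← h, mul_inv_cancel₀ hd, mul_one]

/-- The prefactor expands to `t + t⁻¹ - (W Y / q + q / (W Y))`. With `W` inverted, as in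
`primitive`, `W Y` is `a X`, and this is the factor of `gCore` in the contiguous relations. -/
theorem gDual_eq {q : ℂ} (hb : ‖q ^ 2‖ < 1) (hq : q ≠ 0) {t W Y : ℂ} (y : ℂ)
    (h : 1 - t * q / W / Y ≠ 0) :
    gDual q W t y Y = t⁻¹ * (1 - t * q * W * Y / q ^ 2) * (1 - t * q / W / Y) *
      eigCore q W t y Y := by
  have hq2 : q ^ 2 ≠ 0 := pow_ne_zero 2 hq
  rw [gDual, eigCore, qPoch_eq hb (t * q * W * Y / q ^ 2), div_mul_cancel₀ _ hq2,
    qPoch_eq hb (t * q / W / Y)]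
  refine eq_of_mul_mul_inv h ?_
  simp only [div_eq_mul_inv, mul_inv]
  ring

/-- The prefactor expands to `y + y⁻¹ - (Y + Y⁻¹)`, which is how the eigenvalue in `y` enters the
difference equation. -/
theorem gDual_shift {q : ℂ} (hb : ‖q ^ 2‖ < 1) (hq : q ≠ 0) {t Y : ℂ} (ht : t ≠ 0)
    (hY : Y ≠ 0) (W : ℂ) {y : ℂ} (h1 : 1 - Y * y ≠ 0) (h2 : 1 - Y * y⁻¹ ≠ 0) :
    gDual q W t y (Y * q ^ 2) = -(Y⁻¹ * (1 - Y * y) * (1 - Y * y⁻¹)) * eigCore q W t y Y := by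
  have hq2 : q ^ 2 ≠ 0 := pow_ne_zero 2 hq
  rw [gDual, eigCore, show t * q * W * (Y * q ^ 2) / q ^ 2 = t * q * W * Y by field_simp,
    show Y * q ^ 2 / t = Y / t * q ^ 2 by ring, qTheta_mul hb hq2 (div_ne_zero hY ht),
    show Y * q ^ 2 * y = Y * y * q ^ 2 by ring,
    show Y * q ^ 2 * y⁻¹ = Y * y⁻¹ * q ^ 2 by ring,
    show t * q / W / (Y * q ^ 2) * q ^ 2 = t * q / W / Y by field_simp,
    qPoch_eq hb (Y * y), qPoch_eq hb (Y * y⁻¹), inv_div]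
  refine eq_of_mul_mul_inv (mul_ne_zero h1 h2) ?_
  rw [mul_inv, show t⁻¹ * (qPoch (t * q / W * y) (q ^ 2) * qPoch (t * q / W * y⁻¹) (q ^ 2) *
    qPoch (t * q * W * Y) (q ^ 2) * (-(t / Y) * qTheta (Y / t) (q ^ 2))) =
    -(Y⁻¹ * (qPoch (t * q / W * y) (q ^ 2) * qPoch (t * q / W * y⁻¹) (q ^ 2) *
    qPoch (t * q * W * Y) (q ^ 2) * qTheta (Y / t) (q ^ 2))) by field_simp]
  simp only [div_eq_mul_inv, mul_inv]
  ring

end AWOverlap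

end

/-! ### Contiguous relations for the eigenfunctions: the three shifts of `s`. -/

noncomputable section

namespace AWOverlap

open Complex

theorem coefA_mul_eigCore {q : ℂ} (hb : ‖q ^ 2‖ < 1) (hq : q ≠ 0) (W s : ℂ) {x X : ℂ}
    (h : 1 - X * x ≠ 0) :
    -(x * (1 - s * x * (q / W)) * (1 - s * x * (q * W))) / (s * (1 - x ^ 2) * (1 - q ^ 2 * x ^ 2)) *
        eigCore q W s (x * q ^ 2) X
      = -(x * (1 - s * q * W * x)) / (s * (1 - x ^ 2) * (1 - q ^ 2 * x ^ 2)) *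
        ((1 - s * q / W * x⁻¹ / q ^ 2) * (1 - X * x) / (1 - X * x⁻¹ / q ^ 2)) *
        eigCore q W s x X := by
  rw [eigCore_shift_x hb hq, eigCore_eq hb]
  refine eq_of_mul_mul_inv h ?_
  simp only [div_eq_mul_inv, mul_inv]
  ring

theorem gCore_eq_mul_eigCore {q : ℂ} (hb : ‖q ^ 2‖ < 1) (hq : q ≠ 0) {W s X : ℂ} (x : ℂ)
    (h : 1 - s * q / W / X ≠ 0) :
    gCore q W s x X = X * (1 - s * q * W * X / q ^ 2) * (1 - s * q / W / X) /
        (s * q ^ 2 * (1 - X * x / q ^ 2) * (1 - X * x⁻¹ / q ^ 2)) * eigCore q W s x X := by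
  rw [gCore_eq hb hq, eigCore_eq hb]
  refine eq_of_mul_mul_inv h ?_
  simp only [div_eq_mul_inv, mul_inv]
  ring

theorem contiguous_zero {q W s x X a : ℂ} (T : ℂ) (hb : ‖q ^ 2‖ < 1) (hq : q ≠ 0) (hW : W ≠ 0)
    (hs : s ≠ 0) (hx : x ≠ 0) (hX : X ≠ 0) (ha : a ≠ 0) (h1 : 1 - x ^ 2 ≠ 0)
    (h2 : 1 - q ^ 2 * x ^ 2 ≠ 0) (h3 : x ^ 2 - q ^ 2 ≠ 0) (h4 : q ^ 2 - X * x ≠ 0)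
    (h5 : x * q ^ 2 - X ≠ 0) (h6 : 1 + q ^ 2 ≠ 0) (h7 : 1 - X * x ≠ 0) (h8 : 1 - X * x⁻¹ ≠ 0)
    (h9 : 1 - s * q / W / X ≠ 0) :
    (T - (x⁻¹ / (a * q) + a * q * x)) *
      (-(x * (1 - s * x * (q / W)) * (1 - s * x * (q * W))) /
        (s * (1 - x ^ 2) * (1 - q ^ 2 * x ^ 2)) * eigCore q W s (x * q ^ 2) X)
    + (T - (x / (a * q) + a * q * x⁻¹)) *
      (-(x⁻¹ * (1 - s * x⁻¹ * (q / W)) * (1 - s * x⁻¹ * (q * W))) /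
        (s * (1 - x⁻¹ ^ 2) * (1 - q ^ 2 * x⁻¹ ^ 2)) * eigCore q W s (x * (q ^ 2)⁻¹) X)
    + (T - (a + a⁻¹) * (x + x⁻¹) / (q⁻¹ + q)) *
      ((-(-(x * (1 - s * x * (q / W)) * (1 - s * x * (q * W))) /
        (s * (1 - x ^ 2) * (1 - q ^ 2 * x ^ 2))) -
        -(x⁻¹ * (1 - s * x⁻¹ * (q / W)) * (1 - s * x⁻¹ * (q * W))) /
        (s * (1 - x⁻¹ ^ 2) * (1 - q ^ 2 * x⁻¹ ^ 2))) * eigCore q W s x X)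
    = (a * W * X + (a * W * X)⁻¹ - (a + a⁻¹) * (s + s⁻¹) / (q⁻¹ + q)) * eigCore q W s x X
      - gCore q W s x X * (T - (a * X / q + q / (a * X))) := by
  -- The term `ν = -1` is the term `ν = 1` at `x⁻¹`.
  have e : eigCore q W s (x * (q ^ 2)⁻¹) X = eigCore q W s (x⁻¹ * q ^ 2) X := by
    rw [← eigCore_inv, mul_inv, inv_inv]
  rw [e, coefA_mul_eigCore hb hq W s h7, coefA_mul_eigCore hb hq W s h8,
    gCore_eq_mul_eigCore hb hq x h9, eigCore_inv, inv_inv]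
  linear_combination eigCore q W s x X *
    contiguous_rational_zero (T := T) hq hW hs hx hX ha h1 h2 h3 h4 h5 h6

theorem coefAminus_mul_eigCore {q : ℂ} (hb : ‖q ^ 2‖ < 1) (hq : q ≠ 0) (W : ℂ) {s x X : ℂ}
    (hs : s ≠ 0) (hX : X ≠ 0) (h : 1 - X * x ≠ 0) :
    eigCore q W (s * (q ^ 2)⁻¹) (x * q ^ 2) X =
        ((1 - s * q / W * x⁻¹ / q ^ 4) * (1 - s * q / W * x⁻¹ / q ^ 2) * (1 - s * q * W * X / q ^ 2) *
          -(s / X) * (1 - X * x) / ((1 - X * x⁻¹ / q ^ 2) * (1 - s * q / W / X / q ^ 2))) *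
        eigCore q W s x X := by
  rw [eigCore_shift_s_neg_x hb hq hs hX, eigCore_eq hb]
  refine eq_of_mul_mul_inv h ?_
  simp only [div_eq_mul_inv, mul_inv]
  ring

theorem contiguous_neg {q W s x X a : ℂ} (T : ℂ) (hb : ‖q ^ 2‖ < 1) (hq : q ≠ 0) (hW : W ≠ 0)
    (hs : s ≠ 0) (hx : x ≠ 0) (hX : X ≠ 0) (ha : a ≠ 0) (h1 : 1 - x ^ 2 ≠ 0)
    (h2 : 1 - q ^ 2 * x ^ 2 ≠ 0) (h3 : x ^ 2 - q ^ 2 ≠ 0) (h4 : q ^ 2 - X * x ≠ 0)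
    (h5 : x * q ^ 2 - X ≠ 0) (h6 : 1 + q ^ 2 ≠ 0) (h7 : 1 - X * x ≠ 0) (h8 : 1 - X * x⁻¹ ≠ 0)
    (h9 : 1 - s * q / W / X ≠ 0) (h10 : W * X * q - s ≠ 0) :
    (T - (x⁻¹ / (a * q) + a * q * x)) *
      (x ^ 2 * q ^ 2 / (s ^ 2 * (1 - x ^ 2) * (1 - q ^ 2 * x ^ 2)) *
        eigCore q W (s * (q ^ 2)⁻¹) (x * q ^ 2) X)
    + (T - (x / (a * q) + a * q * x⁻¹)) *
      (x⁻¹ ^ 2 * q ^ 2 / (s ^ 2 * (1 - x⁻¹ ^ 2) * (1 - q ^ 2 * x⁻¹ ^ 2)) *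
        eigCore q W (s * (q ^ 2)⁻¹) (x * (q ^ 2)⁻¹) X)
    + (T - (a + a⁻¹) * (x + x⁻¹) / (q⁻¹ + q)) *
      (q⁻¹ * (q⁻¹ + q) / (s ^ 2 * (1 - x ^ 2 / q ^ 2) * (1 - 1 / (x ^ 2 * q ^ 2))) *
        eigCore q W (s * (q ^ 2)⁻¹) x X)
    = (a * W * X + (a * W * X)⁻¹ - (a * q / s + s / (a * q))) * eigCore q W s x X
      - gCore q W s x X * (T - (a * X / q + q / (a * X))) := by
  have e : eigCore q W (s * (q ^ 2)⁻¹) (x * (q ^ 2)⁻¹) X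
      = eigCore q W (s * (q ^ 2)⁻¹) (x⁻¹ * q ^ 2) X := by
    rw [← eigCore_inv, mul_inv, inv_inv]
  have e0 : eigCore q W (s * (q ^ 2)⁻¹) x X = ((1 - s * q / W * x / q ^ 2) *
      (1 - s * q / W * x⁻¹ / q ^ 2) * (1 - s * q * W * X / q ^ 2) *
      -(s / X) / (1 - s * q / W / X / q ^ 2)) * eigCore q W s x X := by
    rw [eigCore_shift_s_neg hb hq hs hX, eigCore_eq hb]
    simp only [div_eq_mul_inv, mul_inv]
    ring
  rw [e, e0, coefAminus_mul_eigCore hb hq W hs hX h7, coefAminus_mul_eigCore hb hq W hs hX h8,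
    gCore_eq_mul_eigCore hb hq x h9, eigCore_inv, inv_inv]
  linear_combination eigCore q W s x X *
    contiguous_rational_neg (T := T) hq hW hs hx hX ha h1 h2 h3 h4 h5 h6 h10

theorem coefAplus_mul_eigCore {q : ℂ} (hb : ‖q ^ 2‖ < 1) (hq : q ≠ 0) (W : ℂ) {s x X : ℂ}
    (hs : s ≠ 0) (hX : X ≠ 0) (h : 1 - X * x ≠ 0) :
    (1 - s * x * (q / W)) * (1 - s * x * (q ^ 3 / W)) * (1 - s * x * (q * W)) *
        (1 - s * x * (q ^ 3 * W)) / ((1 - x ^ 2) * (1 - q ^ 2 * x ^ 2)) *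
        eigCore q W (s * q ^ 2) (x * q ^ 2) X
      = (1 - s * q * W * x) * (1 - s * q * W * x * q ^ 2) / ((1 - x ^ 2) * (1 - q ^ 2 * x ^ 2)) *
        (-(X / (s * q ^ 2)) * (1 - X * x) / (1 - X * x⁻¹ / q ^ 2)) *
        ((1 - s * q / W * x) * (1 - s * q / W * x⁻¹) * ((1 - X * x) * (1 - X * x⁻¹))⁻¹ *
          coreBase q W s x X) := by
  have e := eigCore_shift_s_x hb hq hs hX W x
  have e' : (1 - s * x * (q / W)) * (1 - s * x * (q ^ 3 / W)) * (1 - s * x * (q * W)) *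
        (1 - s * x * (q ^ 3 * W)) / ((1 - x ^ 2) * (1 - q ^ 2 * x ^ 2)) *
        eigCore q W (s * q ^ 2) (x * q ^ 2) X
      = (1 - s * x * (q / W)) * (1 - s * x * (q * W)) *
        (1 - s * x * (q ^ 3 * W)) / ((1 - x ^ 2) * (1 - q ^ 2 * x ^ 2)) *
        ((1 - s * q / W * x * q ^ 2) * eigCore q W (s * q ^ 2) (x * q ^ 2) X) := by
    simp only [div_eq_mul_inv, mul_inv]
    ring
  rw [e', e]
  refine eq_of_mul_mul_inv h ?_
  simp only [div_eq_mul_inv, mul_inv]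
  ring

theorem contiguous_pos {q W s x X a : ℂ} (T : ℂ) (hb : ‖q ^ 2‖ < 1) (hq : q ≠ 0) (hW : W ≠ 0)
    (hs : s ≠ 0) (hx : x ≠ 0) (hX : X ≠ 0) (ha : a ≠ 0) (h1 : 1 - x ^ 2 ≠ 0)
    (h2 : 1 - q ^ 2 * x ^ 2 ≠ 0) (h3 : x ^ 2 - q ^ 2 ≠ 0) (h4 : q ^ 2 - X * x ≠ 0)
    (h5 : x * q ^ 2 - X ≠ 0) (h6 : 1 + q ^ 2 ≠ 0) (h7 : 1 - X * x ≠ 0) (h8 : 1 - X * x⁻¹ ≠ 0)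
    (h9 : 1 - s * q / W / X ≠ 0) :
    (T - (x⁻¹ / (a * q) + a * q * x)) *
      ((1 - s * x * (q / W)) * (1 - s * x * (q ^ 3 / W)) * (1 - s * x * (q * W)) *
        (1 - s * x * (q ^ 3 * W)) / ((1 - x ^ 2) * (1 - q ^ 2 * x ^ 2)) *
        eigCore q W (s * q ^ 2) (x * q ^ 2) X)
    + (T - (x / (a * q) + a * q * x⁻¹)) *
      ((1 - s * x⁻¹ * (q / W)) * (1 - s * x⁻¹ * (q ^ 3 / W)) * (1 - s * x⁻¹ * (q * W)) *
        (1 - s * x⁻¹ * (q ^ 3 * W)) / ((1 - x⁻¹ ^ 2) * (1 - q ^ 2 * x⁻¹ ^ 2)) *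
        eigCore q W (s * q ^ 2) (x * (q ^ 2)⁻¹) X)
    + (T - (a + a⁻¹) * (x + x⁻¹) / (q⁻¹ + q)) *
      (q⁻¹ * (q⁻¹ + q) * (1 - s * x * (q / W)) * (1 - s / x * (q / W)) * (1 - s * x * (q * W)) *
        (1 - s / x * (q * W)) / ((1 - x ^ 2 / q ^ 2) * (1 - 1 / (x ^ 2 * q ^ 2))) *
        eigCore q W (s * q ^ 2) x X)
    = (a * W * X + (a * W * X)⁻¹ - (a * q * s + (a * q * s)⁻¹)) * eigCore q W s x X
      - gCore q W s x X * (T - (a * X / q + q / (a * X))) := by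
  have e : eigCore q W (s * q ^ 2) (x * (q ^ 2)⁻¹) X
      = eigCore q W (s * q ^ 2) (x⁻¹ * q ^ 2) X := by
    rw [← eigCore_inv, mul_inv, inv_inv]
  have h9' : W * X - s * q ≠ 0 := by
    intro h
    apply h9
    rw [div_div, ← sub_eq_zero.1 h, div_self (mul_ne_zero hW hX), sub_self]
  -- After a positive shift of `s` the functions are not multiples of the unshifted eigenfunction,
  -- which contains the extra factor `1 - s q W X`. All terms are therefore compared with `K`, where
  -- this factor is omitted.
  set K := (1 - s * q / W * x) * (1 - s * q / W * x⁻¹) * ((1 - X * x) * (1 - X * x⁻¹))⁻¹ *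
    coreBase q W s x X with hK
  have e0 : q⁻¹ * (q⁻¹ + q) * (1 - s * x * (q / W)) * (1 - s / x * (q / W)) *
      (1 - s * x * (q * W)) * (1 - s / x * (q * W)) /
      ((1 - x ^ 2 / q ^ 2) * (1 - 1 / (x ^ 2 * q ^ 2))) * eigCore q W (s * q ^ 2) x X
      = (q⁻¹ * (q⁻¹ + q) * (1 - s * q * W * x) * (1 - s * q * W * x⁻¹) /
        ((1 - x ^ 2 / q ^ 2) * (1 - 1 / (x ^ 2 * q ^ 2))) * -(X / (s * q ^ 2))) * K := by
    rw [eigCore_shift_s hb hq hs hX, hK]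
    simp only [div_eq_mul_inv, mul_inv]
    ring
  have e1 : eigCore q W s x X = (1 - s * q * W * X) / (1 - s * q / W / X) * K := by
    rw [eigCore_eq hb, hK]
    simp only [div_eq_mul_inv, mul_inv]
    ring
  have e2 : gCore q W s x X = X * (1 - s * q * W * X / q ^ 2) * (1 - s * q * W * X) /
        (s * q ^ 2 * (1 - X * x / q ^ 2) * (1 - X * x⁻¹ / q ^ 2)) * K := by
    rw [gCore_eq hb hq, hK]
    simp only [div_eq_mul_inv, mul_inv]
    ring
  have e3 : (1 - s * q / W * x⁻¹) * (1 - s * q / W * x⁻¹⁻¹) *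
      ((1 - X * x⁻¹) * (1 - X * x⁻¹⁻¹))⁻¹ * coreBase q W s x⁻¹ X = K := by
    rw [coreBase_inv, inv_inv, hK]
    ring
  rw [e, e0, e1, e2, coefAplus_mul_eigCore hb hq W hs hX h7,
    coefAplus_mul_eigCore hb hq W hs hX h8, e3, ← hK, inv_inv]
  linear_combination K *
    contiguous_rational_pos (T := T) hq hW hs hx hX ha h1 h2 h3 h4 h5 h6 h9'

end AWOverlap

end

/-! ### The contiguous relation for the integrands, up to a `q²`-difference. -/

noncomputable section

namespace AWOverlap

open Complex Set

/-- The coefficient `A` or `B` for one variable, with `m = ν_{i+1}` and `ν = ν_i`. -/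
def coefStep (q : ℝ) (m ν : ℤ) (s : ℂ) (lam : ℝ) (x : ℂ) : ℂ :=
  if ν ≠ 0 then selA q m s lam (x ^ ν) else selB q m s lam x

/-- The product form is expanded so that `t` enters only through `t + t⁻¹`, as the rational
identities require. The right side of the contiguous relation has the same shape, with `y` and `s`
in place of `t` and `x`. -/
theorem coefFirst_of_ne_zero (q : ℝ) {u t v x : ℂ} (hq : (q : ℂ) ≠ 0) (hu : u ≠ 0) (ht : t ≠ 0)
    (hv : v ≠ 0) (hx : x ≠ 0) {m : ℤ} (hm : m ≠ 0) :
    coefFirst q u t v x m = ((q : ℂ)⁻¹ - q)⁻¹ *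
      (t + t⁻¹ - ((x ^ m)⁻¹ / (v / u * q) + v / u * q * x ^ m)) := by
  have hX : x ^ m ≠ 0 := zpow_ne_zero m hx
  rw [coefFirst, if_pos hm, zpow_neg, div_eq_mul_inv _ ((q : ℂ)⁻¹ - q)]
  set k := ((q : ℂ)⁻¹ - q)⁻¹
  field_simp
  ring

theorem coefFirst_zero {q : ℝ} (hq0 : 0 < q) (u t v x : ℂ) :
    coefFirst q u t v x 0 = ((q : ℂ)⁻¹ - q)⁻¹ *
      (t + t⁻¹ - (v / u + (v / u)⁻¹) * (x + x⁻¹) / ((q : ℂ)⁻¹ + q)) := by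
  have h6 : (q : ℂ)⁻¹ + q ≠ 0 := by exact_mod_cast (by positivity : (q⁻¹ + q) ≠ 0)
  rw [coefFirst, if_neg (by simp), ← inv_pow, sq_sub_sq, inv_div]
  rw [div_mul_eq_div_div, sub_div, mul_div_cancel_left₀ _ h6]
  ring

section Pointwise

variable {q : ℝ} {s u t v : ℂ} {lam : ℝ} {x y z : ℂ}

/-- The function whose `q²`-difference is the contiguous relation of the integrands. -/
def primitive (q : ℝ) (s u t v : ℂ) (lam : ℝ) (x y z : ℂ) : ℂ :=
  gCore q (((q : ℂ) ^ (I * lam)) ^ 2) s x (u * z / (q : ℂ) ^ (I * lam)) *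
    gDual q (((q : ℂ) ^ (I * lam)) ^ 2)⁻¹ t y (v * z * (q : ℂ) ^ (I * lam)) / z

/-- With `Y = v z q^{iλ}`, the shifted term `q² P(q² z)` is `Y + Y⁻¹ - y - y⁻¹` times the integrand,
and `P(z)` is the `gCore` term of the hypothesis. Adding the two replaces the eigenvalue `Y + Y⁻¹`
by `y + y⁻¹`. The constant `d` is arbitrary because it is different for each `m`. -/
theorem primitive_sub (hq0 : 0 < q) (hq1 : q < 1) (hs : s ≠ 0) (hu : u ≠ 0) (ht : t ≠ 0)
    (hv : v ≠ 0) (hy : y ≠ 0) (hz : z ≠ 0) (hzi : z ∉ innerPoles q s u t v lam)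
    (hzo : z ∉ outerPoles q u v lam x y) (d : ℂ) {C : ℂ}
    (h : C = (v * z * (q : ℂ) ^ (I * lam) + (v * z * (q : ℂ) ^ (I * lam))⁻¹ - d) *
        eigCore q (((q : ℂ) ^ (I * lam)) ^ 2) s x (u * z / (q : ℂ) ^ (I * lam))
      - gCore q (((q : ℂ) ^ (I * lam)) ^ 2) s x (u * z / (q : ℂ) ^ (I * lam)) *
        (t + t⁻¹ - (v / u * (u * z / (q : ℂ) ^ (I * lam)) / q +
          q / (v / u * (u * z / (q : ℂ) ^ (I * lam)))))) :
    C * eigFn q t v (-lam) 0 y z / z = (y + y⁻¹ - d) * integrand q s u t v lam x y z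
      + ((q : ℂ) ^ 2 * primitive q s u t v lam x y ((q : ℂ) ^ 2 * z)
        - primitive q s u t v lam x y z) := by
  have hb := norm_ofReal_sq_lt_one hq0 hq1
  have hq' : (q : ℂ) ≠ 0 := by exact_mod_cast hq0.ne'
  have hw := cpow_I_ne_zero hq0 lam
  have hy1 : 1 - v * z * (q : ℂ) ^ (I * lam) * y ≠ 0 := fun h => hzo ⟨0, by
    right; right; right
    rw [cpow_neg_I, mul_zero, pow_zero, inv_one, mul_one]
    field_simp
    linear_combination -h⟩
  have hy2 : 1 - v * z * (q : ℂ) ^ (I * lam) * y⁻¹ ≠ 0 := fun h => hzo ⟨0, by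
    right; right; left
    rw [cpow_neg_I, mul_zero, pow_zero, inv_one, mul_one]
    field_simp
    field_simp at h
    linear_combination -h⟩
  have ht1 : 1 - t * q / (((q : ℂ) ^ (I * lam)) ^ 2)⁻¹ / (v * z * (q : ℂ) ^ (I * lam)) ≠ 0 :=
    fun h => hzi ⟨0, by
      right
      rw [cpow_one_add_I hq0, mul_zero, pow_zero, mul_one]
      field_simp
      field_simp at h
      linear_combination h⟩
  rw [h, integrand, eigFn_eq_eigCore hq0 lam s, eigFn_neg_eq_eigCore hq0, primitive, primitive]
  set w := (q : ℂ) ^ (I * lam)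
  have hX : u * z / w ≠ 0 := by positivity
  have hY : v * z * w ≠ 0 := by positivity
  rw [show u * ((q : ℂ) ^ 2 * z) / w = u * z / w * q ^ 2 by ring,
    show v * ((q : ℂ) ^ 2 * z) * w = v * z * w * q ^ 2 by ring, gCore_shift hb hq' hs hX,
    gDual_shift hb hq' ht hY _ hy1 hy2, gDual_eq hb hq' y ht1]
  set K := eigCore q (w ^ 2) s x (u * z / w)
  set g := gCore q (w ^ 2) s x (u * z / w)
  set p := eigCore q (w ^ 2)⁻¹ t y (v * z * w)
  field_simp
  ring

theorem integrand_contiguous (hq0 : 0 < q) (hq1 : q < 1) (hs : s ≠ 0) (hu : u ≠ 0) (ht : t ≠ 0)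
    (hv : v ≠ 0) (hx : x ≠ 0) (hy : y ≠ 0) (h1 : x ^ 2 ≠ 1) (h2 : x ^ 2 ≠ (q : ℂ) ^ 2)
    (h3 : x ^ 2 ≠ ((q : ℂ) ^ 2)⁻¹) (hz : z ≠ 0) {m : ℤ} (hm : m ∈ ({-1, 0, 1} : Finset ℤ))
    (hzi : ∀ m' ∈ ({0, m} : Finset ℤ), z ∉ innerPoles q (s * (q : ℂ) ^ (2 * m')) u t v lam)
    (hzo : ∀ ν ∈ ({-1, 0, 1} : Finset ℤ), z ∉ outerPoles q u v lam (x * (q : ℂ) ^ (2 * ν)) y) :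
    ∑ ν ∈ ({-1, 0, 1} : Finset ℤ), coefFirst q u t v x ν * coefStep q m ν s lam x *
        integrand q (s * (q : ℂ) ^ (2 * m)) u t v lam (x * (q : ℂ) ^ (2 * ν)) y z
      = coefFirst q u y v s m * integrand q s u t v lam x y z
        + ((q : ℂ)⁻¹ - q)⁻¹ * ((q : ℂ) ^ 2 * primitive q s u t v lam x y ((q : ℂ) ^ 2 * z)
        - primitive q s u t v lam x y z) := by
  have hb := norm_ofReal_sq_lt_one hq0 hq1
  have hq' : (q : ℂ) ≠ 0 := by exact_mod_cast hq0.ne'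
  have h6 : 1 + (q : ℂ) ^ 2 ≠ 0 := by exact_mod_cast (by positivity : (1 + q ^ 2) ≠ 0)
  have hw := cpow_I_ne_zero hq0 lam
  have h1' : 1 - x ^ 2 ≠ 0 := sub_ne_zero.2 h1.symm
  have h2' : x ^ 2 - (q : ℂ) ^ 2 ≠ 0 := sub_ne_zero.2 h2
  have h3' : 1 - (q : ℂ) ^ 2 * x ^ 2 ≠ 0 := fun h => h3 (by
    field_simp
    linear_combination -h)
  have hi0 : z ∉ innerPoles q s u t v lam := by simpa using hzi 0 (by simp)
  have ho0 : z ∉ outerPoles q u v lam x y := by simpa using hzo 0 (by simp)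
  have ho1 := hzo 1 (by simp)
  have ho2 := hzo (-1) (by simp)
  have z1 : (q : ℂ) ^ (2 * (1 : ℤ)) = (q : ℂ) ^ 2 := by norm_cast
  have z2 : (q : ℂ) ^ (2 * (-1 : ℤ)) = ((q : ℂ) ^ 2)⁻¹ := by rw [mul_neg, zpow_neg, z1]
  rw [z1] at ho1
  rw [z2] at ho2
  have a1 : 1 - u * z / (q : ℂ) ^ (I * lam) * x ≠ 0 := fun h => ho0 ⟨0, by
    right; left
    rw [mul_zero, pow_zero, inv_one, mul_one]
    field_simp
    field_simp at h
    linear_combination -h⟩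
  have a2 : 1 - u * z / (q : ℂ) ^ (I * lam) * x⁻¹ ≠ 0 := fun h => ho0 ⟨0, by
    left
    rw [mul_zero, pow_zero, inv_one, mul_one]
    field_simp
    field_simp at h
    linear_combination -h⟩
  -- The denominators with `q²` vanish at poles of the eigenfunctions shifted in `x`, so `z` has to
  -- avoid the poles for all three values of `ν`.
  have a3 : (q : ℂ) ^ 2 - u * z / (q : ℂ) ^ (I * lam) * x ≠ 0 := fun h => ho2 ⟨0, by
    right; left
    rw [mul_zero, pow_zero, inv_one, mul_one]
    field_simp
    field_simp at h
    linear_combination -h⟩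
  have a4 : x * (q : ℂ) ^ 2 - u * z / (q : ℂ) ^ (I * lam) ≠ 0 := fun h => ho1 ⟨0, by
    left
    rw [mul_zero, pow_zero, inv_one, mul_one]
    field_simp
    field_simp at h
    linear_combination -h⟩
  have a5 : 1 - s * q / ((q : ℂ) ^ (I * lam)) ^ 2 / (u * z / (q : ℂ) ^ (I * lam)) ≠ 0 :=
    fun h => hi0 ⟨0, by
      left
      rw [cpow_one_sub_I hq0, mul_zero, pow_zero, mul_one]
      field_simp
      field_simp at h
      linear_combination h⟩
  have ha : v / u ≠ 0 := div_ne_zero hv hu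
  have hX : u * z / (q : ℂ) ^ (I * lam) ≠ 0 := by positivity
  -- With `a = v / u` the product `a W X` is the variable of the second eigenfunction.
  have hY : v / u * ((q : ℂ) ^ (I * lam)) ^ 2 * (u * z / (q : ℂ) ^ (I * lam))
      = v * z * (q : ℂ) ^ (I * lam) := by field_simp
  have hsum : ∀ f : ℤ → ℂ, ∑ ν ∈ ({-1, 0, 1} : Finset ℤ), f ν = f 1 + f (-1) + f 0 := by
    intro f
    rw [Finset.sum_insert (by simp), Finset.sum_insert (by simp), Finset.sum_singleton]
    ring
  have one_ne : (1 : ℤ) ≠ 0 := one_ne_zero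
  have neg_one_ne : (-1 : ℤ) ≠ 0 := by decide
  rw [hsum, coefFirst_of_ne_zero q hq' hu ht hv hx one_ne,
    coefFirst_of_ne_zero q hq' hu ht hv hx neg_one_ne, coefFirst_zero hq0]
  have hI : ∀ s' x', integrand q s' u t v lam x' y z = eigCore q (((q : ℂ) ^ (I * lam)) ^ 2) s' x'
      (u * z / (q : ℂ) ^ (I * lam)) * eigFn q t v (-lam) 0 y z / z := fun s' x' => by
    rw [integrand, eigFn_eq_eigCore hq0 lam s' u x' z]
  have neg_one_ne_one : (1 : ℤ) ≠ -1 := by decide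
  have z0 : (q : ℂ) ^ (2 : ℤ) = (q : ℂ) ^ 2 := zpow_ofNat _ 2
  simp only [coefStep, one_ne, neg_one_ne, ne_eq, not_true_eq_false, not_false_eq_true, if_true,
    if_false, zpow_one, zpow_neg_one, z0, z2, mul_zero, zpow_zero, mul_one, inv_inv, hI]
  fin_cases hm
  -- The vanishing of this denominator would make `z` an inner pole for `s` shifted by `q⁻²`, which
  -- is why `m` itself occurs in `hzi`.
  · have a6 : ((q : ℂ) ^ (I * lam)) ^ 2 * (u * z / (q : ℂ) ^ (I * lam)) * q - s ≠ 0 :=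
      fun h => hzi (-1) (by simp) ⟨0, by
        left
        rw [cpow_one_sub_I hq0, mul_zero, pow_zero, mul_one, z2]
        field_simp
        field_simp at h
        linear_combination h⟩
    have c := contiguous_neg (t + t⁻¹) hb hq' (pow_ne_zero 2 hw) hs hx hX ha h1' h3' h2' a3 a4 h6
      a1 a2 a5 a6
    rw [hY] at c
    have c' := primitive_sub hq0 hq1 hs hu ht hv hy hz hi0 ho0 _ c
    rw [coefFirst_of_ne_zero q hq' hu hy hv hs neg_one_ne]
    rw [hI] at c'
    simp only [selA, selB, if_true, coefAminus, coefBminus, z2, zpow_neg_one, inv_inv]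
    linear_combination ((q : ℂ)⁻¹ - q)⁻¹ * c'
  · have c := contiguous_zero (t + t⁻¹) hb hq' (pow_ne_zero 2 hw) hs hx hX ha h1' h3' h2' a3 a4 h6
      a1 a2 a5
    rw [hY] at c
    have c' := primitive_sub hq0 hq1 hs hu ht hv hy hz hi0 ho0 _ c
    rw [coefFirst_zero hq0]
    rw [hI] at c'
    simp only [selA, selB, if_true, if_false, neg_one_ne.symm, coefA, coefB,
      zpow_zero, mul_zero, mul_one, cpow_one_sub_two_I hq0, cpow_one_add_two_I hq0]
    linear_combination ((q : ℂ)⁻¹ - q)⁻¹ * c'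
  · have c := contiguous_pos (t + t⁻¹) hb hq' (pow_ne_zero 2 hw) hs hx hX ha h1' h3' h2' a3 a4 h6
      a1 a2 a5
    rw [hY] at c
    have c' := primitive_sub hq0 hq1 hs hu ht hv hy hz hi0 ho0 _ c
    rw [coefFirst_of_ne_zero q hq' hu hy hv hs one_ne]
    rw [hI] at c'
    simp only [selA, selB, if_false, one_ne, neg_one_ne_one]
    simp only [coefAplus, coefBplus]
    simp only [z1, zpow_one]
    simp only [cpow_one_sub_two_I hq0, cpow_one_add_two_I hq0]
    simp only [cpow_three_sub_two_I hq0,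
      cpow_three_add_two_I hq0]
    linear_combination ((q : ℂ)⁻¹ - q)⁻¹ * c'

end Pointwise

end AWOverlap

end

/-! ### The contiguous relation for the univariate overlap coefficients. -/

noncomputable section

namespace AWOverlap

open Complex Set

variable {q : ℝ} {s u t v : ℂ} {lam : ℝ} {x y : ℂ}

/-- Compared with the integrand, the outer poles belonging to `x` begin one step `q²` closer to `0`,
and the first pole of each inner sequence is missing. The set `P` is left open so that it can be
described by the winding numbers at hand. -/
theorem isFactored_primitive (hq0 : 0 < q) (hq1 : q < 1) (hs : s ≠ 0) (hu : u ≠ 0) (ht : t ≠ 0)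
    (hv : v ≠ 0) (hx : x ≠ 0) (hy : y ≠ 0) {P : Set ℂ}
    (hP₁ : ∀ k : ℕ, u⁻¹ * (q : ℂ) ^ (I * lam) * x⁻¹ * q ^ 2 * ((q : ℂ) ^ (2 * k))⁻¹ ∈ P)
    (hP₂ : ∀ k : ℕ, u⁻¹ * (q : ℂ) ^ (I * lam) * x * q ^ 2 * ((q : ℂ) ^ (2 * k))⁻¹ ∈ P)
    (hP₃ : ∀ k : ℕ, v⁻¹ * (q : ℂ) ^ (-(I * lam)) * y⁻¹ * ((q : ℂ) ^ (2 * k))⁻¹ ∈ P)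
    (hP₄ : ∀ k : ℕ, v⁻¹ * (q : ℂ) ^ (-(I * lam)) * y * ((q : ℂ) ^ (2 * k))⁻¹ ∈ P)
    (hP₅ : ∀ k : ℕ, u⁻¹ * s * (q : ℂ) ^ (1 - I * lam) * (q : ℂ) ^ (2 * (k + 1)) ∈ P)
    (hP₆ : ∀ k : ℕ, v⁻¹ * t * (q : ℂ) ^ (1 + I * lam) * (q : ℂ) ^ (2 * (k + 1)) ∈ P) (r R : ℝ)
    (hr : 0 < r) : IsFactored P r R (primitive q s u t v lam x y) := by
  have hb := norm_ofReal_sq_lt_one hq0 hq1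
  have hq' : (q : ℂ) ≠ 0 := by exact_mod_cast hq0.ne'
  have hw := cpow_I_ne_zero hq0 lam
  have hz0 : ∀ z ∈ annulus r R, z ≠ 0 := fun z hz => norm_pos_iff.1 (hr.trans hz.1)
  simp only [cpow_neg_I, cpow_one_sub_I hq0, cpow_one_add_I hq0] at *
  set w := (q : ℂ) ^ (I * lam) with hwdef
  have hN : DifferentiableOn ℂ (fun z => (u * z / w / (s * q ^ 2) * (qPoch (s * q / w ^ 2 * x)
      (q ^ 2) * qPoch (s * q / w ^ 2 * x⁻¹) (q ^ 2) *
      qPoch (s * q * w ^ 2 * (u * z / w) / q ^ 2) (q ^ 2) *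
      qTheta (u * z / w / s) (q ^ 2))) * (t⁻¹ * (qPoch (t * q / (w ^ 2)⁻¹ * y) (q ^ 2) *
      qPoch (t * q / (w ^ 2)⁻¹ * y⁻¹) (q ^ 2) *
      qPoch (t * q * (w ^ 2)⁻¹ * (v * z * w) / q ^ 2) (q ^ 2) *
      qTheta (v * z * w / t) (q ^ 2))) * z⁻¹) (annulus r R) := by
    refine DifferentiableOn.mul (DifferentiableOn.mul (DifferentiableOn.mul (by fun_prop) ?_)
      (DifferentiableOn.mul (differentiableOn_const _) ?_)) (differentiableOn_id.fun_inv hz0)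
    · refine (((differentiableOn_const _).mul (differentiableOn_const _)).mul
        ((differentiable_qPoch hb).comp_differentiableOn (by fun_prop))).mul
        (differentiableOn_qTheta hb (by fun_prop) fun z hz => ?_)
      have := hz0 z hz
      positivity
    · refine (((differentiableOn_const _).mul (differentiableOn_const _)).mul
        ((differentiable_qPoch hb).comp_differentiableOn (by fun_prop))).mul
        (differentiableOn_qTheta hb (by fun_prop) fun z hz => ?_)
      have := hz0 z hz
      positivity
  have key := isFactored_div_qPoch (P := P)
    hr R hb (pow_ne_zero 2 hq') hN (a₁ := u / w * x / q ^ 2) (a₂ := u / w * x⁻¹ / q ^ 2)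
    (a₃ := v * w * y) (a₄ := v * w * y⁻¹) (c₁ := s * q * q ^ 2 / (w * u))
    (c₂ := t * q * w * q ^ 2 / v) (by positivity)
    (by positivity) (by positivity) (by positivity)
    (fun k => by
      convert hP₁ k using 1
      rw [pow_mul]
      field_simp)
    (fun k => by
      convert hP₂ k using 1
      rw [pow_mul]
      field_simp)
    (fun k => by
      convert hP₃ k using 1
      rw [pow_mul]
      field_simp)
    (fun k => by
      convert hP₄ k using 1
      rw [pow_mul]
      field_simp)
    (fun k => by
      convert hP₅ k using 1
      rw [pow_mul]
      field_simp
      ring)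
    (fun k => by
      convert hP₆ k using 1
      rw [pow_mul]
      field_simp
      ring)
  refine key.congr fun z hz => ?_
  have hz := hz0 z hz
  rw [primitive, ← hwdef, gCore, gDual,
    show u * z / w * x / q ^ 2 = u / w * x / q ^ 2 * z by ring,
    show u * z / w * x⁻¹ / q ^ 2 = u / w * x⁻¹ / q ^ 2 * z by ring,
    show v * z * w * y = v * w * y * z by ring, show v * z * w * y⁻¹ = v * w * y⁻¹ * z by ring,
    show s * q / w ^ 2 / (u * z / w) * q ^ 2 = s * q * q ^ 2 / (w * u) / z by field_simp,
    show t * q / (w ^ 2)⁻¹ / (v * z * w) * q ^ 2 = t * q * w * q ^ 2 / v / z by field_simp]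
  simp only [div_eq_mul_inv, mul_inv]
  ring

/-- The primitive has the same integral over `γ` and over `q² γ`. -/
theorem Admissible.integral_primitive {γ : Contour} (h : Admissible q s u t v lam x y γ)
    (h1 : Admissible q s u t v lam (x * q ^ 2) y γ)
    (h2 : Admissible q s u t v lam (x * ((q : ℂ) ^ 2)⁻¹) y γ) (hq0 : 0 < q) (hq1 : q < 1)
    (hs : s ≠ 0) (hu : u ≠ 0) (ht : t ≠ 0) (hv : v ≠ 0) (hx : x ≠ 0) (hy : y ≠ 0) :
    ContinuousOn (primitive q s u t v lam x y) (γ.toFun '' Icc 0 1) ∧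
    ContinuousOn (fun z => (q : ℂ) ^ 2 * primitive q s u t v lam x y ((q : ℂ) ^ 2 * z))
      (γ.toFun '' Icc 0 1) ∧
    γ.integral (fun z => (q : ℂ) ^ 2 * primitive q s u t v lam x y ((q : ℂ) ^ 2 * z))
      = γ.integral (primitive q s u t v lam x y) := by
  have hq' : (q : ℂ) ≠ 0 := by exact_mod_cast hq0.ne'
  have hq2 : (q : ℂ) ^ 2 ≠ 0 := pow_ne_zero 2 hq'
  -- A point `q² p` lies in `P` as soon as `p` and `q² p` are on the same side of `γ`, because the
  -- scaled curve winds around `q² p` as `γ` does around `p`. Every pole of the primitive is of this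
  -- form.
  set P : Set ℂ := {p | γ.SameWinding (γ.scale ((q : ℂ) ^ 2)) p} with hP
  have hin : ∀ p, γ.Inside ((q : ℂ) ^ 2 * p) → γ.Inside p → (q : ℂ) ^ 2 * p ∈ P :=
    fun p h h' => h.sameWinding (h'.scale hq2)
  have hout : ∀ p, γ.Outside ((q : ℂ) ^ 2 * p) → γ.Outside p → (q : ℂ) ^ 2 * p ∈ P :=
    fun p h h' => h.sameWinding (h'.scale hq2)
  have hF : ∀ r R, 0 < r → IsFactored P r R (primitive q s u t v lam x y) := by
    refine isFactored_primitive hq0 hq1 hs hu ht hv hx hy (fun k => ?_) (fun k => ?_)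
      (fun k => ?_) (fun k => ?_) (fun k => ?_) (fun k => ?_)
    · convert hout (u⁻¹ * (q : ℂ) ^ (I * lam) * x⁻¹ * ((q : ℂ) ^ (2 * k))⁻¹) ?_ ?_ using 1
      · ring
      -- The extra pole of this sequence, one step closer to `0`, is an outer pole for the parameter
      -- `x q⁻²`. For the sequence with `x` in place of `x⁻¹` the parameter is `x q²`.
      · refine h2.2.2 _ ⟨k, Or.inr (Or.inl ?_)⟩
        rw [mul_inv, inv_inv]
        ring
      · exact h.2.2 _ ⟨k, Or.inr (Or.inl rfl)⟩
    · convert hout (u⁻¹ * (q : ℂ) ^ (I * lam) * x * ((q : ℂ) ^ (2 * k))⁻¹) ?_ ?_ using 1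
      · ring
      · refine h1.2.2 _ ⟨k, Or.inl ?_⟩
        ring
      · exact h.2.2 _ ⟨k, Or.inl rfl⟩
    · convert hout (v⁻¹ * (q : ℂ) ^ (-(I * lam)) * y⁻¹ * ((q : ℂ) ^ (2 * (k + 1)))⁻¹) ?_ ?_ using 1
      · rw [mul_add, pow_add]
        field_simp
      · refine h.2.2 _ ⟨k, Or.inr (Or.inr (Or.inr ?_))⟩
        rw [mul_add, pow_add]
        field_simp
        ring
      · exact h.2.2 _ ⟨k + 1, Or.inr (Or.inr (Or.inr rfl))⟩
    · convert hout (v⁻¹ * (q : ℂ) ^ (-(I * lam)) * y * ((q : ℂ) ^ (2 * (k + 1)))⁻¹) ?_ ?_ using 1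
      · rw [mul_add, pow_add]
        field_simp
      · refine h.2.2 _ ⟨k, Or.inr (Or.inr (Or.inl ?_))⟩
        rw [mul_add, pow_add]
        field_simp
        ring
      · exact h.2.2 _ ⟨k + 1, Or.inr (Or.inr (Or.inl rfl))⟩
    · convert hin (u⁻¹ * s * (q : ℂ) ^ (1 - I * lam) * (q : ℂ) ^ (2 * k)) ?_ ?_ using 1
      · ring
      · refine h.2.1 _ ⟨k + 1, Or.inl ?_⟩
        ring
      · exact h.2.1 _ ⟨k, Or.inl rfl⟩
    · convert hin (v⁻¹ * t * (q : ℂ) ^ (1 + I * lam) * (q : ℂ) ^ (2 * k)) ?_ ?_ using 1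
      · ring
      · refine h.2.1 _ ⟨k + 1, Or.inr ?_⟩
        ring
      · exact h.2.1 _ ⟨k, Or.inr rfl⟩
  have h0 : γ.SameWinding (γ.scale ((q : ℂ) ^ 2)) 0 :=
    h.1.sameWinding (by simpa using h.1.scale hq2)
  refine ⟨Contour.continuousOn_of_isFactored h0.1 (fun p hp => hp.1) hF, ?_, ?_⟩
  · have hc := Contour.continuousOn_of_isFactored (γ := γ.scale ((q : ℂ) ^ 2)) h0.2.1
      (fun p hp => hp.2.1) hF
    refine continuousOn_const.mul (hc.comp (by fun_prop) ?_)
    rintro _ ⟨τ, hτ, rfl⟩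
    exact ⟨τ, hτ, rfl⟩
  -- The substitution `z ↦ q² z` turns the left side into the integral of the primitive over the
  -- scaled curve.
  · rw [← Contour.integral_scale, Contour.integral_eq_of_sameWinding h0 (fun p hp => hp) hF]

theorem Contour.integral_sum (γ : Contour) {ι : Type*} (S : Finset ι) {F : ι → ℂ → ℂ}
    (hF : ∀ i ∈ S, ContinuousOn (F i) (γ.toFun '' Icc 0 1)) :
    γ.integral (fun z => ∑ i ∈ S, F i z) = ∑ i ∈ S, γ.integral (F i) := by
  simp only [Contour.integral, Finset.sum_mul]
  exact intervalIntegral.integral_finsetSum fun i hi => γ.intervalIntegrable (hF i hi)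

/-- The contiguous relation for the univariate overlap coefficients. -/
theorem overlap1_contiguous (hq0 : 0 < q) (hq1 : q < 1) (hs : s ≠ 0) (hu : u ≠ 0) (ht : t ≠ 0)
    (hv : v ≠ 0) (hx : x ≠ 0) (hy : y ≠ 0) (h1 : x ^ 2 ≠ 1) (h2 : x ^ 2 ≠ (q : ℂ) ^ 2)
    (h3 : x ^ 2 ≠ ((q : ℂ) ^ 2)⁻¹) {m : ℤ} (hm : m ∈ ({-1, 0, 1} : Finset ℤ))
    (hd : ∀ m' ∈ ({0, m} : Finset ℤ), ∀ ν ∈ ({-1, 0, 1} : Finset ℤ),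
      Disjoint (innerPoles q (s * (q : ℂ) ^ (2 * m')) u t v lam)
        (outerPoles q u v lam (x * (q : ℂ) ^ (2 * ν)) y)) :
    ∑ ν ∈ ({-1, 0, 1} : Finset ℤ), coefFirst q u t v x ν * (coefStep q m ν s lam x *
        overlap1 q (s * (q : ℂ) ^ (2 * m)) u t v lam 0 (x * (q : ℂ) ^ (2 * ν)) y)
      = coefFirst q u y v s m * overlap1 q s u t v lam 0 x y := by
  classical
  have hq' : (q : ℂ) ≠ 0 := by exact_mod_cast hq0.ne'
  have hqz : ∀ n : ℤ, (q : ℂ) ^ n ≠ 0 := fun n => zpow_ne_zero n hq'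
  -- One curve that is admissible for all shifted coefficients, so that the pointwise relation can
  -- be integrated term by term.
  obtain ⟨γ, hγ⟩ := exists_admissible hq0 hq1 (t := t) lam hu hv hy
    (({0, m} : Finset ℤ).image fun m' => s * (q : ℂ) ^ (2 * m'))
    (({-1, 0, 1} : Finset ℤ).image fun ν => x * (q : ℂ) ^ (2 * ν))
    (by
      intro x' hx'
      obtain ⟨ν, -, rfl⟩ := Finset.mem_image.1 hx'
      exact mul_ne_zero hx (hqz _))
    (by
      intro s' hs' x' hx'
      obtain ⟨ν, hν, rfl⟩ := Finset.mem_image.1 hx'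
      obtain ⟨m', hm', rfl⟩ := Finset.mem_image.1 hs'
      exact hd m' hm' ν hν)
  have hadm : ∀ m' ∈ ({0, m} : Finset ℤ), ∀ ν ∈ ({-1, 0, 1} : Finset ℤ),
      Admissible q (s * (q : ℂ) ^ (2 * m')) u t v lam (x * (q : ℂ) ^ (2 * ν)) y γ :=
    fun m' hm' ν hν => hγ _ (Finset.mem_image_of_mem _ hm') _ (Finset.mem_image_of_mem _ hν)
  have z1 : (q : ℂ) ^ (2 * (1 : ℤ)) = (q : ℂ) ^ 2 := by norm_cast
  have z2 : (q : ℂ) ^ (2 * (-1 : ℤ)) = ((q : ℂ) ^ 2)⁻¹ := by rw [mul_neg, zpow_neg, z1]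
  have A0 : Admissible q s u t v lam x y γ := by simpa using hadm 0 (by simp) 0 (by simp)
  have A1 : Admissible q s u t v lam (x * (q : ℂ) ^ 2) y γ := by
    have := hadm 0 (by simp) 1 (by simp)
    rwa [z1, mul_zero, zpow_zero, mul_one] at this
  have A2 : Admissible q s u t v lam (x * ((q : ℂ) ^ 2)⁻¹) y γ := by
    have := hadm 0 (by simp) (-1) (by simp)
    rwa [z2, mul_zero, zpow_zero, mul_one] at this
  obtain ⟨c1, c2, hint⟩ := A0.integral_primitive A1 A2 hq0 hq1 hs hu ht hv hx hy
  have hpt : ∀ z ∈ γ.toFun '' Icc 0 1, _ = _ := fun z hz =>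
    integrand_contiguous (z := z) hq0 hq1 hs hu ht hv hx hy h1 h2 h3
      (fun h => Contour.notMem_image A0.1.1 (h ▸ hz)) hm
      (fun m' hm' h => Contour.notMem_image ((hadm m' hm' 0 (by simp)).2.1 z h).1 hz)
      (fun ν hν h => Contour.notMem_image ((hadm 0 (by simp) ν hν).2.2 z h).1 hz)
  have hcont : ∀ ν ∈ ({-1, 0, 1} : Finset ℤ), ContinuousOn (integrand q (s * (q : ℂ) ^ (2 * m)) u
      t v lam (x * (q : ℂ) ^ (2 * ν)) y) (γ.toFun '' Icc 0 1) := fun ν hν =>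
    (hadm m (by simp) ν hν).continuousOn_integrand hq0 hq1 (mul_ne_zero hs (hqz _)) hu ht hv
      (mul_ne_zero hx (hqz _)) hy
  have key := γ.integral_congr hpt
  -- The `q²`-difference of the primitive integrates to zero.
  have hrhs : ∀ A B : ℂ, γ.integral (fun z => A * integrand q s u t v lam x y z
      + B * ((q : ℂ) ^ 2 * primitive q s u t v lam x y ((q : ℂ) ^ 2 * z)
        - primitive q s u t v lam x y z)) = A * γ.integral (integrand q s u t v lam x y) :=
    fun A B => by
      rw [Contour.integral_add γ (F := fun z => A * integrand q s u t v lam x y z)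
        (continuousOn_const.mul (A0.continuousOn_integrand hq0 hq1 hs hu ht hv hx hy))
        (G := fun z => B * ((q : ℂ) ^ 2 * primitive q s u t v lam x y ((q : ℂ) ^ 2 * z)
          - primitive q s u t v lam x y z)) (continuousOn_const.mul (c2.sub c1)), Contour.integral_const_mul,
        Contour.integral_const_mul, Contour.integral_sub γ c2 c1, hint, sub_self, mul_zero,
        add_zero]
  rw [hrhs, Contour.integral_sum γ _ (F := fun ν z => coefFirst q u t v x ν *
    coefStep q m ν s lam x * integrand q (s * (q : ℂ) ^ (2 * m)) u t v lam
      (x * (q : ℂ) ^ (2 * ν)) y z) (fun ν hν => continuousOn_const.mul (hcont ν hν))] at key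
  rw [A0.overlap1_eq hq0 hq1 hs hu ht hv hx hy, mul_left_comm, ← key, Finset.mul_sum]
  refine Finset.sum_congr rfl fun ν hν => ?_
  rw [(hadm m (by simp) ν hν).overlap1_eq hq0 hq1 (mul_ne_zero hs (hqz _)) hu ht hv
    (mul_ne_zero hx (hqz _)) hy, Contour.integral_const_mul]
  ring

end AWOverlap

end

noncomputable section

namespace AWOverlap

open Complex

/-! ### The difference equations -/

theorem sum_piFinset_succ {n : ℕ} (S : Fin (n + 1) → Finset ℤ) (f : (Fin (n + 1) → ℤ) → ℂ) :
    ∑ ν ∈ Fintype.piFinset S, f ν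
      = ∑ ν ∈ Fintype.piFinset (Fin.tail S), ∑ a ∈ S 0, f (Fin.cons a ν) := by
  rw [Finset.sum_comm, ← Finset.sum_product']
  refine (Finset.sum_bij' (fun p _ => (Fin.cons p.1 p.2 : Fin (n + 1) → ℤ))
    (fun ν _ => (ν 0, Fin.tail ν)) ?_ ?_ ?_ ?_ ?_).symm
  · rintro ⟨a, ν⟩ h
    rw [Finset.mem_product] at h
    rw [Fin.mem_piFinset_iff_zero_tail]
    simpa using h
  · intro ν h
    rw [Fin.mem_piFinset_iff_zero_tail] at h
    exact Finset.mem_product.2 h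
  · rintro ⟨a, ν⟩ -
    simp
  · intro ν _
    exact Fin.cons_self_tail ν
  · rintro ⟨a, ν⟩ -
    rfl

theorem snoc_mem_snoc {n : ℕ} {S : Fin n → Finset ℤ} {ν : Fin n → ℤ}
    (hν : ν ∈ Fintype.piFinset S) (i : Fin (n + 1)) :
    (Fin.snoc (α := fun _ => ℤ) ν 0 : Fin (n + 1) → ℤ) i
      ∈ (Fin.snoc (α := fun _ => Finset ℤ) S {0} : Fin (n + 1) → Finset ℤ) i := by
  induction i using Fin.lastCases with
  | last => simp
  | cast i =>
    rw [Fin.snoc_castSucc, Fin.snoc_castSucc]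
    exact Fintype.mem_piFinset.1 hν i

theorem next_mem_next {n : ℕ} {S : Fin n → Finset ℤ} {ν : Fin n → ℤ}
    (hν : ν ∈ Fintype.piFinset S) (i : Fin n) : next 0 ν i ∈ next {0} S i :=
  snoc_mem_snoc hν i.succ

theorem next_cons_zero {R : Type} {n : ℕ} (e a : R) (ν : Fin n → R) :
    next e (Fin.cons a ν : Fin (n + 1) → R) 0
      = (Fin.snoc (α := fun _ => R) ν e : Fin (n + 1) → R) 0 := by
  rw [next, ← Fin.cons_snoc_eq_snoc_cons, Fin.cons_succ]

theorem next_cons_succ {R : Type} {n : ℕ} (e a : R) (ν : Fin n → R) (i : Fin n) :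
    next e (Fin.cons a ν : Fin (n + 1) → R) i.succ = next e ν i := by
  rw [next, ← Fin.cons_snoc_eq_snoc_cons, Fin.cons_succ, next]

/-- A product of matrices `M i`, each of which sends `D i` to a multiple of `D (i + 1)`, applied to
the first vector. -/
theorem sum_prod_transfer (n : ℕ) : ∀ (S : Fin n → Finset ℤ) (M : Fin n → ℤ → ℤ → ℂ)
    (D : Fin (n + 1) → ℤ → ℂ) (φ : Fin n → ℂ),
    (∀ i, ∀ m ∈ next {0} S i, ∑ ν ∈ S i, D i.castSucc ν * M i ν m = D i.succ m * φ i) →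
    ∑ ν ∈ Fintype.piFinset S, D 0 ((Fin.snoc (α := fun _ => ℤ) ν 0 : Fin (n + 1) → ℤ) 0) *
      ∏ i, M i (ν i) (next 0 ν i) = D (Fin.last n) 0 * ∏ i, φ i := by
  induction n with
  | zero =>
    intro S M D φ _
    simp [Fin.snoc]
  | succ n ih =>
    intro S M D φ h
    have key := ih (Fin.tail S) (Fin.tail M) (Fin.tail D) (Fin.tail φ) fun i m hm =>
      h i.succ m (by rwa [← Fin.cons_self_tail S, next_cons_succ])
    rw [sum_piFinset_succ, Fin.prod_univ_succ, mul_left_comm]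
    refine Eq.trans (Finset.sum_congr rfl fun ν hν => ?_)
      ((Finset.mul_sum _ _ _).symm.trans (congrArg (φ 0 * ·) key))
    -- The first index occurs only in the first vector and in `M 0`. Summing over it replaces the
    -- vector `D 0` by `D 1` times `φ 0`, and the induction hypothesis handles the rest.
    have h0 := h 0 ((Fin.snoc (α := fun _ => ℤ) ν 0 : Fin (n + 1) → ℤ) 0) (by
      have := snoc_mem_snoc hν 0
      rwa [← next_cons_zero {0} (S 0), Fin.cons_self_tail] at this)
    rw [← mul_assoc, mul_comm (φ 0), show Fin.tail D 0 = D (Fin.succ 0) from rfl, ← h0,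
      Finset.sum_mul]
    refine Finset.sum_congr rfl fun a _ => ?_
    rw [Fin.prod_univ_succ, next_cons_zero, ← Fin.cons_snoc_eq_snoc_cons, Fin.cons_zero, mul_assoc]
    simp only [Fin.cons_zero, Fin.cons_succ, next_cons_succ, Fin.castSucc_zero, Fin.tail]

/-- The univariate relation in position `i` needs the genericity of every pair of shifts of `x_i`
and `x_{i+1}`. Each such pair is extended by zeros to an admissible shift vector. -/
theorem exists_mem_piFinset {n : ℕ} {S : Fin n → Finset ℤ} (hS : ∀ i, 0 ∈ S i) {i : Fin n}
    {a m : ℤ} (ha : a ∈ S i) (hm : m ∈ next {0} S i) :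
    ∃ ν ∈ Fintype.piFinset S, ν i = a ∧ next 0 ν i = m := by
  -- The additional last slot stands for the entry after the final position, where only the shift
  -- `0` is allowed.
  set V : Fin (n + 1) → ℤ := fun k => if k = i.castSucc then a else if k = i.succ then m else 0
  have hV : ∀ k, V k ∈ (Fin.snoc (α := fun _ => Finset ℤ) S {0} : Fin (n + 1) → Finset ℤ) k := by
    intro k
    by_cases h1 : k = i.castSucc
    · simp only [V, h1, if_true, Fin.snoc_castSucc, ha]
    by_cases h2 : k = i.succ
    · subst h2
      simp only [V, h1, if_true, if_false]
      exact hm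
    simp only [V, h1, h2, if_false]
    induction k using Fin.lastCases with
    | last => simp
    | cast k =>
      rw [Fin.snoc_castSucc]
      exact hS k
  have hsnoc : ∀ k, (Fin.snoc (α := fun _ => ℤ) (fun j => V j.castSucc) 0 : Fin (n + 1) → ℤ) k
      = V k := by
    intro k
    induction k using Fin.lastCases with
    | last =>
      have := hV (Fin.last n)
      rw [Fin.snoc_last, Finset.mem_singleton] at this
      rw [Fin.snoc_last, this]
    | cast k => rw [Fin.snoc_castSucc]
  refine ⟨fun j => V j.castSucc, Fintype.mem_piFinset.2 fun j => ?_, by simp [V], ?_⟩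
  · have := hV j.castSucc
    rwa [Fin.snoc_castSucc] at this
  · have h : i.succ ≠ i.castSucc := by
      rw [Ne, Fin.ext_iff]
      simp
    rw [next, hsnoc]
    simp only [V, h, if_false, if_true]

theorem next_shiftVec (q : ℝ) {n : ℕ} (e : ℂ) (ν : Fin n → ℤ) (x : Fin n → ℂ) (i : Fin n) :
    next e (shiftVec q ν x) i = next e x i * (q : ℂ) ^ (2 * next 0 ν i) := by
  cases n with
  | zero => exact i.elim0
  | succ n =>
    induction i using Fin.lastCases with
    | last => rw [next_last, next_last, next_last, mul_zero, zpow_zero, mul_one]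
    | cast i => rw [next_castSucc, next_castSucc, next_castSucc, shiftVec]

section Shifts

variable {q : ℝ} {N : ℕ} {α : Params N} {x y : Fin N → ℂ} {j : Fin N}

theorem overlapN_eq_prod_of_generic (h : Generic q α x y) (hq0 : 0 < q) (hq1 : q < 1)
    (hs : α.s ≠ 0) (hu : α.u ≠ 0) (ht : α.t ≠ 0) (hv : α.v ≠ 0) (hx : ∀ j, x j ≠ 0)
    (hy : ∀ j, y j ≠ 0) : overlapN q α x y
      = ∏ j, overlap1 q (next α.s x j) α.u (prev α.t y j) α.v (α.lam j) 0 (x j) (y j) := by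
  obtain ⟨C, hC⟩ := h.exists_admissibleN hq0 hq1 hu hv hx hy
  exact hC.overlapN_eq_prod hq0 hq1 hs hu ht hv hx hy

/-- The univariate relation in the `i`-th variable. -/
theorem overlap1_contiguous_shifts (hq0 : 0 < q) (hq1 : q < 1) (hs : α.s ≠ 0) (hu : α.u ≠ 0)
    (ht : α.t ≠ 0) (hv : α.v ≠ 0) (hx : ∀ j, x j ≠ 0) (hy : ∀ j, y j ≠ 0)
    (hgen : ∀ ν ∈ shifts j, Generic q α (shiftVec q ν x) y)
    (hreg : ∀ i ≤ j, x i ^ 2 ≠ 1 ∧ x i ^ 2 ≠ (q : ℂ) ^ 2 ∧ x i ^ 2 ≠ ((q : ℂ) ^ 2)⁻¹)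
    {i : Fin N} (hi : i ≤ j) {m : ℤ}
    (hm : m ∈ next {0} (fun i => if i ≤ j then ({-1, 0, 1} : Finset ℤ) else {0}) i) :
    ∑ ν ∈ ({-1, 0, 1} : Finset ℤ), coefFirst q α.u (prev α.t y i) α.v (x i) ν *
        (coefStep q m ν (next α.s x i) (α.lam i) (x i) *
        overlap1 q (next α.s x i * (q : ℂ) ^ (2 * m)) α.u (prev α.t y i) α.v (α.lam i) 0
          (x i * (q : ℂ) ^ (2 * ν)) (y i))
      = coefFirst q α.u (y i) α.v (next α.s x i) m *
        overlap1 q (next α.s x i) α.u (prev α.t y i) α.v (α.lam i) 0 (x i) (y i) := by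
  have hS : ∀ k, 0 ∈ (if k ≤ j then ({-1, 0, 1} : Finset ℤ) else {0}) := fun k => by
    split_ifs <;> simp
  have hzero : (0 : ℤ) ∈ next {0} (fun i => if i ≤ j then ({-1, 0, 1} : Finset ℤ) else {0}) i :=
    next_mem_next (ν := fun _ => 0) (Fintype.mem_piFinset.2 hS) i |> fun h => by
      have h0 : next (0 : ℤ) (fun _ : Fin N => (0 : ℤ)) i = 0 := by
        cases N with
        | zero => exact i.elim0
        | succ n =>
          induction i using Fin.lastCases with
          | last => rw [next_last]
          | cast i => rw [next_castSucc]
      rwa [h0] at h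
  refine overlap1_contiguous hq0 hq1 (next_ne_zero hs hx i) hu (prev_ne_zero ht hy i) hv (hx i)
    (hy i) (hreg i hi).1 (hreg i hi).2.1 (hreg i hi).2.2 ?_ ?_
  · cases N with
    | zero => exact i.elim0
    | succ n =>
      induction i using Fin.lastCases with
      | last =>
        rw [next_last, Finset.mem_singleton] at hm
        simp [hm]
      | cast i =>
        rw [next_castSucc] at hm
        split_ifs at hm
        · exact hm
        · rw [Finset.mem_singleton] at hm
          simp [hm]
  · intro m' hm' ν hν
    have hm'' : m' ∈ next {0} (fun i => if i ≤ j then ({-1, 0, 1} : Finset ℤ) else {0}) i := by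
      rcases Finset.mem_insert.1 hm' with rfl | h
      · exact hzero
      · rwa [Finset.mem_singleton.1 h]
    obtain ⟨V, hV, h1, h2⟩ := exists_mem_piFinset hS (a := ν) (by rwa [if_pos hi]) hm''
    have := hgen V hV i
    rwa [next_shiftVec, h2, shiftVec, h1] at this

theorem sum_coefTotal_mul_overlapN (hq0 : 0 < q) (hq1 : q < 1) (hs : α.s ≠ 0) (hu : α.u ≠ 0)
    (ht : α.t ≠ 0) (hv : α.v ≠ 0) (hx : ∀ j, x j ≠ 0) (hy : ∀ j, y j ≠ 0)
    (hgen : ∀ ν ∈ shifts j, Generic q α (shiftVec q ν x) y)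
    (hreg : ∀ i ≤ j, x i ^ 2 ≠ 1 ∧ x i ^ 2 ≠ (q : ℂ) ^ 2 ∧ x i ^ 2 ≠ ((q : ℂ) ^ 2)⁻¹) :
    ∑ ν ∈ shifts j, coefTotal q α x j ν * overlapN q α (shiftVec q ν x) y
      = coefFirst q α.u (y j) α.v (next α.s x j) 0 * overlapN q α x y := by
  have hq' : (q : ℂ) ≠ 0 := by exact_mod_cast hq0.ne'
  set S : Fin N → Finset ℤ := fun i => if i ≤ j then {-1, 0, 1} else {0} with hSdef
  have h0 : Generic q α x y := by
    have := hgen (fun _ => 0) (Fintype.mem_piFinset.2 fun k => by split_ifs <;> simp)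
    have e : shiftVec q (fun _ => 0) x = x := by
      funext k
      simp [shiftVec]
    rwa [e] at this
  -- In position `k` the vector belongs to the pair formed by the predecessor of `y_k` and by `x_k`.
  -- After position `j` it is kept constant, equal to the vector that the relation in position `j`
  -- produces.
  set D : Fin (N + 1) → ℤ → ℂ := fun k m =>
    if k ≤ j.castSucc then
      coefFirst q α.u ((Fin.cons (α := fun _ => ℂ) α.t y : Fin (N + 1) → ℂ) k) α.v
        ((Fin.snoc (α := fun _ => ℂ) x α.s : Fin (N + 1) → ℂ) k) m
    else coefFirst q α.u (y j) α.v (next α.s x j) m with hD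
  set M : Fin N → ℤ → ℤ → ℂ := fun i ν m =>
    (if i ≤ j then coefStep q m ν (next α.s x i) (α.lam i) (x i) else 1) *
      overlap1 q (next α.s x i * (q : ℂ) ^ (2 * m)) α.u (prev α.t y i) α.v (α.lam i) 0
        (x i * (q : ℂ) ^ (2 * ν)) (y i) with hM
  have key := sum_prod_transfer N S M D (fun i =>
    overlap1 q (next α.s x i) α.u (prev α.t y i) α.v (α.lam i) 0 (x i) (y i)) (by
    intro i m hm
    by_cases hi : i ≤ j
    · have h1 : i.castSucc ≤ j.castSucc := hi
      have h2 : D i.succ m = coefFirst q α.u (y i) α.v (next α.s x i) m := by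
        simp only [hD]
        split_ifs with h
        · rw [Fin.cons_succ, next]
        · have : i = j := le_antisymm hi (by
            rw [Fin.le_def] at h ⊢
            simp at h
            omega)
          rw [this]
      have h3 := overlap1_contiguous_shifts hq0 hq1 hs hu ht hv hx hy hgen hreg hi hm
      rw [h2, ← h3]
      simp only [hSdef, hM, hD, hi, h1, if_true, Fin.snoc_castSucc]
      rfl
    -- After position `j` nothing is shifted: only the index `0` is allowed, the matrix entry is the
    -- unshifted coefficient, and the transfer relation is trivial.
    · have h1 : ¬ i.castSucc ≤ j.castSucc := hi
      have h2 : ¬ i.succ ≤ j.castSucc := fun h => hi (by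
        rw [Fin.le_def] at h ⊢
        simp at h
        omega)
      have hm0 : m = 0 := by
        cases N with
        | zero => exact i.elim0
        | succ n =>
          induction i using Fin.lastCases with
          | last =>
            rw [next_last, Finset.mem_singleton] at hm
            exact hm
          | cast i =>
            have h4 : ¬ i.succ ≤ j := h2
            simp only [hSdef, next_castSucc, h4, if_false, Finset.mem_singleton] at hm
            exact hm
      simp only [hSdef, hM, hD, hi, h1, h2, if_false, hm0, Finset.sum_singleton, mul_zero,
        zpow_zero, mul_one, one_mul])
  have hlast : D (Fin.last N) 0 = coefFirst q α.u (y j) α.v (next α.s x j) 0 := by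
    simp only [hD]
    rw [if_neg (by simp [Fin.le_def])]
  rw [hlast, ← overlapN_eq_prod_of_generic h0 hq0 hq1 hs hu ht hv hx hy] at key
  rw [← key]
  refine Finset.sum_congr rfl fun ν hν => ?_
  rw [overlapN_eq_prod_of_generic (hgen ν hν) hq0 hq1 hs hu ht hv
    (fun k => mul_ne_zero (hx k) (zpow_ne_zero _ hq')) hy]
  simp only [hM, Finset.prod_mul_distrib, next_shiftVec]
  have hprod : ∏ i, (if i ≤ j then coefStep q (next 0 ν i) (ν i) (next α.s x i) (α.lam i) (x i)
      else 1) = ∏ i ∈ Finset.Iic j, coefFactor q α x ν i := by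
    rw [Finset.prod_ite, Finset.prod_const_one, mul_one]
    refine Finset.prod_congr ?_ fun i _ => rfl
    ext i
    simp
  have hfirst : D 0 ((Fin.snoc (α := fun _ => ℤ) ν 0 : Fin (N + 1) → ℤ) 0)
      = coefFirst q α.u α.t α.v (x ⟨0, j.pos⟩) (ν ⟨0, j.pos⟩) := by
    simp only [hD]
    rw [if_pos (Fin.zero_le _), Fin.cons_zero,
      show (0 : Fin (N + 1)) = Fin.castSucc ⟨0, j.pos⟩ from rfl, Fin.snoc_castSucc,
      Fin.snoc_castSucc]
  rw [hprod, hfirst, coefTotal]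
  simp only [shiftVec]
  ring

/-- Because `q⁻² - q²` is `(q⁻¹ + q)(q⁻¹ - q)`, the first term of `coefFirst` at `0` reduces to the
eigenvalue. The second is the constant that appears on the right of the difference equation. -/
theorem coefFirst_zero_eq_mu (hq0 : 0 < q) (u y v s : ℂ) : coefFirst q u y v s 0
    = mu q y - (u / v + v / u) * (s + s⁻¹) / (((q : ℂ) ^ 2)⁻¹ - (q : ℂ) ^ 2) := by
  have h6 : (q : ℂ)⁻¹ + q ≠ 0 := by exact_mod_cast (by positivity : (q⁻¹ + q) ≠ 0)
  rw [coefFirst, if_neg (by simp), sub_div, mu, ← inv_pow, sq_sub_sq, mul_div_mul_left _ _ h6]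

end Shifts

end AWOverlap

end

theorem mainTheorem3 (q : ℝ) (hq0 : 0 < q) (hq1 : q < 1) (N : ℕ) (α : AWOverlap.Params N)
    (hs : α.s ≠ 0) (hu : α.u ≠ 0) (ht : α.t ≠ 0) (hv : α.v ≠ 0)
    (x y : Fin N → ℂ) (hx : ∀ j, x j ≠ 0) (hy : ∀ j, y j ≠ 0) :
    -- the coefficient is well defined: contours exist and their choice is irrelevant
    (AWOverlap.Generic q α x y →
      (∃ C, AWOverlap.AdmissibleN q α x y C) ∧
      ∀ C, AWOverlap.AdmissibleN q α x y C →
        AWOverlap.overlapAlong q α x y C = AWOverlap.overlapN q α x y) ∧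
    -- factorization
    (AWOverlap.Generic q α x y →
      AWOverlap.overlapN q α x y =
        ∏ j, AWOverlap.overlap1 q (AWOverlap.next α.s x j) α.u (AWOverlap.prev α.t y j) α.v
          (α.lam j) 0 (x j) (y j)) ∧
    -- symmetry
    (AWOverlap.Generic q α.conj (AWOverlap.conjVec x) (AWOverlap.conjVec y) →
      (starRingEnd ℂ) (AWOverlap.overlapN q α.conj (AWOverlap.conjVec x) (AWOverlap.conjVec y)) =
        AWOverlap.overlapN q α.theta (AWOverlap.revVec y) (AWOverlap.revVec x)) ∧
    -- difference equations
    (∀ j : Fin N,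
      (∀ ν ∈ AWOverlap.shifts j, AWOverlap.Generic q α (AWOverlap.shiftVec q ν x) y) →
      (∀ i ≤ j, x i ^ 2 ≠ 1 ∧ x i ^ 2 ≠ (q : ℂ) ^ 2 ∧ x i ^ 2 ≠ ((q : ℂ) ^ 2)⁻¹) →
      AWOverlap.mu q (y j) * AWOverlap.overlapN q α x y =
        ∑ ν ∈ AWOverlap.shifts j, AWOverlap.coefTotal q α x j ν *
            AWOverlap.overlapN q α (AWOverlap.shiftVec q ν x) y
          + (α.u / α.v + α.v / α.u) * (AWOverlap.next α.s x j + (AWOverlap.next α.s x j)⁻¹)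
              / (((q : ℂ) ^ 2)⁻¹ - (q : ℂ) ^ 2) * AWOverlap.overlapN q α x y) := by
  refine ⟨fun h => ⟨h.exists_admissibleN hq0 hq1 hu hv hx hy, fun C hC => ?_⟩, fun h =>
    AWOverlap.overlapN_eq_prod_of_generic h hq0 hq1 hs hu ht hv hx hy,
    AWOverlap.conj_overlapN hq0 hq1 hs hu ht hv hx hy, fun j hgen hreg => ?_⟩
  · rw [hC.overlapAlong_eq_prod hq0 hq1 hs hu ht hv hx hy,
      hC.overlapN_eq_prod hq0 hq1 hs hu ht hv hx hy]
  · rw [AWOverlap.sum_coefTotal_mul_overlapN hq0 hq1 hs hu ht hv hx hy hgen hreg,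
      AWOverlap.coefFirst_zero_eq_mu hq0]
    ring
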